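/- Fix integers $k\ge 3$, $d\ge1$ and put $\alpha=d/k$. Write $0^0=0$ throughout. For $\lambda\in[0,1]$ and a discrete probability measure $\mu$ on $[0,1]$ define probability measures $\hat{\mathscr R}_\lambda\mu$ and $\dot{\mathscr R}_\lambda\mu$ on $[0,1]$ by $$\hat{\mathscr R}_\lambda\mu(B)=\frac1{\hat{\mathscr Z}(\mu)}\int\Big(2-\prod_{i=1}^{k-1}x_i-\prod_{i=1}^{k-1}(1-x_i)\Big)^{\lambda}\mathbf 1\Big\{\tfrac{1-\prod_{i}x_i}{2-\prod_{i}x_i-\prod_{i}(1-x_i)}\in B\Big\}\prod_{i=1}^{k-1}\mu(dx_i),$$ $$\dot{\mathscr R}_\lambda\mu(B)=\frac1{\dot{\mathscr Z}(\mu)}\int\Big(\prod_{i=1}^{d-1}y_i+\prod_{i=1}^{d-1}(1-y_i)\Big)^{\lambda}\mathbf 1\Big\{\tfrac{\prod_{i}y_i}{\prod_{i}y_i+\prod_{i}(1-y_i)}\in B\Big\}\prod_{i=1}^{d-1}\mu(dy_i),$$ with $\hat{\mathscr Z}(\mu),\dot{\mathscr Z}(\mu)$ the normalizing constants. Let $\dot\mu_{\lambda,0}=\frac12\delta_0+\frac12\delta_1$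 and $\dot\mu_{\lambda,l+1}=\dot{\mathscr R}_\lambda\hat{\mathscr R}_\lambda\dot\mu_{\lambda,l}$ for $l\ge0$; let $\dot\mu_\lambda$ be the limit of $\dot\mu_{\lambda,l}$ as $l\to\infty$ in the $\ell^1$ distance of point masses, among discrete probability measures on $[0,1]$, and let $\hat\mu_\lambda=\hat{\mathscr R}_\lambda\dot\mu_\lambda$. Let $\dot w_\lambda,\hat w_\lambda,\bar w_\lambda$ be the probability measures $$\dot w_\lambda(B)=\frac1{\dot{\mathfrak Z}_\lambda}\int U^\lambda\mathbf 1\{U\in B\}\prod_{i=1}^d\hat\mu_\lambda(dy_i),\quad \hat w_\lambda(B)=\frac1{\hat{\mathfrak Z}_\lambda}\int V^\lambda\mathbf 1\{V\in B\}\prod_{i=1}^k\dot\mu_\lambda(dx_i),\quad \bar w_\lambda(B)=\frac1{\bar{\mathfrak Z}_\lambda}\iint W^\lambda\mathbf 1\{W\in B\}\,\dot\mu_\lambda(dx)\hat\mu_\lambda(dy),$$ where $U=\prod_{i=1}^dy_i+\prod_{i=1}^d(1-y_i)$, $V=1-\prod_{i=1}^kx_i-\prod_{i=1}^k(1-x_i)$,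 $W=xy+(1-x)(1-y)$, and $\dot{\mathfrak Z}_\lambda,\hat{\mathfrak Z}_\lambda,\bar{\mathfrak Z}_\lambda$ are the normalizing constants. Put $$\mathfrak F(\lambda;\alpha)=\log\dot{\mathfrak Z}_\lambda+\alpha\log\hat{\mathfrak Z}_\lambda-k\alpha\log\bar{\mathfrak Z}_\lambda,\qquad s_\lambda(\alpha)=\int\log x\,\dot w_\lambda(dx)+\alpha\int\log x\,\hat w_\lambda(dx)-k\alpha\int\log x\,\bar w_\lambda(dx).$$ The complexity function $\Sigma(\cdot\,;\alpha)$ has domain $\{s_\lambda(\alpha):\lambda\in[0,1]\}$ and is defined by $\Sigma(s_\lambda(\alpha);\alpha)=\mathfrak F(\lambda;\alpha)-\lambda s_\lambda(\alpha)$. Finally let $$A=A_k=\big[(2^{k-1}-2)\log2,\;2^{k-1}\log2\big]\cap k^{-1}\mathbb Z,$$ $\alpha_{\rm cond}=\sup\{\alpha\in A:\Sigma(s_1(\alpha);\alpha)>0\}$ and $\alpha_{\rm sat}=\sup\{\alpha\in A:\Sigma(s_0(\alpha);\alpha)>0\}$. The one-step replica symmetry breaking (1RSB) free energy prediction $\mathsf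 f^{\rm 1RSB}(\alpha)$ is $2(1-2/2^k)^\alpha$ if $\alpha\le\alpha_{\rm cond}$, is $\exp[\sup\{s:\Sigma(s;\alpha)\ge0\}]$ if $\alpha_{\rm cond}<\alpha<\alpha_{\rm sat}$, and is $0$ if $\alpha>\alpha_{\rm sat}$. **Proposition.** There is an absolute constant $k_0$ such that the following holds for all $k\ge k_0$. 1. For every $\alpha\in A$, the function $\Sigma(\cdot\,;\alpha)$ is well defined, continuous and strictly decreasing on its domain. Here well defined means that for every $\lambda\in[0,1]$ all the iterates $\dot\mu_{\lambda,l}$ are discrete probability measures on $[0,1]$, the $\ell^1$ limit $\dot\mu_\lambda$ exists and is unique, $\hat\mu_\lambda$ is a discrete probability measure on $[0,1]$, the constants $\dot{\mathfrak Z}_\lambda,\hat{\mathfrak Z}_\lambda,\bar{\mathfrak Z}_\lambda$ are positive and finite, $\log$ is integrable for $\dot w_\lambda,\hat w_\lambda,\bar w_\lambda$, and $\mathfrak F(\lambda;\alpha)-\lambda s_\lambda(\alpha)$ depends on $\lambda$ only through the value $s_\lambda(\alpha)$. 2. Hence the 1RSB free energy prediction is well defined: the two sets whose suprema are $\alpha_{\rm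 cond}$ and $\alpha_{\rm sat}$ are nonempty and bounded above, and for every $\alpha\in A$ with $\alpha\ne\alpha_{\rm sat}$ the definition assigns to $\mathsf f^{\rm 1RSB}(\alpha)$ exactly one value; in particular $\{s:\Sigma(s;\alpha)\ge0\}$ is nonempty and bounded above for $\alpha_{\rm cond}<\alpha<\alpha_{\rm sat}$. -/

import Mathlib

open MeasureTheory Filter Topology Set
open scoped ENNReal

namespace NaeSat

noncomputable section

/-- The power `x ^ lam` for `x ≥ 0`, with the convention `0 ^ 0 = 0`. -/
def tpow (x lam : ℝ) : ℝ := if x = 0 then 0 else x ^ lam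

/-- The product measure `∏_{i=1}^n μ(dx_i)`. -/
def iid (n : ℕ) (μ : Measure ℝ) : Measure (Fin n → ℝ) := Measure.pi fun _ => μ

/-- The normalizing constant `∫ w(ω)^lam P(dω)`. -/
def partFn {Ω : Type} [MeasurableSpace Ω] (lam : ℝ) (P : Measure Ω) (w : Ω → ℝ) : ℝ≥0∞ :=
  ∫⁻ ω, ENNReal.ofReal (tpow (w ω) lam) ∂P

/-- The measure `B ↦ Z⁻¹ ∫ w(ω)^lam 1{g(ω) ∈ B} P(dω)`, with `Z = ∫ w(ω)^lam P(dω)`. -/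
def reweight {Ω : Type} [MeasurableSpace Ω] (lam : ℝ) (P : Measure Ω) (w g : Ω → ℝ) :
    Measure ℝ :=
  (partFn lam P w)⁻¹ •
    (P.withDensity fun ω => ENNReal.ofReal (tpow (w ω) lam)).map g

/-- `∏ x_i + ∏ (1 - x_i)`. -/
def agree {n : ℕ} (x : Fin n → ℝ) : ℝ := ∏ i, x i + ∏ i, (1 - x i)

/-- The clause recursion (a map on probability measures on `[0,1]`). -/
def clauseRec (k : ℕ) (lam : ℝ) (μ : Measure ℝ) : Measure ℝ :=
  reweight lam (iid (k - 1) μ) (fun x => 2 - agree x)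
    (fun x => (1 - ∏ i, x i) / (2 - agree x))

/-- The variable recursion (a map on probability measures on `[0,1]`). -/
def varRec (d : ℕ) (lam : ℝ) (μ : Measure ℝ) : Measure ℝ :=
  reweight lam (iid (d - 1) μ) (fun y => agree y)
    (fun y => (∏ i, y i) / agree y)

/-- The sequence of measures obtained by iterating the recursion `varRec ∘ clauseRec` from
`(δ₀ + δ₁) / 2`. -/
def dotMuSeq (k d : ℕ) (lam : ℝ) : ℕ → Measure ℝ
  | 0 => (2 : ℝ≥0∞)⁻¹ • (Measure.dirac 0 + Measure.dirac 1)
  | l + 1 => varRec d lam (clauseRec k lam (dotMuSeq k d lam l))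

/-- `μ` is a discrete probability measure on `[0,1]`. -/
def IsDiscreteProb (μ : Measure ℝ) : Prop :=
  IsProbabilityMeasure μ ∧ ∃ S : Set ℝ, S.Countable ∧ S ⊆ Icc 0 1 ∧ μ Sᶜ = 0

/-- The `ℓ¹` distance `∑_x |μ{x} - ν{x}|` of the point masses of two measures; one of the two
truncated differences is zero. -/
def atomDist (μ ν : Measure ℝ) : ℝ≥0∞ :=
  ∑' x : ℝ, ((μ {x} - ν {x}) + (ν {x} - μ {x}))

/-- `μ` is the `ℓ¹` limit of the iterates `dotMuSeq k d lam l` as `l → ∞`. -/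
def IsDotMu (k d : ℕ) (lam : ℝ) (μ : Measure ℝ) : Prop :=
  IsDiscreteProb μ ∧ Tendsto (fun l => atomDist (dotMuSeq k d lam l) μ) atTop (𝓝 0)

/-- The `ℓ¹` limit of the iterates (meaningful when it exists; it is then unique). -/
def dotMu (k d : ℕ) (lam : ℝ) : Measure ℝ := Classical.epsilon (IsDotMu k d lam)

/-- The clause-to-variable measure belonging to `dotMu`. -/
def hatMu (k d : ℕ) (lam : ℝ) : Measure ℝ := clauseRec k lam (dotMu k d lam)

/-- The local weight of an edge, for the pair `(x, y)` of messages on it. -/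
def edgeWt (p : ℝ × ℝ) : ℝ := p.1 * p.2 + (1 - p.1) * (1 - p.2)

/-- Normalizing constant of `dotW`. -/
def dotZ (k d : ℕ) (lam : ℝ) : ℝ≥0∞ := partFn lam (iid d (hatMu k d lam)) agree

/-- Normalizing constant of `hatW`. -/
def hatZ (k d : ℕ) (lam : ℝ) : ℝ≥0∞ :=
  partFn lam (iid k (dotMu k d lam)) (fun x => 1 - agree x)

/-- Normalizing constant of `barW`. -/
def barZ (k d : ℕ) (lam : ℝ) : ℝ≥0∞ :=
  partFn lam ((dotMu k d lam).prod (hatMu k d lam)) edgeWt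

/-- The tilted law of the variable weight `∏_{i ≤ d} y_i + ∏_{i ≤ d} (1 - y_i)`. -/
def dotW (k d : ℕ) (lam : ℝ) : Measure ℝ :=
  reweight lam (iid d (hatMu k d lam)) agree agree

/-- The tilted law of the clause weight `1 - ∏_{i ≤ k} x_i - ∏_{i ≤ k} (1 - x_i)`. -/
def hatW (k d : ℕ) (lam : ℝ) : Measure ℝ :=
  reweight lam (iid k (dotMu k d lam)) (fun x => 1 - agree x) (fun x => 1 - agree x)

/-- The tilted law of the edge weight `x y + (1 - x) (1 - y)`. -/
def barW (k d : ℕ) (lam : ℝ) : Measure ℝ :=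
  reweight lam ((dotMu k d lam).prod (hatMu k d lam)) edgeWt edgeWt

/-- The clause density `α = d / k`. -/
def density (k d : ℕ) : ℝ := (d : ℝ) / k

/-- `α_lbd = (2^{k-1} - 2) log 2`. -/
def alphaLbd (k : ℕ) : ℝ := ((2 : ℝ) ^ (k - 1) - 2) * Real.log 2

/-- `α_ubd = 2^{k-1} log 2`. -/
def alphaUbd (k : ℕ) : ℝ := (2 : ℝ) ^ (k - 1) * Real.log 2

/-- `𝔉(lam; α)` for `α = d / k`. -/
def bigF (k d : ℕ) (lam : ℝ) : ℝ :=
  Real.log (dotZ k d lam).toReal + density k d * Real.log (hatZ k d lam).toReal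
    - k * density k d * Real.log (barZ k d lam).toReal

/-- `s_lam(α)` for `α = d / k`. -/
def sParam (k d : ℕ) (lam : ℝ) : ℝ :=
  ∫ x, Real.log x ∂(dotW k d lam) + density k d * ∫ x, Real.log x ∂(hatW k d lam)
    - k * density k d * ∫ x, Real.log x ∂(barW k d lam)

/-- All objects entering `bigF k d lam` and `sParam k d lam` are well defined: the iterates are
discrete probability measures, they have exactly one limit in `ℓ¹`, the normalizing constants are
positive and finite, and the logarithm is integrable. -/
def ParamsDefined (k d : ℕ) (lam : ℝ) : Prop :=
  (∀ l, IsDiscreteProb (dotMuSeq k d lam l)) ∧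
  (∃! μ, IsDotMu k d lam μ) ∧
  IsDiscreteProb (hatMu k d lam) ∧
  (0 < dotZ k d lam ∧ dotZ k d lam < ∞) ∧
  (0 < hatZ k d lam ∧ hatZ k d lam < ∞) ∧
  (0 < barZ k d lam ∧ barZ k d lam < ∞) ∧
  Integrable Real.log (dotW k d lam) ∧
  Integrable Real.log (hatW k d lam) ∧
  Integrable Real.log (barW k d lam)

/-- The set of all `s_lam`, `lam ∈ [0,1]`: the domain of the complexity function. -/
def sDomain (k d : ℕ) : Set ℝ := sParam k d '' Icc 0 1

/-- The complexity function `Σ(s; α)`, `α = d / k`: for `s` in the domain, pick `lam ∈ [0,1]` with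
`s = s_lam` and set `Σ(s) = 𝔉(lam) - lam * s`. That the choice of `lam` does not matter is part of
what the theorem asserts. -/
def complexity (k d : ℕ) (s : ℝ) : ℝ :=
  let lam := Classical.epsilon fun t : ℝ => t ∈ Icc (0 : ℝ) 1 ∧ sParam k d t = s
  bigF k d lam - lam * s

/-- `α = d / k` lies in `A = [α_lbd, α_ubd] ∩ k⁻¹ℤ`. -/
def InRange (k d : ℕ) : Prop := density k d ∈ Icc (alphaLbd k) (alphaUbd k)

/-- `{α ∈ A : Σ(s_lam(α); α) > 0}`. -/
def posSet (k : ℕ) (lam : ℝ) : Set ℝ :=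
  {α | ∃ d : ℕ, α = density k d ∧ InRange k d ∧ 0 < complexity k d (sParam k d lam)}

/-- `α_cond = sup {α : Σ(s_1(α); α) > 0}`. -/
def alphaCond (k : ℕ) : ℝ := sSup (posSet k 1)

/-- `α_sat = sup {α : Σ(s_0(α); α) > 0}`. -/
def alphaSat (k : ℕ) : ℝ := sSup (posSet k 0)

/-- `f` is a value of the one-step replica symmetry breaking free energy at `α = d / k`
according to its piecewise definition. -/
def IsFreeEnergy (k d : ℕ) (f : ℝ) : Prop :=
  (density k d ≤ alphaCond k → f = 2 * (1 - 2 / (2 : ℝ) ^ k) ^ density k d) ∧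
  (alphaCond k < density k d → density k d < alphaSat k →
    ∃ t, IsLUB {s | s ∈ sDomain k d ∧ 0 ≤ complexity k d s} t ∧ f = Real.exp t) ∧
  (alphaSat k < density k d → f = 0)

end

end NaeSat

/-! ### Weighted ℓ¹ spaces and their convolution algebras. -/

namespace NaeSat

noncomputable section

set_option linter.unusedSectionVars false

/-! Put n = k - 1 and h = 2^(-n). The exponent λ is made complex, z in the strip -1/2 < Re z < 3/2,
and message laws become elements of weighted ℓ¹ spaces, so that everything depends holomorphically
on z. Bounds on values then give bounds on derivatives by Cauchy's estimates, and no derivative of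
the fixed point is ever estimated.

A symmetric message law is, up to a scalar, δ_0 + δ_1 + p with p carried by the free messages in
(0,1). Messages multiply coordinatewise as pairs (x, 1 - x), so products of independent messages are
powers in a convolution algebra; since the tilting weights are multiplicative, the normalization of
the pairs can be postponed. In these coordinates one round of message passing is the map `TT`. A
clause forces a variable with relative weight about h, and α ∈ A means d h = (n+1) log 2 + O(n h),
so a variable escapes all forcing with relative weight about e^(-dh) ≈ h/2. Hence `TT` maps the ball
of radius `rad`, of order n^(-2), into the ball of radius 72 h (`norm_TT_le`), and Schwarz's lemma
turns this into a contraction (`norm_TT_sub_le`). The fixed point is a uniform limit of holomorphic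
iterates, hence holomorphic in z (`differentiableOn_fixp`); for λ ∈ [0,1] it is the ℓ¹ limit of the
iterates (`dotMuSeq_eq`, `dotMu_eq`).

The free energy 𝔉 equals log `DD` - (dn/(n+1)) log `HH`, with the variable and the clause partition
functions. The duality `UU_mul_flipL` makes it stationary in the message at the fixed point, so only
the explicit dependence on λ contributes to d𝔉/dλ, and this is s_λ (`hasDerivAt_Fc`, `sParam_eq`).
The first order effect of p cancels between the clause terms, which gives 𝔉 = log 2 + α log(1 - h) +
(h/4)(2^z - 2) + O(n³h²) uniformly on the strip (`Fc_approx`). By Cauchy, 𝔉'' > 0 on [0,1]. Thus s_λ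
is strictly increasing, and 𝔉 - λ s_λ has derivative -λ s_λ', negative for λ in (0,1]; this is all
that is needed for Σ.

For the thresholds, raising d by one lowers the main term by at least h/(n+1), which exceeds the
errors, so Σ(s_0) decreases in α (`bigF_zero_lt`) and is positive everywhere below α_sat. At the
lower end of A even Σ(s_1) is positive (`complexity_one_pos`), so both sets are nonempty, and Σ(s_1)
< Σ(s_0) gives α_cond ≤ α_sat. -/

/-- A weight function bounded below by one. -/
structure Weight (I : Type*) where
  /-- The values of the weight. -/
  toFun : I → ℝ
  one_le' : ∀ i, 1 ≤ toFun i

instance {I : Type*} : CoeFun (Weight I) fun _ => I → ℝ := ⟨Weight.toFun⟩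

lemma Weight.one_le {I : Type*} (w : Weight I) (i : I) : 1 ≤ w i := w.one_le' i
lemma Weight.pos {I : Type*} (w : Weight I) (i : I) : 0 < w i := zero_lt_one.trans_le (w.one_le i)
lemma Weight.ne_zero {I : Type*} (w : Weight I) (i : I) : (w i : ℂ) ≠ 0 := by
  exact_mod_cast (w.pos i).ne'

/-- The weighted `ℓ¹` space `{a : I → ℂ | ∑ ‖a i‖ w i < ∞}` (stored in rescaled coordinates). -/
def L1 {I : Type*} (_w : Weight I) : Type _ := lp (fun _ : I => ℂ) 1

namespace L1

variable {I : Type*} {w : Weight I}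

instance : NormedAddCommGroup (L1 w) := inferInstanceAs (NormedAddCommGroup (lp (fun _ : I => ℂ) 1))
instance : NormedSpace ℂ (L1 w) := inferInstanceAs (NormedSpace ℂ (lp (fun _ : I => ℂ) 1))
instance : CompleteSpace (L1 w) := inferInstanceAs (CompleteSpace (lp (fun _ : I => ℂ) 1))

open scoped Classical in
/-- The basis vector at `i`, of norm `w i`. -/
def delta (w : Weight I) (i : I) : L1 w := (w i : ℂ) • (lp.single 1 i (1 : ℂ) : lp (fun _ : I => ℂ) 1)

/-- The rescaled coordinates. -/
def raw (a : L1 w) : I → ℂ := fun i => (show lp (fun _ : I => ℂ) 1 from a) i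

lemma raw_add (a b : L1 w) (i : I) : raw (a + b) i = raw a i + raw b i := rfl
lemma raw_smul (c : ℂ) (a : L1 w) (i : I) : raw (c • a) i = c * raw a i := rfl

lemma hasSum_raw (a : L1 w) : HasSum (fun i => ‖raw a i‖) ‖a‖ := by
  have := lp.hasSum_norm (p := 1) (by simp) (show lp (fun _ : I => ℂ) 1 from a)
  simp only [ENNReal.toReal_one, Real.rpow_one] at this
  exact this

lemma raw_bound {F : Type*} [NormedAddCommGroup F] [NormedSpace ℂ F] {v : I → F} {C : ℝ}
    (h : ∀ i, ‖v i‖ ≤ C * w i) (a : L1 w) (i : I) :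
    ‖(raw a i * (w i : ℂ)⁻¹) • v i‖ ≤ ‖raw a i‖ * C := by
  have hw := w.pos i
  rw [norm_smul, norm_mul, norm_inv, Complex.norm_real, Real.norm_of_nonneg hw.le, mul_assoc]
  refine mul_le_mul_of_nonneg_left ?_ (norm_nonneg _)
  rw [inv_mul_le_iff₀ hw]
  linarith [h i]

lemma summable_aux {F : Type*} [NormedAddCommGroup F] [NormedSpace ℂ F] [CompleteSpace F]
    {v : I → F} {C : ℝ} (h : ∀ i, ‖v i‖ ≤ C * w i) (a : L1 w) :
    Summable fun i => (raw a i * (w i : ℂ)⁻¹) • v i :=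
  Summable.of_norm_bounded ((hasSum_raw a).summable.mul_right C) (raw_bound h a)

variable {F : Type*} [NormedAddCommGroup F] [NormedSpace ℂ F] [CompleteSpace F]

open scoped Classical in
/-- The continuous linear map with `delta i ↦ v i` (zero if `v` is not bounded by a multiple of
the weight). -/
def lift (w : Weight I) (v : I → F) : L1 w →L[ℂ] F :=
  if h : ∃ C, ∀ i, ‖v i‖ ≤ C * w i then
    LinearMap.mkContinuous
      { toFun := fun a => ∑' i, (raw a i * (w i : ℂ)⁻¹) • v i
        map_add' := fun a b => by
          rw [← (summable_aux h.choose_spec a).tsum_add (summable_aux h.choose_spec b)]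
          simp only [raw_add, add_mul, add_smul]
        map_smul' := fun c a => by
          simp only [raw_smul, RingHom.id_apply]
          rw [← (summable_aux h.choose_spec a).tsum_const_smul]
          simp only [mul_assoc, mul_smul] }
      h.choose
      (fun a => by
        have := tsum_of_norm_bounded ((hasSum_raw a).mul_right h.choose) (raw_bound h.choose_spec a)
        simpa [mul_comm] using this)
  else 0

/-- The `i`-th coordinate. -/
def coef (i : I) (a : L1 w) : ℂ := raw a i * (w i : ℂ)⁻¹

lemma hasSum_lift {v : I → F} {C : ℝ} (h : ∀ i, ‖v i‖ ≤ C * w i) (a : L1 w) :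
    HasSum (fun i => coef i a • v i) (lift w v a) := by
  have h' : ∃ C, ∀ i, ‖v i‖ ≤ C * w i := ⟨C, h⟩
  rw [lift, dif_pos h']
  exact (summable_aux h a).hasSum

open scoped Classical in
lemma raw_delta (i j : I) : raw (delta w i) j = if j = i then (w i : ℂ) else 0 := by
  have : raw (delta w i) j = (w i : ℂ) * (lp.single 1 i (1 : ℂ) : lp (fun _ : I => ℂ) 1) j := rfl
  rw [this, lp.single_apply]
  by_cases hj : j = i
  · subst hj; simp
  · simp [hj]

open scoped Classical in
lemma coef_delta (i j : I) : coef j (delta w i) = if j = i then 1 else 0 := by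
  rw [coef, raw_delta]
  split_ifs with hj
  · subst hj; exact mul_inv_cancel₀ (w.ne_zero _)
  · simp

lemma lift_delta {v : I → F} {C : ℝ} (h : ∀ i, ‖v i‖ ≤ C * w i) (i : I) :
    lift w v (delta w i) = v i := by
  classical
  refine (hasSum_lift h _).unique ?_
  convert hasSum_single i ?_ using 1
  · simp [coef_delta]
  · intro j hj; simp [coef_delta, hj]

lemma hasSum_norm (a : L1 w) : HasSum (fun i => ‖coef i a‖ * w i) ‖a‖ := by
  convert hasSum_raw a using 2 with i
  rw [coef, norm_mul, norm_inv, Complex.norm_real, Real.norm_of_nonneg (w.pos i).le,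
    mul_assoc, inv_mul_cancel₀ (w.pos i).ne', mul_one]

lemma hasSum_delta (a : L1 w) : HasSum (fun i => coef i a • delta w i) a := by
  classical
  have := lp.hasSum_single (p := 1) (by simp) (show lp (fun _ : I => ℂ) 1 from a)
  refine this.congr_fun ?_
  intro i
  have e : (lp.single 1 i (raw a i) : lp (fun _ : I => ℂ) 1)
      = raw a i • (lp.single 1 i (1 : ℂ) : lp (fun _ : I => ℂ) 1) := by
    rw [← lp.single_smul, smul_eq_mul, mul_one]
  show coef i a • ((w i : ℂ) • (lp.single 1 i (1 : ℂ) : lp (fun _ : I => ℂ) 1)) = _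
  rw [smul_smul, coef, mul_assoc, inv_mul_cancel₀ (w.ne_zero i), mul_one]
  exact e.symm

lemma norm_delta (i : I) : ‖delta w i‖ = w i := by
  classical
  refine (hasSum_norm (delta w i)).unique ?_
  convert hasSum_single i ?_ using 1
  · simp [coef_delta]
  · intro j hj; simp [coef_delta, hj]

lemma norm_lift_apply_le {v : I → F} {C : ℝ} (h : ∀ i, ‖v i‖ ≤ C * w i) (a : L1 w) :
    ‖lift w v a‖ ≤ C * ‖a‖ := by
  refine (hasSum_lift h a).norm_le_of_bounded ((hasSum_norm a).mul_left C) fun i => ?_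
  rw [norm_smul]
  calc _ ≤ ‖coef i a‖ * (C * w i) := mul_le_mul_of_nonneg_left (h i) (norm_nonneg _)
    _ = _ := by ring

lemma norm_lift_le {v : I → F} {C : ℝ} (hC : 0 ≤ C) (h : ∀ i, ‖v i‖ ≤ C * w i) :
    ‖lift w v‖ ≤ C :=
  ContinuousLinearMap.opNorm_le_bound _ hC (norm_lift_apply_le h)

/-- Every element is the convergent sum of its multiples of basis vectors. Almost all identities
between functionals below are reduced in this way to identities between numbers; multilinear ones
are treated one variable at a time. -/
lemma clm_ext {f g : L1 w →L[ℂ] F} (h : ∀ i, f (delta w i) = g (delta w i)) : f = g := by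
  ext a
  have hf := (hasSum_delta a).mapL f
  have hg := (hasSum_delta a).mapL g
  simp only [map_smul, h] at hf hg
  exact hf.unique hg

open scoped Classical in
lemma coef_bound (i : I) (j : I) :
    ‖(if j = i then (1 : ℂ) else 0)‖ ≤ 1 * w j := by
  split_ifs
  · simpa using w.one_le j
  · simpa using (w.pos j).le

open scoped Classical in
lemma coef_eq_lift (i : I) (a : L1 w) :
    coef i a = lift w (fun j => if j = i then (1 : ℂ) else 0) a := by
  refine HasSum.unique ?_ (hasSum_lift (coef_bound i) a)
  convert hasSum_single i ?_ using 1
  · simp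
  · intro j hj; simp [hj]

lemma coef_add (i : I) (a b : L1 w) : coef i (a + b) = coef i a + coef i b := by
  simp only [coef_eq_lift, map_add]
lemma coef_smul (i : I) (c : ℂ) (a : L1 w) : coef i (c • a) = c * coef i a := by
  simp only [coef_eq_lift, map_smul, smul_eq_mul]
lemma coef_zero (i : I) : coef i (0 : L1 w) = 0 := by
  simp only [coef_eq_lift, map_zero]
lemma continuous_coef (i : I) : Continuous (coef i : L1 w → ℂ) := by
  have : (coef i : L1 w → ℂ) = fun a => coef i a := rfl
  simp only [this, coef_eq_lift]
  exact ContinuousLinearMap.continuous _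

lemma summable_coef (a : L1 w) : Summable fun i => ‖coef i a‖ :=
  (hasSum_norm a).summable.of_nonneg_of_le (fun _ => norm_nonneg _) fun i =>
    le_mul_of_one_le_right (norm_nonneg _) (w.one_le i)

/-! ### The convolution algebra -/

/-- A weight on a monoid with `w (x * y) ≤ w x * w y` and `w 1 = 1`. -/
class _root_.NaeSat.Submul {M : Type*} [CommMonoid M] (w : Weight M) : Prop where
  map_one : w 1 = 1
  map_mul_le : ∀ x y, w (x * y) ≤ w x * w y

variable {M : Type*} [CommMonoid M] {w : Weight M} [Submul w]

/-- Convolution as a bilinear map. -/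
def mulCLM (w : Weight M) : L1 w →L[ℂ] L1 w →L[ℂ] L1 w :=
  lift w fun x => lift w fun y => delta w (x * y)

lemma mul_bound_inner (x y : M) : ‖delta w (x * y)‖ ≤ w x * w y := by
  rw [norm_delta]; exact Submul.map_mul_le x y

lemma mul_bound_outer (x : M) : ‖lift w fun y => delta w (x * y)‖ ≤ 1 * w x := by
  rw [one_mul]
  exact norm_lift_le (w.pos x).le fun y => mul_bound_inner x y

lemma mulCLM_delta (x y : M) : mulCLM w (delta w x) (delta w y) = delta w (x * y) := by
  rw [mulCLM, lift_delta mul_bound_outer, lift_delta (mul_bound_inner x)]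

lemma clm_ext₂ {f g : L1 w →L[ℂ] L1 w →L[ℂ] F}
    (h : ∀ i j, f (delta w i) (delta w j) = g (delta w i) (delta w j)) : f = g :=
  clm_ext fun i => clm_ext fun j => h i j

lemma mulCLM_comm (a b : L1 w) : mulCLM w a b = mulCLM w b a := by
  have : mulCLM w = (mulCLM w).flip := clm_ext₂ fun i j => by
    rw [ContinuousLinearMap.flip_apply, mulCLM_delta, mulCLM_delta, mul_comm]
  conv_lhs => rw [this]
  rfl

lemma mulCLM_assoc (a b c : L1 w) :
    mulCLM w (mulCLM w a b) c = mulCLM w a (mulCLM w b c) := by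
  have h1 : ∀ i j, mulCLM w (mulCLM w (delta w i) (delta w j))
      = (mulCLM w (delta w i)) ∘L (mulCLM w (delta w j)) := fun i j => clm_ext fun l => by
    simp only [ContinuousLinearMap.comp_apply, mulCLM_delta, mul_assoc]
  have h2 : ∀ i, (mulCLM w) ∘L (mulCLM w (delta w i))
      = (ContinuousLinearMap.compL ℂ _ _ _ (mulCLM w (delta w i))) ∘L mulCLM w :=
    fun i => clm_ext fun j => h1 i j
  have h3 : (mulCLM w).flip c ∘L (mulCLM w).flip b = (mulCLM w).flip (mulCLM w b c) :=
    clm_ext fun i => DFunLike.congr_fun (DFunLike.congr_fun (h2 i) b) c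
  exact DFunLike.congr_fun h3 a

lemma norm_mulCLM_le (a b : L1 w) : ‖mulCLM w a b‖ ≤ ‖a‖ * ‖b‖ := by
  have h := norm_lift_le (w := w) zero_le_one (mul_bound_outer (w := w))
  calc _ ≤ ‖mulCLM w a‖ * ‖b‖ := (mulCLM w a).le_opNorm b
    _ ≤ (1 * ‖a‖) * ‖b‖ := by
        refine mul_le_mul_of_nonneg_right ?_ (norm_nonneg _)
        exact (mulCLM w).le_of_opNorm_le h a
    _ = _ := by rw [one_mul]

lemma one_mulCLM (a : L1 w) : mulCLM w (delta w 1) a = a := by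
  have : mulCLM w (delta w 1) = ContinuousLinearMap.id ℂ _ := clm_ext fun i => by
    rw [mulCLM_delta, one_mul, ContinuousLinearMap.id_apply]
  rw [this, ContinuousLinearMap.id_apply]

instance : NormedCommRing (L1 w) where
  mul a b := mulCLM w a b
  one := delta w 1
  left_distrib a b c := map_add (mulCLM w a) b c
  right_distrib a b c := by
    show mulCLM w (a + b) c = mulCLM w a c + mulCLM w b c
    simp
  zero_mul a := by show mulCLM w 0 a = 0; simp
  mul_zero a := by show mulCLM w a 0 = 0; simp
  mul_assoc := mulCLM_assoc
  one_mul := one_mulCLM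
  mul_one a := by show mulCLM w a (delta w 1) = a; rw [mulCLM_comm, one_mulCLM]
  mul_comm := mulCLM_comm
  norm_mul_le := norm_mulCLM_le
  dist_eq := NormedAddCommGroup.dist_eq

lemma mul_def (a b : L1 w) : a * b = mulCLM w a b := rfl
lemma one_def : (1 : L1 w) = delta w 1 := rfl

instance : NormedAlgebra ℂ (L1 w) where
  __ := Algebra.ofModule (R := ℂ) (A := L1 w)
    (fun c a b => by simp only [mul_def, map_smul, smul_apply])
    (fun c a b => by simp only [mul_def, map_smul])
  norm_smul_le := norm_smul_le

instance : NormOneClass (L1 w) where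
  norm_one := by rw [one_def, norm_delta, Submul.map_one]

lemma delta_mul (x y : M) : delta w x * delta w y = delta w (x * y) := mulCLM_delta x y

variable {R : Type*} [NormedCommRing R] [NormedAlgebra ℂ R] [CompleteSpace R]

/-- Bilinearity reduces multiplicativity to basis vectors, where it is `hv`. Nothing is assumed
about `v 1`, which is why `lift_pow` excludes the exponent zero. -/
lemma lift_mul {v : M → R} {C : ℝ} (h : ∀ i, ‖v i‖ ≤ C * w i)
    (hv : ∀ x y, v (x * y) = v x * v y) (a b : L1 w) :
    lift w v (a * b) = lift w v a * lift w v b := by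
  have : (ContinuousLinearMap.compL ℂ _ _ _ (lift w v)) ∘L (mulCLM w)
      = ((ContinuousLinearMap.mul ℂ R).bilinearComp (lift w v) (lift w v)) :=
    clm_ext₂ fun i j => by
      simp only [ContinuousLinearMap.comp_apply, ContinuousLinearMap.compL_apply, mulCLM_delta,
        ContinuousLinearMap.bilinearComp_apply, ContinuousLinearMap.mul_apply', lift_delta h, hv]
  exact DFunLike.congr_fun (DFunLike.congr_fun this a) b

lemma lift_pow {v : M → R} {C : ℝ} (h : ∀ i, ‖v i‖ ≤ C * w i)
    (hv : ∀ x y, v (x * y) = v x * v y) (a : L1 w) {n : ℕ} (hn : n ≠ 0) :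
    lift w v (a ^ n) = lift w v a ^ n := by
  obtain ⟨n, rfl⟩ := Nat.exists_eq_succ_of_ne_zero hn
  clear hn
  induction n with
  | zero => simp
  | succ n ih => rw [pow_succ, lift_mul h hv, ih, pow_succ _ (n + 1)]

end L1

end

end NaeSat

namespace NaeSat

noncomputable section

set_option linter.unusedSectionVars false

/-! ### Holomorphic families of powers -/

/-- The strip `-1/2 < Re z < 3/2`. -/
def strip : Set ℂ := {z | -1 / 2 < z.re ∧ z.re < 3 / 2}

lemma isOpen_strip : IsOpen strip :=
  (isOpen_lt continuous_const Complex.continuous_re).inter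
    (isOpen_lt Complex.continuous_re continuous_const)

lemma ofReal_mem_strip {x : ℝ} (hx : x ∈ Icc (0 : ℝ) 1) : (x : ℂ) ∈ strip := by
  constructor <;> simp only [Complex.ofReal_re] <;> linarith [hx.1, hx.2]

/-- The exponent Re z + 1 lies in (1/2, 5/2), and 2^(5/2) = 4√2 < 6. The extra factor s is what the
weights provide, so 6 becomes the norm bound of all functionals below. -/
lemma norm_cpow_mul_le {s : ℝ} (hs : 0 < s) (hs2 : s ≤ 2) {z : ℂ} (hz : z ∈ strip) :
    ‖(s : ℂ) ^ z‖ * s ≤ 6 := by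
  rw [Complex.norm_cpow_eq_rpow_re_of_pos hs]
  have h1 : s ^ z.re * s = s ^ (z.re + 1) := by
    rw [Real.rpow_add hs, Real.rpow_one]
  rw [h1]
  calc s ^ (z.re + 1) ≤ 2 ^ (z.re + 1) :=
        Real.rpow_le_rpow hs.le hs2 (by linarith [hz.1])
    _ ≤ 2 ^ (5 / 2 : ℝ) := Real.rpow_le_rpow_of_exponent_le (by norm_num) (by linarith [hz.2])
    _ ≤ 6 := by
        have : (2 : ℝ) ^ (5 / 2 : ℝ) = 4 * √2 := by
          rw [Real.sqrt_eq_rpow, show (5 / 2 : ℝ) = 2 + 1 / 2 by norm_num,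
            Real.rpow_add (by norm_num)]
          norm_num
        rw [this]
        have := Real.sqrt_lt' (x := 2) (y := 3 / 2) (by norm_num)
        have h2 := this.2 (by norm_num)
        linarith

/-- For s ≤ 1 the exponential costs at most s^(-1/8) and the squared logarithm s^(-1/4), up to a
constant. The exponent σ + 1 > 1/2 pays for both. For s ≥ 1 all factors are bounded. -/
lemma rpow_mul_log_sq_le {s : ℝ} (hs : 0 < s) (hs2 : s ≤ 2) {σ : ℝ} (hσ : -1 / 2 < σ)
    (hσ' : σ < 3 / 2) {y : ℝ} (hy0 : 0 ≤ y) (hy : y ≤ 1 / 8) :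
    s ^ σ * s * (|Real.log s| ^ 2 * Real.exp (y * |Real.log s|)) ≤ 100 := by
  have h1 : s ^ σ * s = s ^ (σ + 1) := by rw [Real.rpow_add hs, Real.rpow_one]
  rw [h1]
  rcases le_total s 1 with h | h
  · have hl : Real.log s ≤ 0 := Real.log_nonpos hs.le h
    have e1 : Real.exp (y * |Real.log s|) = s ^ (-y) := by
      rw [abs_of_nonpos hl, Real.rpow_def_of_pos hs]; ring_nf
    have e2 := Real.abs_log_mul_self_rpow_lt s (1 / 8) hs h (by norm_num)
    have e3 : |Real.log s| * s ^ (1 / 8 : ℝ) ≤ 8 := by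
      rw [abs_mul, abs_of_pos (Real.rpow_pos_of_pos hs _)] at e2
      linarith
    have e4 : s ^ (σ + 1) * (|Real.log s| ^ 2 * s ^ (-y))
        = (|Real.log s| * s ^ (1 / 8 : ℝ)) ^ 2 * s ^ (σ + 1 - y - 1 / 4) := by
      have : s ^ (σ + 1) * s ^ (-y) = s ^ (1 / 8 : ℝ) * s ^ (1 / 8 : ℝ) * s ^ (σ + 1 - y - 1 / 4) := by
        rw [← Real.rpow_add hs, ← Real.rpow_add hs, ← Real.rpow_add hs]; ring_nf
      calc _ = |Real.log s| ^ 2 * (s ^ (σ + 1) * s ^ (-y)) := by ring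
        _ = _ := by rw [this]; ring
    rw [e1, e4]
    have e5 : s ^ (σ + 1 - y - 1 / 4) ≤ 1 := Real.rpow_le_one hs.le h (by linarith)
    have e6 : 0 ≤ |Real.log s| * s ^ (1 / 8 : ℝ) := by positivity
    have e7 : 0 ≤ s ^ (σ + 1 - y - 1 / 4) := by positivity
    nlinarith
  · have hl : 0 ≤ Real.log s := Real.log_nonneg h
    have hl1 : Real.log s ≤ 1 := by
      have := Real.log_le_sub_one_of_pos hs
      linarith
    rw [abs_of_nonneg hl]
    have e1 : Real.exp (y * Real.log s) ≤ 3 := by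
      calc _ ≤ Real.exp 1 := Real.exp_le_exp.2 (by nlinarith)
        _ ≤ 3 := by linarith [Real.exp_one_lt_d9]
    have e2 : s ^ (σ + 1) ≤ 8 := by
      calc s ^ (σ + 1) ≤ 2 ^ (σ + 1) := Real.rpow_le_rpow hs.le hs2 (by linarith)
        _ ≤ 2 ^ (3 : ℝ) := Real.rpow_le_rpow_of_exponent_le (by norm_num) (by linarith)
        _ = 8 := by norm_num
    have e3 : Real.log s ^ 2 ≤ 1 := by nlinarith
    calc s ^ (σ + 1) * (Real.log s ^ 2 * Real.exp (y * Real.log s)) ≤ 8 * (1 * 3) := by gcongr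
      _ ≤ 100 := by norm_num

variable {I : Type*} {w : Weight I} {F : Type*} [NormedAddCommGroup F] [NormedSpace ℂ F]
  [CompleteSpace F] {s : I → ℝ} {b : I → F}

/-- The bases `s i` and vectors `b i` of a family `i ↦ (s i) ^ z • b i`. -/
structure PowData (w : Weight I) (s : I → ℝ) (b : I → F) : Prop where
  le_two : ∀ i, s i ≤ 2
  zero : ∀ i, s i ≤ 0 → b i = 0
  bound : ∀ i, 0 < s i → ‖b i‖ ≤ s i * w i

/-- The family `i ↦ (s i) ^ z • b i`. -/
def powFam (s : I → ℝ) (b : I → F) (z : ℂ) (i : I) : F := ((s i : ℂ) ^ z) • b i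

/-- The linear map with `delta i ↦ (s i) ^ z • b i`. -/
def powLift (w : Weight I) (s : I → ℝ) (b : I → F) (z : ℂ) : L1 w →L[ℂ] F :=
  L1.lift w (powFam s b z)

/-- The family `i ↦ (s i) ^ z log (s i) • b i`. -/
def logFam (s : I → ℝ) (b : I → F) (z : ℂ) (i : I) : F :=
  ((s i : ℂ) ^ z * (Real.log (s i) : ℂ)) • b i

/-- The linear map with `delta i ↦ (s i) ^ z log (s i) • b i`. -/
def logLift (w : Weight I) (s : I → ℝ) (b : I → F) (z : ℂ) : L1 w →L[ℂ] F :=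
  L1.lift w (logFam s b z)

lemma PowData.powFam_bound (h : PowData w s b) {z : ℂ} (hz : z ∈ strip) (i : I) :
    ‖powFam s b z i‖ ≤ 6 * w i := by
  rw [powFam, norm_smul]
  rcases le_or_gt (s i) 0 with hs | hs
  · rw [h.zero i hs, norm_zero, mul_zero]; linarith [w.pos i]
  · calc _ ≤ ‖(s i : ℂ) ^ z‖ * (s i * w i) :=
          mul_le_mul_of_nonneg_left (h.bound i hs) (norm_nonneg _)
      _ = (‖(s i : ℂ) ^ z‖ * s i) * w i := by ring
      _ ≤ _ := mul_le_mul_of_nonneg_right (norm_cpow_mul_le hs (h.le_two i) hz) (w.pos i).le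

lemma PowData.powLift_delta (h : PowData w s b) {z : ℂ} (hz : z ∈ strip) (i : I) :
    powLift w s b z (L1.delta w i) = ((s i : ℂ) ^ z) • b i :=
  L1.lift_delta (h.powFam_bound hz) i

lemma PowData.norm_powLift_le (h : PowData w s b) {z : ℂ} (hz : z ∈ strip) :
    ‖powLift w s b z‖ ≤ 6 :=
  L1.norm_lift_le (by norm_num) (h.powFam_bound hz)

lemma PowData.logFam_bound (h : PowData w s b) {z : ℂ} (hz : z ∈ strip) (i : I) :
    ‖logFam s b z i‖ ≤ 106 * w i := by
  rw [logFam, norm_smul]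
  rcases le_or_gt (s i) 0 with hs | hs
  · rw [h.zero i hs, norm_zero, mul_zero]; linarith [w.pos i]
  · have e := norm_cpow_mul_le hs (h.le_two i) hz
    have e' := rpow_mul_log_sq_le hs (h.le_two i) hz.1 hz.2 le_rfl (by norm_num)
    have e'' : ‖(s i : ℂ) ^ z‖ * s i * |Real.log (s i)| ≤ 106 := by
      rw [Complex.norm_cpow_eq_rpow_re_of_pos hs] at e ⊢
      simp only [zero_mul, Real.exp_zero, mul_one] at e'
      have h0 : 0 ≤ s i ^ z.re * s i := by positivity
      nlinarith [sq_nonneg (|Real.log (s i)| - 1), abs_nonneg (Real.log (s i)),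
        mul_nonneg h0 (sq_nonneg (|Real.log (s i)| - 1))]
    calc _ ≤ ‖(s i : ℂ) ^ z * (Real.log (s i) : ℂ)‖ * (s i * w i) :=
          mul_le_mul_of_nonneg_left (h.bound i hs) (norm_nonneg _)
      _ = (‖(s i : ℂ) ^ z‖ * s i * |Real.log (s i)|) * w i := by
          rw [norm_mul, Complex.norm_real, Real.norm_eq_abs]; ring
      _ ≤ _ := mul_le_mul_of_nonneg_right e'' (w.pos i).le

/-- The Taylor remainder |e^y - 1 - y| ≤ |y|² e^|y| with y = (z' - z) log s is bounded uniformly in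
the index, because the weight absorbs small s. A quadratic remainder in operator norm makes the
family of operators holomorphic. -/
lemma PowData.norm_sub_le (h : PowData w s b) {z z' : ℂ} (hz : z ∈ strip) (hz' : z' ∈ strip)
    (hzz : ‖z' - z‖ ≤ 1 / 8) :
    ‖powLift w s b z' - powLift w s b z - (z' - z) • logLift w s b z‖
      ≤ 100 * ‖z' - z‖ ^ 2 := by
  refine ContinuousLinearMap.opNorm_le_bound _ (by positivity) fun a => ?_
  have hs1 := L1.hasSum_lift (h.powFam_bound hz') a
  have hs2 := L1.hasSum_lift (h.powFam_bound hz) a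
  have hs3 := L1.hasSum_lift (h.logFam_bound hz) a
  have hs := (hs1.sub hs2).sub (hs3.const_smul (z' - z))
  refine hs.norm_le_of_bounded ((L1.hasSum_norm a).mul_left (100 * ‖z' - z‖ ^ 2)) fun i => ?_
  have e : L1.coef i a • powFam s b z' i - L1.coef i a • powFam s b z i
      - (z' - z) • (L1.coef i a • logFam s b z i)
      = (L1.coef i a * ((s i : ℂ) ^ z' - (s i : ℂ) ^ z
        - (z' - z) * ((s i : ℂ) ^ z * (Real.log (s i) : ℂ)))) • b i := by
    simp only [powFam, logFam]
    module
  rw [e, norm_smul, norm_mul]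
  have key : ‖((s i : ℂ) ^ z' - (s i : ℂ) ^ z
        - (z' - z) * ((s i : ℂ) ^ z * (Real.log (s i) : ℂ)))‖ * ‖b i‖
        ≤ 100 * ‖z' - z‖ ^ 2 * w i := by
    rcases le_or_gt (s i) 0 with hsi | hsi
    · rw [h.zero i hsi, norm_zero, mul_zero]
      have := w.pos i
      positivity
    · have hne : (s i : ℂ) ≠ 0 := by exact_mod_cast hsi.ne'
      set y : ℂ := (z' - z) * (Real.log (s i) : ℂ) with hy
      have e1 : (s i : ℂ) ^ z' = (s i : ℂ) ^ z * Complex.exp y := by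
        rw [Complex.cpow_def_of_ne_zero hne, Complex.cpow_def_of_ne_zero hne, ← Complex.exp_add,
          hy, Complex.ofReal_log hsi.le]
        ring_nf
      have e2 : (s i : ℂ) ^ z' - (s i : ℂ) ^ z - (z' - z) * ((s i : ℂ) ^ z * (Real.log (s i) : ℂ))
          = (s i : ℂ) ^ z * (Complex.exp y - ∑ m ∈ Finset.range 2, y ^ m / (m.factorial : ℂ)) := by
        rw [e1, Finset.sum_range_succ, Finset.sum_range_one]
        simp only [hy, pow_zero, Nat.factorial, Nat.cast_one, div_one, pow_one, mul_one]
        ring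
      have e3 := Complex.norm_exp_sub_sum_le_norm_mul_exp y 2
      have e4 : ‖y‖ = ‖z' - z‖ * |Real.log (s i)| := by
        rw [hy, norm_mul, Complex.norm_real, Real.norm_eq_abs]
      have e5 := rpow_mul_log_sq_le hsi (h.le_two i) hz.1 hz.2 (norm_nonneg (z' - z)) hzz
      rw [e2, norm_mul, Complex.norm_cpow_eq_rpow_re_of_pos hsi]
      have hw := w.pos i
      calc _ ≤ s i ^ z.re * (‖y‖ ^ 2 * Real.exp ‖y‖) * (s i * w i) := by
            gcongr
            exact h.bound i hsi
        _ = ‖z' - z‖ ^ 2 * (s i ^ z.re * s i * (|Real.log (s i)| ^ 2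
              * Real.exp (‖z' - z‖ * |Real.log (s i)|))) * w i := by rw [e4]; ring
        _ ≤ ‖z' - z‖ ^ 2 * 100 * w i := by gcongr
        _ = _ := by ring
  calc _ = ‖L1.coef i a‖ * (‖((s i : ℂ) ^ z' - (s i : ℂ) ^ z
        - (z' - z) * ((s i : ℂ) ^ z * (Real.log (s i) : ℂ)))‖ * ‖b i‖) := by ring
    _ ≤ ‖L1.coef i a‖ * (100 * ‖z' - z‖ ^ 2 * w i) := by gcongr
    _ = _ := by ring

lemma PowData.hasDerivAt (h : PowData w s b) {z : ℂ} (hz : z ∈ strip) :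
    HasDerivAt (powLift w s b) (logLift w s b z) z := by
  rw [hasDerivAt_iff_isLittleO]
  have h1 : (fun z' => powLift w s b z' - powLift w s b z - (z' - z) • logLift w s b z)
      =O[𝓝 z] fun z' => ‖z' - z‖ ^ 2 := by
    refine Asymptotics.IsBigO.of_bound 100 ?_
    have h2 : ∀ᶠ z' in 𝓝 z, z' ∈ strip := isOpen_strip.mem_nhds hz
    have h3 : ∀ᶠ z' in 𝓝 z, ‖z' - z‖ ≤ 1 / 8 := by
      filter_upwards [Metric.ball_mem_nhds z (show (0 : ℝ) < 1 / 8 by norm_num)] with z' hz'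
      rw [Metric.mem_ball, dist_eq_norm] at hz'
      exact hz'.le
    filter_upwards [h2, h3] with z' h2 h3
    simpa using h.norm_sub_le hz h2 h3
  refine h1.trans_isLittleO ?_
  rw [Asymptotics.isLittleO_iff]
  intro c hc
  filter_upwards [Metric.ball_mem_nhds z hc] with z' hz'
  rw [Metric.mem_ball, dist_eq_norm] at hz'
  rw [norm_pow, norm_norm, pow_two]
  exact mul_le_mul_of_nonneg_right hz'.le (norm_nonneg _)

/-! ### Powers in normed rings -/

section Powers

variable {R : Type*} [NormedCommRing R] [NormOneClass R]

/-- A majorant argument: the expansion of the left side has nonnegative coefficients, so its norm is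
at most the same polynomial in the norms. The next lemma does the same with the linear term removed.
-/
lemma norm_add_pow_sub_pow_le (x y : R) (n : ℕ) :
    ‖(x + y) ^ n - x ^ n‖ ≤ (‖x‖ + ‖y‖) ^ n - ‖x‖ ^ n := by
  induction n with
  | zero => simp
  | succ n ih =>
    have e : (x + y) ^ (n + 1) - x ^ (n + 1) = (x + y) * ((x + y) ^ n - x ^ n) + y * x ^ n := by ring
    rw [e]
    calc _ ≤ ‖x + y‖ * ‖(x + y) ^ n - x ^ n‖ + ‖y‖ * ‖x‖ ^ n := by
          refine (norm_add_le _ _).trans (add_le_add (norm_mul_le _ _) ((norm_mul_le _ _).trans ?_))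
          gcongr
          exact norm_pow_le _ _
      _ ≤ (‖x‖ + ‖y‖) * ((‖x‖ + ‖y‖) ^ n - ‖x‖ ^ n) + ‖y‖ * ‖x‖ ^ n := by
          gcongr
          exact norm_add_le _ _
      _ = _ := by ring

lemma norm_add_pow_sub_sub_le (x y : R) (n : ℕ) :
    ‖(x + y) ^ (n + 1) - x ^ (n + 1) - (n + 1) * (x ^ n * y)‖
      ≤ (‖x‖ + ‖y‖) ^ (n + 1) - ‖x‖ ^ (n + 1) - (n + 1) * (‖x‖ ^ n * ‖y‖) := by
  induction n with
  | zero => simp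
  | succ n ih =>
    have e : (x + y) ^ (n + 1 + 1) - x ^ (n + 1 + 1) - ((n + 1 : ℕ) + 1) * (x ^ (n + 1) * y)
        = x * ((x + y) ^ (n + 1) - x ^ (n + 1) - (n + 1) * (x ^ n * y))
          + y * ((x + y) ^ (n + 1) - x ^ (n + 1)) := by push_cast; ring
    rw [e]
    calc _ ≤ ‖x‖ * ((‖x‖ + ‖y‖) ^ (n + 1) - ‖x‖ ^ (n + 1) - (n + 1) * (‖x‖ ^ n * ‖y‖))
          + ‖y‖ * ((‖x‖ + ‖y‖) ^ (n + 1) - ‖x‖ ^ (n + 1)) := by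
          refine (norm_add_le _ _).trans (add_le_add ((norm_mul_le _ _).trans ?_)
            ((norm_mul_le _ _).trans ?_))
          · gcongr
          · gcongr
            exact norm_add_pow_sub_pow_le _ _ _
      _ = _ := by push_cast; ring

/-- From (1 + x)^n ≤ e^(nx) and the expansion of the exponential on [0,1]. -/
lemma one_add_pow_sub_one_le {x : ℝ} (hx : 0 ≤ x) {n : ℕ} (h : n * x ≤ 1) :
    (1 + x) ^ n - 1 ≤ 2 * (n * x) := by
  have h1 : (1 + x) ^ n ≤ Real.exp (n * x) := by
    rw [mul_comm, Real.exp_mul, Real.rpow_natCast]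
    gcongr
    linarith [Real.add_one_le_exp x]
  have h0 : 0 ≤ (n : ℝ) * x := by positivity
  have h2 := Real.abs_exp_sub_one_le (x := n * x) (by rwa [abs_of_nonneg h0])
  rw [abs_of_nonneg h0] at h2
  linarith [le_abs_self (Real.exp (n * x) - 1)]

lemma one_add_pow_sub_sub_le {x : ℝ} (hx : 0 ≤ x) {n : ℕ} (h : n * x ≤ 1) :
    (1 + x) ^ n - 1 - n * x ≤ (n * x) ^ 2 := by
  have h1 : (1 + x) ^ n ≤ Real.exp (n * x) := by
    rw [mul_comm, Real.exp_mul, Real.rpow_natCast]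
    gcongr
    linarith [Real.add_one_le_exp x]
  have h0 : 0 ≤ (n : ℝ) * x := by positivity
  have h2 := Real.abs_exp_sub_one_sub_id_le (x := n * x) (by rwa [abs_of_nonneg h0])
  linarith [le_abs_self (Real.exp (n * x) - 1 - n * x)]

lemma norm_pow_sub_one_le {x : R} {ε : ℝ} (hx : ‖x - 1‖ ≤ ε) {n : ℕ} (h : n * ε ≤ 1) :
    ‖x ^ n - 1‖ ≤ 2 * (n * ε) := by
  have hε : 0 ≤ ε := (norm_nonneg _).trans hx
  have h1 := norm_add_pow_sub_pow_le 1 (x - 1) n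
  rw [add_sub_cancel, one_pow, norm_one, one_pow] at h1
  refine h1.trans (le_trans ?_ (one_add_pow_sub_one_le hε h))
  gcongr

end Powers

end

end NaeSat

namespace NaeSat

noncomputable section

set_option linter.unusedSectionVars false

/-! ### The three message spaces -/

/-- Free messages. -/
abbrev Free : Type := {x : ℝ // x ∈ Ioo (0 : ℝ) 1}

/-- Pairs of numbers in `[0,1]`: messages from clauses, up to normalization. -/
abbrev Pair : Type := unitInterval × unitInterval

/-- The pairs that arise as `(∏ x_i, ∏ (1 - x_i))`. -/
def clauseSub : Submonoid Pair where
  carrier := {s | (s.1 : ℝ) + s.2 ≤ 1 ∨ s = 1}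
  one_mem' := Or.inr rfl
  mul_mem' := by
    rintro s s' (h | rfl) (h' | rfl)
    · left
      have h1 := mul_le_of_le_one_right s.1.2.1 s'.1.2.2
      have h2 := mul_le_of_le_one_right s.2.2.1 s'.2.2.2
      simp only [Prod.fst_mul, Prod.snd_mul, Set.Icc.coe_mul]
      linarith
    · left; simpa using h
    · left; simpa using h'
    · right; simp

/-- The elements of `clauseSub`. -/
abbrev Clause : Type := clauseSub

/-- The weight on free messages. -/
def wE : Weight Free where
  toFun x := max (x : ℝ)⁻¹ (1 - (x : ℝ))⁻¹
  one_le' x := le_max_of_le_left ((one_le_inv₀ x.2.1).2 x.2.2.le)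

/-- The weight on pairs. -/
def wA : Weight Pair where
  toFun y := max 1 (max (y.1 : ℝ)⁻¹ (y.2 : ℝ)⁻¹)
  one_le' _ := le_max_left _ _

/-- The weight on clause pairs. -/
def wB : Weight Clause where
  toFun s := max (max 1 (1 - (s.1.1 : ℝ))⁻¹) (max (1 - (s.1.2 : ℝ))⁻¹ (1 - (s.1.1 : ℝ) - s.1.2)⁻¹)
  one_le' _ := le_max_of_le_left (le_max_left _ _)

lemma wE_apply (x : Free) : wE x = max (x : ℝ)⁻¹ (1 - (x : ℝ))⁻¹ := rfl
lemma wA_apply (y : Pair) : wA y = max 1 (max (y.1 : ℝ)⁻¹ (y.2 : ℝ)⁻¹) := rfl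
lemma wB_apply (s : Clause) : wB s =
  max (max 1 (1 - (s.1.1 : ℝ))⁻¹) (max (1 - (s.1.2 : ℝ))⁻¹ (1 - (s.1.1 : ℝ) - s.1.2)⁻¹) := rfl

/-- The weights are built from the reciprocals of the bases that will be raised to complex powers: u
and v on pairs, and 1 - a, 1 - b, 1 - a - b on clause pairs. This pays for exponents with negative
real part. A vanishing base has reciprocal zero and costs nothing. -/
lemma inv_fst_le_wA (y : Pair) : (y.1 : ℝ)⁻¹ ≤ wA y :=
  le_max_of_le_right (le_max_left _ _)
lemma inv_snd_le_wA (y : Pair) : (y.2 : ℝ)⁻¹ ≤ wA y :=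
  le_max_of_le_right (le_max_right _ _)

lemma le_mul_of_le_one_le {a b c : ℝ} (h : a ≤ b) (hb : 1 ≤ b) (hc : 1 ≤ c) : a ≤ b * c :=
  h.trans (le_mul_of_one_le_right (by linarith) hc)

instance : Submul wA where
  map_one := by simp [wA_apply]
  map_mul_le x y := by
    have hx := wA.one_le x
    have hy := wA.one_le y
    refine max_le (one_le_mul_of_one_le_of_one_le hx hy) (max_le ?_ ?_)
    · simp only [Prod.fst_mul, Set.Icc.coe_mul, mul_inv]
      exact mul_le_mul (inv_fst_le_wA x) (inv_fst_le_wA y) (inv_nonneg.2 y.1.2.1) (by linarith)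
    · simp only [Prod.snd_mul, Set.Icc.coe_mul, mul_inv]
      exact mul_le_mul (inv_snd_le_wA x) (inv_snd_le_wA y) (inv_nonneg.2 y.2.2.1) (by linarith)

lemma inv_fst_le_wB (s : Clause) : (1 - (s.1.1 : ℝ))⁻¹ ≤ wB s :=
  le_max_of_le_left (le_max_right _ _)
lemma inv_snd_le_wB (s : Clause) : (1 - (s.1.2 : ℝ))⁻¹ ≤ wB s :=
  le_max_of_le_right (le_max_left _ _)
lemma inv_sub_le_wB (s : Clause) : (1 - (s.1.1 : ℝ) - s.1.2)⁻¹ ≤ wB s :=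
  le_max_of_le_right (le_max_right _ _)

lemma inv_one_sub_mul_le {a a' W W' : ℝ} (ha : a ∈ Icc (0 : ℝ) 1) (ha' : a' ∈ Icc (0 : ℝ) 1)
    (h : (1 - a)⁻¹ ≤ W) (h' : (1 - a')⁻¹ ≤ W') (h1 : 1 ≤ W) (h1' : 1 ≤ W') :
    (1 - a * a')⁻¹ ≤ W * W' := by
  rcases eq_or_lt_of_le ha.2 with rfl | hlt
  · rw [one_mul, mul_comm]
    exact le_mul_of_le_one_le h' h1' h1
  · refine le_mul_of_le_one_le (le_trans ?_ h) h1 h1'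
    refine inv_anti₀ (by linarith) ?_
    have := mul_le_of_le_one_right ha.1 ha'.2
    linarith

/-- The delicate entry is the reciprocal of 1 - aa' - bb'. If a + b < 1 or a' + b' < 1, that factor
alone dominates it, as aa' + bb' is at most either sum. If both pairs lie on the line of sum one,
their own third entries are zero; then 1 - aa' - bb' = a(1 - a') + a'(1 - a) is at least min(a, 1 -
a), which the entries (1 - b)⁻¹ and (1 - a)⁻¹ of the first factor control. The endpoints a = 0 and a
= 1 fall to the second factor. -/
instance : Submul wB where
  map_one := by simp [wB_apply]
  map_mul_le x y := by
    have hx := wB.one_le x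
    have hy := wB.one_le y
    obtain ⟨⟨⟨a, ha⟩, ⟨b, hb⟩⟩, hs⟩ := x
    obtain ⟨⟨⟨a', ha'⟩, ⟨b', hb'⟩⟩, hs'⟩ := y
    set x : Clause := ⟨⟨⟨a, ha⟩, ⟨b, hb⟩⟩, hs⟩ with hxdef
    set y : Clause := ⟨⟨⟨a', ha'⟩, ⟨b', hb'⟩⟩, hs'⟩ with hydef
    have xa : (1 - a)⁻¹ ≤ wB x := inv_fst_le_wB x
    have xb : (1 - b)⁻¹ ≤ wB x := inv_snd_le_wB x
    have xc : (1 - a - b)⁻¹ ≤ wB x := inv_sub_le_wB x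
    have ya : (1 - a')⁻¹ ≤ wB y := inv_fst_le_wB y
    have yb : (1 - b')⁻¹ ≤ wB y := inv_snd_le_wB y
    have yc : (1 - a' - b')⁻¹ ≤ wB y := inv_sub_le_wB y
    refine max_le (max_le (one_le_mul_of_one_le_of_one_le hx hy) ?_) (max_le ?_ ?_)
    · exact inv_one_sub_mul_le ha ha' xa ya hx hy
    · exact inv_one_sub_mul_le hb hb' xb yb hx hy
    · show (1 - a * a' - b * b')⁻¹ ≤ _
      have m1 := mul_le_of_le_one_right ha.1 ha'.2
      have m2 := mul_le_of_le_one_right hb.1 hb'.2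
      have m3 := mul_le_of_le_one_left ha'.1 ha.2
      have m4 := mul_le_of_le_one_left hb'.1 hb.2
      rcases hs with h | h
      · change a + b ≤ 1 at h
        rcases hs' with h' | h'
        · change a' + b' ≤ 1 at h'
          rcases h.lt_or_eq with hlt | heq
          · refine le_mul_of_le_one_le (le_trans ?_ xc) hx hy
            exact inv_anti₀ (by linarith) (by linarith)
          rcases h'.lt_or_eq with hlt' | heq'
          · rw [mul_comm (wB x)]
            refine le_mul_of_le_one_le (le_trans ?_ yc) hy hx
            exact inv_anti₀ (by linarith) (by linarith)
          obtain rfl : b = 1 - a := by linarith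
          obtain rfl : b' = 1 - a' := by linarith
          rcases ha.1.eq_or_lt with rfl | ha0
          · rw [mul_comm (wB x)]
            refine le_mul_of_le_one_le (le_trans (le_of_eq ?_) yb) hy hx
            ring_nf
          rcases hb.1.eq_or_lt with hb0 | hb0
          · obtain rfl : a = 1 := by linarith
            rw [mul_comm (wB x)]
            refine le_mul_of_le_one_le (le_trans (le_of_eq ?_) ya) hy hx
            ring_nf
          · refine le_mul_of_le_one_le ?_ hx hy
            rcases le_total a (1 - a) with hle | hle
            · refine le_trans (inv_anti₀ ha0 ?_) (by simpa using xb)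
              nlinarith [ha'.1, ha'.2]
            · refine le_trans (inv_anti₀ hb0 ?_) xa
              nlinarith [ha'.1, ha'.2]
        · obtain ⟨rfl, rfl⟩ : a' = 1 ∧ b' = 1 := by
            rw [Prod.ext_iff, Subtype.ext_iff, Subtype.ext_iff] at h'
            exact h'
          rw [mul_one, mul_one]
          exact le_mul_of_le_one_le xc hx hy
      · obtain ⟨rfl, rfl⟩ : a = 1 ∧ b = 1 := by
          rw [Prod.ext_iff, Subtype.ext_iff, Subtype.ext_iff] at h
          exact h
        rw [one_mul, one_mul, mul_comm (wB x)]
        exact le_mul_of_le_one_le yc hy hx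

/-- The space of free parts of variable messages. -/
abbrev SpE : Type := L1 wE
/-- The algebra of clause-to-variable messages. -/
abbrev SpA : Type := L1 wA
/-- The algebra of products of variable-to-clause messages. -/
abbrev SpB : Type := L1 wB

/-- The pair `(x, 1 - x)`. -/
def pt (x : unitInterval) : Clause :=
  ⟨(x, unitInterval.symm x), Or.inl (by simp [unitInterval.coe_symm_eq])⟩

/-- A free message as an element of the unit interval. -/
def Free.toI (x : Free) : unitInterval := ⟨x, x.2.1.le, x.2.2.le⟩

/-- `(a, b) ↦ (1 - a, 1 - b)`. -/
def flipPt (s : Clause) : Pair := (unitInterval.symm s.1.1, unitInterval.symm s.1.2)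

/-- The embedding of free messages. -/
def emb : SpE →L[ℂ] SpB := L1.lift wE fun x => L1.delta wB (pt x.toI)

/-- Push-forward under `flipPt`. -/
def flipL : SpB →L[ℂ] SpA := L1.lift wB fun s => L1.delta wA (flipPt s)

lemma pt_fst (x : unitInterval) : ((pt x).1.1 : ℝ) = x := rfl
lemma pt_snd (x : unitInterval) : ((pt x).1.2 : ℝ) = 1 - x := rfl
lemma flipPt_fst (s : Clause) : ((flipPt s).1 : ℝ) = 1 - s.1.1 := rfl
lemma flipPt_snd (s : Clause) : ((flipPt s).2 : ℝ) = 1 - s.1.2 := rfl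

lemma emb_bound (x : Free) : ‖L1.delta wB (pt x.toI)‖ ≤ 1 * wE x := by
  rw [L1.norm_delta, one_mul, wB_apply, wE_apply, pt_fst, pt_snd]
  show max (max 1 (1 - (x : ℝ))⁻¹) (max (1 - (1 - (x : ℝ)))⁻¹ (1 - (x : ℝ) - (1 - x))⁻¹) ≤ _
  have h1 : (1 : ℝ) ≤ (x : ℝ)⁻¹ := (one_le_inv₀ x.2.1).2 x.2.2.le
  rw [sub_self, inv_zero, sub_sub_cancel]
  refine max_le (max_le (le_max_of_le_left h1) (le_max_right _ _))
    (max_le (le_max_left _ _) (le_max_of_le_left (by linarith)))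

lemma emb_delta (x : Free) : emb (L1.delta wE x) = L1.delta wB (pt x.toI) :=
  L1.lift_delta emb_bound x

lemma norm_emb_le (p : SpE) : ‖emb p‖ ≤ ‖p‖ :=
  (L1.norm_lift_apply_le emb_bound p).trans_eq (one_mul _)

lemma flipL_bound (s : Clause) : ‖L1.delta wA (flipPt s)‖ ≤ 1 * wB s := by
  rw [L1.norm_delta, one_mul, wA_apply, flipPt_fst, flipPt_snd]
  exact max_le (wB.one_le s) (max_le (inv_fst_le_wB s) (inv_snd_le_wB s))

lemma flipL_delta (s : Clause) : flipL (L1.delta wB s) = L1.delta wA (flipPt s) :=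
  L1.lift_delta flipL_bound s

lemma norm_flipL_le (b : SpB) : ‖flipL b‖ ≤ ‖b‖ :=
  (L1.norm_lift_apply_le flipL_bound b).trans_eq (one_mul _)

/-- The total mass. -/
def mass {I : Type*} (w : Weight I) : L1 w →L[ℂ] ℂ := L1.lift w fun _ => 1

lemma mass_bound {I : Type*} (w : Weight I) (i : I) : ‖(1 : ℂ)‖ ≤ 1 * w i := by
  simpa using w.one_le i

lemma mass_delta {I : Type*} (w : Weight I) (i : I) : mass w (L1.delta w i) = 1 :=
  L1.lift_delta (mass_bound w) i

lemma norm_mass_le {I : Type*} (w : Weight I) (a : L1 w) : ‖mass w a‖ ≤ ‖a‖ :=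
  (L1.norm_lift_apply_le (mass_bound w) a).trans_eq (one_mul _)

lemma mass_mul (a b : SpB) : mass wB (a * b) = mass wB a * mass wB b :=
  L1.lift_mul (mass_bound wB) (by simp) a b

lemma mass_pow (a : SpB) (n : ℕ) : mass wB (a ^ n) = mass wB a ^ n := by
  rcases eq_or_ne n 0 with rfl | hn
  · simp only [pow_zero]; exact mass_delta wB 1
  · exact L1.lift_pow (mass_bound wB) (by simp) a hn

lemma mass_emb (p : SpE) : mass wB (emb p) = mass wE p := by
  have : mass wB ∘L emb = mass wE := L1.clm_ext fun i => by
    rw [ContinuousLinearMap.comp_apply, emb_delta, mass_delta, mass_delta]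
  exact DFunLike.congr_fun this p

/-! ### Distinguished elements -/

/-- The frozen message `0`. -/
def e0 : SpB := L1.delta wB (pt 0)
/-- The frozen message `1`. -/
def e1 : SpB := L1.delta wB (pt 1)
/-- The absorbing basis vector at `(0, 0)`. -/
def zz : SpB := e0 * e1
/-- The basis vector at `(1, 0)`. -/
def f1 : SpA := L1.delta wA (1, 0)
/-- The basis vector at `(0, 1)`. -/
def f0 : SpA := L1.delta wA (0, 1)

lemma clause_ext {s s' : Clause} (h1 : (s.1.1 : ℝ) = s'.1.1) (h2 : (s.1.2 : ℝ) = s'.1.2) :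
    s = s' :=
  Subtype.ext (Prod.ext (Subtype.ext h1) (Subtype.ext h2))

lemma clause_mul_fst (s s' : Clause) : ((s * s').1.1 : ℝ) = s.1.1 * s'.1.1 := rfl
lemma clause_mul_snd (s s' : Clause) : ((s * s').1.2 : ℝ) = s.1.2 * s'.1.2 := rfl
lemma pair_mul_fst (y y' : Pair) : ((y * y').1 : ℝ) = y.1 * y'.1 := rfl
lemma pair_mul_snd (y y' : Pair) : ((y * y').2 : ℝ) = y.2 * y'.2 := rfl
lemma pt_zero_fst : ((pt 0).1.1 : ℝ) = 0 := rfl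
lemma pt_zero_snd : ((pt 0).1.2 : ℝ) = 1 := by rw [pt_snd]; simp
lemma pt_one_fst : ((pt 1).1.1 : ℝ) = 1 := rfl
lemma pt_one_snd : ((pt 1).1.2 : ℝ) = 0 := by rw [pt_snd]; simp

lemma zz_eq : zz = L1.delta wB (pt 0 * pt 1) := L1.delta_mul _ _

lemma e0_mul_self : e0 * e0 = e0 := by
  rw [e0, L1.delta_mul]
  congr 1
  exact clause_ext (by rw [clause_mul_fst, pt_zero_fst, mul_zero])
    (by rw [clause_mul_snd, pt_zero_snd, mul_one])

lemma e1_mul_self : e1 * e1 = e1 := by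
  rw [e1, L1.delta_mul]
  congr 1
  exact clause_ext (by rw [clause_mul_fst, pt_one_fst, mul_one])
    (by rw [clause_mul_snd, pt_one_snd, mul_zero])

/-- The point (0, 0) absorbs every factor, so only the total mass of `a` survives. -/
lemma zz_mul (a : SpB) : zz * a = mass wB a • zz := by
  have : L1.mulCLM wB zz = (mass wB).smulRight zz := L1.clm_ext fun i => by
    rw [ContinuousLinearMap.smulRight_apply, mass_delta, one_smul, zz_eq, L1.mulCLM_delta]
    congr 1
    refine clause_ext ?_ ?_
    · simp only [clause_mul_fst, pt_zero_fst, zero_mul]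
    · simp only [clause_mul_snd, pt_one_snd, mul_zero, zero_mul]
  exact DFunLike.congr_fun this a

lemma norm_e0 : ‖e0‖ = 1 := by
  rw [e0, L1.norm_delta, wB_apply, pt_zero_fst, pt_zero_snd]; simp
lemma norm_e1 : ‖e1‖ = 1 := by
  rw [e1, L1.norm_delta, wB_apply, pt_one_fst, pt_one_snd]; simp
lemma mass_e0 : mass wB e0 = 1 := mass_delta _ _
lemma mass_e1 : mass wB e1 = 1 := mass_delta _ _
lemma mass_zz : mass wB zz = 1 := by rw [zz_eq]; exact mass_delta _ _

lemma flipL_e0 : flipL e0 = f1 := by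
  rw [e0, flipL_delta, f1]; congr 1
  exact Prod.ext (by simp [flipPt, pt]) (by simp [flipPt, pt])
lemma flipL_e1 : flipL e1 = f0 := by
  rw [e1, flipL_delta, f0]; congr 1
  exact Prod.ext (by simp [flipPt, pt]) (by simp [flipPt, pt])
-- A clause that already sees both frozen values is satisfied whatever happens and sends the
-- uninformative pair (1, 1), the unit of the algebra.
lemma flipL_zz : flipL zz = 1 := by
  rw [zz_eq, flipL_delta, L1.one_def]; congr 1
  exact Prod.ext (by simp [flipPt, pt]) (by simp [flipPt, pt])

end

end NaeSat

namespace NaeSat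

noncomputable section

set_option linter.unusedSectionVars false
set_option linter.unusedSimpArgs false

/-! ### Weighted functionals -/

open scoped Classical in
/-- The indicator function of a proposition, with values in `ℂ`. -/
def ind (p : Prop) : ℂ := if p then 1 else 0

lemma ind_true {p : Prop} (h : p) : ind p = 1 := if_pos h
lemma ind_false {p : Prop} (h : ¬p) : ind p = 0 := if_neg h
lemma ind_and (p q : Prop) : ind (p ∧ q) = ind p * ind q := by
  by_cases hp : p <;> by_cases hq : q <;> simp [ind, hp, hq]
lemma norm_ind_le (p : Prop) : ‖ind p‖ ≤ 1 := by
  by_cases hp : p <;> simp [ind, hp]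

/-- An indicator is at most 1, and 1 = s · s⁻¹ ≤ s w. The condition `hp` keeps the support away from
nonpositive bases. -/
lemma PowData.of_ind {I : Type*} {w : Weight I} {s : I → ℝ} {p : I → Prop}
    (h2 : ∀ i, s i ≤ 2) (hp : ∀ i, p i → 0 < s i) (hw : ∀ i, 0 < s i → (s i)⁻¹ ≤ w i) :
    PowData w s fun i => ind (p i) where
  le_two := h2
  zero i hi := ind_false fun h => absurd (hp i h) (not_lt.2 hi)
  bound i hi := (norm_ind_le _).trans (by
    have := mul_le_mul_of_nonneg_left (hw i hi) hi.le
    rwa [mul_inv_cancel₀ hi.ne'] at this)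

lemma fst_le_two (y : Pair) : (y.1 : ℝ) ≤ 2 := by linarith [y.1.2.2]
lemma snd_le_two (y : Pair) : (y.2 : ℝ) ≤ 2 := by linarith [y.2.2.2]
lemma sum_le_two (y : Pair) : (y.1 : ℝ) + y.2 ≤ 2 := by linarith [y.1.2.2, y.2.2.2]

lemma inv_sum_le_wA (y : Pair) (_ : 0 < (y.1 : ℝ) + y.2) : ((y.1 : ℝ) + y.2)⁻¹ ≤ wA y := by
  rcases y.1.2.1.eq_or_lt with h0 | h0
  · rw [← h0, zero_add]; exact inv_snd_le_wA y
  · exact (inv_anti₀ h0 (by linarith [y.2.2.1])).trans (inv_fst_le_wA y)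

lemma pd_chi1 : PowData wA (fun y => (y.1 : ℝ)) fun y => ind (0 < (y.1 : ℝ)) :=
  .of_ind fst_le_two (fun _ h => h) fun y _ => inv_fst_le_wA y
lemma pd_chi0 : PowData wA (fun y => (y.2 : ℝ)) fun y => ind (0 < (y.2 : ℝ)) :=
  .of_ind snd_le_two (fun _ h => h) fun y _ => inv_snd_le_wA y
lemma pd_chiP : PowData wA (fun y => (y.1 : ℝ)) fun y => ind (0 < (y.1 : ℝ) ∧ 0 < (y.2 : ℝ)) :=
  .of_ind fst_le_two (fun _ h => h.1) fun y _ => inv_fst_le_wA y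
lemma pd_xi1 : PowData wA (fun y => (y.1 : ℝ)) fun y => ind (0 < (y.1 : ℝ) ∧ (y.2 : ℝ) = 0) :=
  .of_ind fst_le_two (fun _ h => h.1) fun y _ => inv_fst_le_wA y
lemma pd_xi0 : PowData wA (fun y => (y.2 : ℝ)) fun y => ind (0 < (y.2 : ℝ) ∧ (y.1 : ℝ) = 0) :=
  .of_ind snd_le_two (fun _ h => h.1) fun y _ => inv_snd_le_wA y
lemma pd_UF : PowData wA (fun y => (y.1 : ℝ) + y.2) fun y => ind (0 < (y.1 : ℝ) ∧ 0 < (y.2 : ℝ)) :=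
  .of_ind sum_le_two (fun _ h => by linarith [h.1, h.2]) inv_sum_le_wA
lemma pd_U : PowData wA (fun y => (y.1 : ℝ) + y.2) fun y => ind (0 < (y.1 : ℝ) + y.2) :=
  .of_ind sum_le_two (fun _ h => h) inv_sum_le_wA
lemma pd_V : PowData wB (fun s => 1 - (s.1.1 : ℝ) - s.1.2)
    fun s => ind (0 < 1 - (s.1.1 : ℝ) - s.1.2) :=
  .of_ind (fun s => by linarith [s.1.1.2.1, s.1.2.2.1]) (fun _ h => h) fun s _ => inv_sub_le_wB s

/-- The character `(u, v) ↦ u ^ z`. -/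
def chi1 (z : ℂ) : SpA →L[ℂ] ℂ := powLift wA (fun y => (y.1 : ℝ)) (fun y => ind (0 < (y.1 : ℝ))) z
/-- The character `(u, v) ↦ v ^ z`. -/
def chi0 (z : ℂ) : SpA →L[ℂ] ℂ := powLift wA (fun y => (y.2 : ℝ)) (fun y => ind (0 < (y.2 : ℝ))) z
/-- The character `(u, v) ↦ u ^ z 1{u, v > 0}`. -/
def chiP (z : ℂ) : SpA →L[ℂ] ℂ :=
  powLift wA (fun y => (y.1 : ℝ)) (fun y => ind (0 < (y.1 : ℝ) ∧ 0 < (y.2 : ℝ))) z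
/-- The functional `(u, v) ↦ u ^ z 1{u > 0, v = 0}`. -/
def xi1 (z : ℂ) : SpA →L[ℂ] ℂ :=
  powLift wA (fun y => (y.1 : ℝ)) (fun y => ind (0 < (y.1 : ℝ) ∧ (y.2 : ℝ) = 0)) z
/-- The functional `(u, v) ↦ v ^ z 1{v > 0, u = 0}`. -/
def xi0 (z : ℂ) : SpA →L[ℂ] ℂ :=
  powLift wA (fun y => (y.2 : ℝ)) (fun y => ind (0 < (y.2 : ℝ) ∧ (y.1 : ℝ) = 0)) z
/-- The functional `(u, v) ↦ (u + v) ^ z 1{u, v > 0}`. -/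
def UF (z : ℂ) : SpA →L[ℂ] ℂ :=
  powLift wA (fun y => (y.1 : ℝ) + y.2) (fun y => ind (0 < (y.1 : ℝ) ∧ 0 < (y.2 : ℝ))) z
/-- The functional `(u, v) ↦ (u + v) ^ z`. -/
def UU (z : ℂ) : SpA →L[ℂ] ℂ :=
  powLift wA (fun y => (y.1 : ℝ) + y.2) (fun y => ind (0 < (y.1 : ℝ) + y.2)) z
/-- The functional `(a, b) ↦ (1 - a - b) ^ z`. -/
def VV (z : ℂ) : SpB →L[ℂ] ℂ :=
  powLift wB (fun s => 1 - (s.1.1 : ℝ) - s.1.2) (fun s => ind (0 < 1 - (s.1.1 : ℝ) - s.1.2)) z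

/-- The normalized message of a pair with positive entries. -/
def Pair.free (y : Pair) (h : 0 < (y.1 : ℝ) ∧ 0 < (y.2 : ℝ)) : Free :=
  ⟨(y.1 : ℝ) / (y.1 + y.2), div_pos h.1 (add_pos h.1 h.2),
    (div_lt_one (add_pos h.1 h.2)).2 (by linarith [h.2])⟩

open scoped Classical in
/-- The basis vector of the normalized message; zero for frozen pairs. -/
def msg (y : Pair) : SpE :=
  if h : 0 < (y.1 : ℝ) ∧ 0 < (y.2 : ℝ) then L1.delta wE (y.free h) else 0

lemma msg_pos {y : Pair} (h : 0 < (y.1 : ℝ) ∧ 0 < (y.2 : ℝ)) : msg y = L1.delta wE (y.free h) :=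
  dif_pos h
lemma msg_neg {y : Pair} (h : ¬(0 < (y.1 : ℝ) ∧ 0 < (y.2 : ℝ))) : msg y = 0 := dif_neg h

/-- The message u/(u+v) has weight (u+v) max(1/u, 1/v). The weights `wE` and `wA` are matched so
that normalization costs precisely the factor u + v allowed by `PowData`. -/
lemma wE_free (y : Pair) (h : 0 < (y.1 : ℝ) ∧ 0 < (y.2 : ℝ)) :
    wE (y.free h) ≤ ((y.1 : ℝ) + y.2) * wA y := by
  have hs := add_pos h.1 h.2
  rw [wE_apply]
  have e1 : ((y.free h : Free) : ℝ) = (y.1 : ℝ) / (y.1 + y.2) := rfl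
  have e2 : 1 - (y.1 : ℝ) / (y.1 + y.2) = (y.2 : ℝ) / (y.1 + y.2) := by
    field_simp; ring
  rw [e1, e2, inv_div, inv_div, div_eq_mul_inv, div_eq_mul_inv]
  exact max_le (mul_le_mul_of_nonneg_left (inv_fst_le_wA y) hs.le)
    (mul_le_mul_of_nonneg_left (inv_snd_le_wA y) hs.le)

lemma pd_L : PowData wA (fun y => (y.1 : ℝ) + y.2) msg where
  le_two := sum_le_two
  zero y hy := msg_neg fun h => by linarith [h.1, h.2]
  bound y hy := by
    by_cases h : 0 < (y.1 : ℝ) ∧ 0 < (y.2 : ℝ)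
    · rw [msg_pos h, L1.norm_delta]
      exact wE_free y h
    · rw [msg_neg h, norm_zero]
      exact mul_nonneg hy.le (wA.pos y).le

/-- The map `(u, v) ↦ (u + v) ^ z δ_{u / (u + v)}` to free messages. -/
def LL (z : ℂ) : SpA →L[ℂ] SpE := powLift wA (fun y => (y.1 : ℝ) + y.2) msg z

variable {z : ℂ}

lemma ofReal_mul_cpow {a b : ℝ} (ha : 0 ≤ a) (hb : 0 ≤ b) (z : ℂ) :
    ((a * b : ℝ) : ℂ) ^ z = (a : ℂ) ^ z * (b : ℂ) ^ z := by
  rw [Complex.ofReal_mul, Complex.mul_cpow_ofReal_nonneg ha hb]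

lemma pos_mul_iff {a b : ℝ} (ha : 0 ≤ a) (hb : 0 ≤ b) : 0 < a * b ↔ 0 < a ∧ 0 < b := by
  constructor
  · intro h
    exact ⟨pos_of_mul_pos_left h hb, pos_of_mul_pos_right h ha⟩
  · exact fun h => mul_pos h.1 h.2

lemma chi1_mul (hz : z ∈ strip) (a b : SpA) : chi1 z (a * b) = chi1 z a * chi1 z b := by
  refine L1.lift_mul (pd_chi1.powFam_bound hz) (fun x y => ?_) a b
  simp only [powFam, pair_mul_fst, pos_mul_iff x.1.2.1 y.1.2.1, ind_and, smul_eq_mul,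
    ofReal_mul_cpow x.1.2.1 y.1.2.1]
  ring

lemma chiP_mul (hz : z ∈ strip) (a b : SpA) : chiP z (a * b) = chiP z a * chiP z b := by
  refine L1.lift_mul (pd_chiP.powFam_bound hz) (fun x y => ?_) a b
  simp only [powFam, pair_mul_fst, pair_mul_snd, pos_mul_iff x.1.2.1 y.1.2.1,
    pos_mul_iff x.2.2.1 y.2.2.1, ind_and, smul_eq_mul, ofReal_mul_cpow x.1.2.1 y.1.2.1]
  ring

lemma pow_of_mul {R : Type*} [Monoid R] {f : R → ℂ} (h1 : f 1 = 1)
    (h : ∀ a b, f (a * b) = f a * f b) (a : R) (n : ℕ) : f (a ^ n) = f a ^ n := by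
  induction n with
  | zero => simpa using h1
  | succ n ih => rw [pow_succ, h, ih, pow_succ]

lemma one_pair_fst : ((1 : Pair).1 : ℝ) = 1 := rfl
lemma one_pair_snd : ((1 : Pair).2 : ℝ) = 1 := rfl

lemma chi1_one (hz : z ∈ strip) : chi1 z 1 = 1 := by
  rw [L1.one_def, chi1, pd_chi1.powLift_delta hz, one_pair_fst, ind_true one_pos]; simp
lemma chiP_one (hz : z ∈ strip) : chiP z 1 = 1 := by
  rw [L1.one_def, chiP, pd_chiP.powLift_delta hz, one_pair_fst, one_pair_snd,
    ind_true ⟨one_pos, one_pos⟩]; simp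

lemma chi1_pow (hz : z ∈ strip) (a : SpA) (n : ℕ) : chi1 z (a ^ n) = chi1 z a ^ n :=
  pow_of_mul (chi1_one hz) (chi1_mul hz) a n
lemma chiP_pow (hz : z ∈ strip) (a : SpA) (n : ℕ) : chiP z (a ^ n) = chiP z a ^ n :=
  pow_of_mul (chiP_one hz) (chiP_mul hz) a n

lemma chi1_eq (hz : z ∈ strip) (a : SpA) : chi1 z a = chiP z a + xi1 z a := by
  have : chi1 z = chiP z + xi1 z := L1.clm_ext fun y => by
    rw [add_apply, chi1, chiP, xi1, pd_chi1.powLift_delta hz,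
      pd_chiP.powLift_delta hz, pd_xi1.powLift_delta hz, ← smul_add]
    congr 1
    by_cases h1 : 0 < (y.1 : ℝ)
    · rcases y.2.2.1.eq_or_lt with h2 | h2
      · rw [ind_true h1, ind_false (by rw [← h2]; simp), ind_true ⟨h1, h2.symm⟩, zero_add]
      · rw [ind_true h1, ind_true ⟨h1, h2⟩, ind_false (fun h => h2.ne' h.2), add_zero]
    · rw [ind_false h1, ind_false (fun h => h1 h.1), ind_false (fun h => h1 h.1), zero_add]
  exact DFunLike.congr_fun this a

lemma UU_eq (hz : z ∈ strip) (a : SpA) : UU z a = UF z a + xi1 z a + xi0 z a := by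
  have : UU z = UF z + xi1 z + xi0 z := L1.clm_ext fun y => by
    rw [add_apply, add_apply, UU, UF, xi1, xi0, pd_U.powLift_delta hz,
      pd_UF.powLift_delta hz, pd_xi1.powLift_delta hz, pd_xi0.powLift_delta hz]
    rcases y.1.2.1.eq_or_lt with h1 | h1 <;> rcases y.2.2.1.eq_or_lt with h2 | h2
    · simp [ind, ← h1, ← h2]
    · simp [ind, ← h1, h2, h2.ne']
    · simp [ind, ← h2, h1, h1.ne']
    · simp [ind, h1, h2, h1.ne', h2.ne', add_pos h1 h2]
  exact DFunLike.congr_fun this a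

lemma f1_fst : (((1, 0) : Pair).1 : ℝ) = 1 := rfl
lemma f1_snd : (((1, 0) : Pair).2 : ℝ) = 0 := rfl
lemma f0_fst : (((0, 1) : Pair).1 : ℝ) = 0 := rfl
-- One forcing clause annihilates a coordinate of the product, and a pair with a zero coordinate has
-- no free message. The same holds for `f0` and for `UF`.
lemma LL_f1_mul (hz : z ∈ strip) (a : SpA) : LL z (f1 * a) = 0 := by
  have : LL z ∘L L1.mulCLM wA f1 = 0 := L1.clm_ext fun y => by
    rw [ContinuousLinearMap.comp_apply, f1, L1.mulCLM_delta, LL, pd_L.powLift_delta hz, msg_neg]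
    · simp
    · simp
  exact DFunLike.congr_fun this a

lemma LL_f0_mul (hz : z ∈ strip) (a : SpA) : LL z (f0 * a) = 0 := by
  have : LL z ∘L L1.mulCLM wA f0 = 0 := L1.clm_ext fun y => by
    rw [ContinuousLinearMap.comp_apply, f0, L1.mulCLM_delta, LL, pd_L.powLift_delta hz, msg_neg]
    · simp
    · simp
  exact DFunLike.congr_fun this a

lemma UF_f1_mul (hz : z ∈ strip) (a : SpA) : UF z (f1 * a) = 0 := by
  have : UF z ∘L L1.mulCLM wA f1 = 0 := L1.clm_ext fun y => by
    rw [ContinuousLinearMap.comp_apply, f1, L1.mulCLM_delta, UF, pd_UF.powLift_delta hz, ind_false]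
    · simp
    · simp
  exact DFunLike.congr_fun this a

lemma UF_f0_mul (hz : z ∈ strip) (a : SpA) : UF z (f0 * a) = 0 := by
  have : UF z ∘L L1.mulCLM wA f0 = 0 := L1.clm_ext fun y => by
    rw [ContinuousLinearMap.comp_apply, f0, L1.mulCLM_delta, UF, pd_UF.powLift_delta hz, ind_false]
    · simp
    · simp
  exact DFunLike.congr_fun this a

lemma UF_one (hz : z ∈ strip) : UF z 1 = 2 ^ z := by
  rw [L1.one_def, UF, pd_UF.powLift_delta hz, one_pair_fst, one_pair_snd,
    ind_true ⟨one_pos, one_pos⟩]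
  norm_num

lemma chi1_f1 (hz : z ∈ strip) : chi1 z f1 = 1 := by
  rw [f1, chi1, pd_chi1.powLift_delta hz, f1_fst, ind_true one_pos]; simp
lemma chi1_f0 (hz : z ∈ strip) : chi1 z f0 = 0 := by
  rw [f0, chi1, pd_chi1.powLift_delta hz, f0_fst, ind_false (lt_irrefl _)]; simp

/-! ### Clause identities -/

lemma VV_delta (hz : z ∈ strip) (s : Clause) : VV z (L1.delta wB s)
    = ((1 - (s.1.1 : ℝ) - s.1.2 : ℝ) : ℂ) ^ z * ind (0 < 1 - (s.1.1 : ℝ) - s.1.2) :=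
  pd_V.powLift_delta hz s

lemma VV_zz_mul (hz : z ∈ strip) (b : SpB) : VV z (zz * b) = mass wB b := by
  rw [zz_mul, map_smul, zz_eq, VV_delta hz]
  simp only [clause_mul_fst, clause_mul_snd, pt_zero_fst, pt_one_snd, zero_mul, mul_zero, sub_zero]
  rw [ind_true one_pos]; simp

/-- Adding a frozen message 1 to the clause turns (a, b) into (a, 0), whose weight 1 - a is the
first coordinate of the flipped pair. -/
lemma chi1_flipL (hz : z ∈ strip) (b : SpB) : chi1 z (flipL b) = VV z (e1 * b) := by
  have : chi1 z ∘L flipL = VV z ∘L L1.mulCLM wB e1 := L1.clm_ext fun s => by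
    rw [ContinuousLinearMap.comp_apply, ContinuousLinearMap.comp_apply, flipL_delta, e1,
      L1.mulCLM_delta, VV_delta hz, chi1, pd_chi1.powLift_delta hz, flipPt_fst]
    simp only [clause_mul_fst, clause_mul_snd, pt_one_fst, pt_one_snd, one_mul, zero_mul, sub_zero,
      smul_eq_mul]
  exact DFunLike.congr_fun this b

lemma chi0_flipL (hz : z ∈ strip) (b : SpB) : chi0 z (flipL b) = VV z (e0 * b) := by
  have : chi0 z ∘L flipL = VV z ∘L L1.mulCLM wB e0 := L1.clm_ext fun s => by
    rw [ContinuousLinearMap.comp_apply, ContinuousLinearMap.comp_apply, flipL_delta, e0,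
      L1.mulCLM_delta, VV_delta hz, chi0, pd_chi0.powLift_delta hz, flipPt_snd]
    simp only [clause_mul_fst, clause_mul_snd, pt_zero_fst, pt_zero_snd, one_mul, zero_mul,
      sub_zero, smul_eq_mul]
  exact DFunLike.congr_fun this b

/-- The duality between variables and clauses. With r = u/(u+v), u(1 - a) + v(1 - b) = (u + v)(1 -
ra - (1 - r)b): the weight of a variable that receives one more clause message is its normalization
times the weight of that clause fed with the variable's outgoing message. The last two terms are the
pairs (u, v) with one zero coordinate, whose outgoing message is frozen. -/
lemma UU_mul_flipL (hz : z ∈ strip) (a : SpA) (b : SpB) :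
    UU z (a * flipL b)
      = VV z (emb (LL z a) * b) + xi1 z a * VV z (e1 * b) + xi0 z a * VV z (e0 * b) := by
  have key : ∀ y s, UU z (L1.delta wA y * flipL (L1.delta wB s))
      = VV z (emb (LL z (L1.delta wA y)) * L1.delta wB s)
        + xi1 z (L1.delta wA y) * VV z (e1 * L1.delta wB s)
        + xi0 z (L1.delta wA y) * VV z (e0 * L1.delta wB s) := by
    intro y s
    rw [← chi1_flipL hz, ← chi0_flipL hz, flipL_delta, L1.delta_mul, LL, pd_L.powLift_delta hz,
      map_smul, smul_mul_assoc, map_smul, UU, pd_U.powLift_delta hz, xi1, xi0,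
      pd_xi1.powLift_delta hz, pd_xi0.powLift_delta hz, chi1, chi0, pd_chi1.powLift_delta hz,
      pd_chi0.powLift_delta hz, pair_mul_fst, pair_mul_snd]
    set c := flipPt s with hc
    rcases y.1.2.1.eq_or_lt with h1 | h1 <;> rcases y.2.2.1.eq_or_lt with h2 | h2
    · rw [msg_neg (by simp [← h1])]
      simp [ind, ← h1, ← h2]
    · rw [msg_neg (by simp [← h1])]
      simp only [← h1, zero_mul, zero_add, map_zero, smul_zero, smul_eq_mul,
        ofReal_mul_cpow y.2.2.1 c.2.2.1]
      simp [ind, h2, h2.ne']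
    · rw [msg_neg (by simp [← h2])]
      simp only [← h2, zero_mul, zero_add, map_zero, smul_zero, smul_eq_mul, add_zero,
        ofReal_mul_cpow y.1.2.1 c.1.2.1]
      simp [ind, h1, h1.ne']
    · have h := And.intro h1 h2
      have hs := add_pos h1 h2
      rw [msg_pos h, emb_delta, L1.delta_mul, VV_delta hz,
        ind_false (p := 0 < (y.1 : ℝ) ∧ (y.2 : ℝ) = 0) (fun h => h2.ne' h.2),
        ind_false (p := 0 < (y.2 : ℝ) ∧ (y.1 : ℝ) = 0) (fun h => h1.ne' h.2)]
      simp only [smul_zero, zero_mul, add_zero, clause_mul_fst, clause_mul_snd, pt_fst, pt_snd]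
      have e1 : ((Free.toI (y.free h) : unitInterval) : ℝ) = (y.1 : ℝ) / (y.1 + y.2) := rfl
      have e3 : (y.1 : ℝ) * c.1 + y.2 * c.2 = (y.1 + y.2) * (1 - (y.1 : ℝ) / (y.1 + y.2) * s.1.1
          - (1 - (y.1 : ℝ) / (y.1 + y.2)) * s.1.2) := by
        rw [hc, flipPt_fst, flipPt_snd]; field_simp; ring
      have e4 : 0 ≤ (1 - (y.1 : ℝ) / (y.1 + y.2) * s.1.1
          - (1 - (y.1 : ℝ) / (y.1 + y.2)) * s.1.2) := by
        have : 0 ≤ (y.1 : ℝ) * c.1 + y.2 * c.2 :=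
          add_nonneg (mul_nonneg h1.le c.1.2.1) (mul_nonneg h2.le c.2.2.1)
        rw [e3] at this
        exact nonneg_of_mul_nonneg_right this hs
      rw [e1, e3, ofReal_mul_cpow hs.le e4, pos_mul_iff hs.le e4, ind_and, ind_true hs]
      simp only [smul_eq_mul]
      ring
  have h1 : ∀ y, UU z ∘L (L1.mulCLM wA (L1.delta wA y)) ∘L flipL
      = VV z ∘L (L1.mulCLM wB (emb (LL z (L1.delta wA y))))
        + xi1 z (L1.delta wA y) • (VV z ∘L L1.mulCLM wB e1)
        + xi0 z (L1.delta wA y) • (VV z ∘L L1.mulCLM wB e0) :=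
    fun y => L1.clm_ext fun s => key y s
  have h2 : UU z ∘L (L1.mulCLM wA).flip (flipL b)
      = VV z ∘L (L1.mulCLM wB).flip b ∘L emb ∘L LL z
        + (xi1 z).smulRight (VV z (e1 * b)) + (xi0 z).smulRight (VV z (e0 * b)) :=
    L1.clm_ext fun y => DFunLike.congr_fun (h1 y) b
  exact DFunLike.congr_fun h2 a

/-- The only frozen-by-one-clause contribution comes from all messages being zero. -/
lemma xi1_flipL_pow (hz : z ∈ strip) (p : SpE) {n : ℕ} :
    xi1 z (flipL ((e0 + e1 + emb p) ^ n)) = xi1 z (flipL (e0 ^ n)) := by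
  -- A factor x that is 1 or free makes the second entry (1 - x)b of the clause product smaller than
  -- 1. The flipped second coordinate is then positive, and `xi1` vanishes there.
  have k1 : ∀ b, xi1 z (flipL (e1 * b)) = 0 := by
    intro b
    have : xi1 z ∘L flipL ∘L L1.mulCLM wB e1 = 0 := L1.clm_ext fun s => by
      rw [ContinuousLinearMap.comp_apply, ContinuousLinearMap.comp_apply, e1, L1.mulCLM_delta,
        flipL_delta, xi1, pd_xi1.powLift_delta hz, flipPt_snd, clause_mul_snd, pt_one_snd]
      simp [ind]
    exact DFunLike.congr_fun this b
  have k2 : ∀ b, xi1 z (flipL (emb p * b)) = 0 := by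
    have h1 : ∀ x, xi1 z ∘L flipL ∘L L1.mulCLM wB (L1.delta wB (pt (Free.toI x))) = 0 :=
      fun x => L1.clm_ext fun s => by
        rw [ContinuousLinearMap.comp_apply, ContinuousLinearMap.comp_apply, L1.mulCLM_delta,
          flipL_delta, xi1, pd_xi1.powLift_delta hz, flipPt_snd, clause_mul_snd, pt_snd, ind_false]
        · simp
        · intro h
          have hx : ((Free.toI x : unitInterval) : ℝ) = x := rfl
          rw [hx] at h
          nlinarith [h.2, x.2.1, x.2.2, s.1.2.2.1, s.1.2.2.2]
    intro b
    have h2 : xi1 z ∘L flipL ∘L (L1.mulCLM wB).flip b ∘L emb = 0 := L1.clm_ext fun x => by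
      have := DFunLike.congr_fun (h1 x) b
      rw [ContinuousLinearMap.comp_apply, ContinuousLinearMap.comp_apply,
        ContinuousLinearMap.comp_apply, emb_delta]
      exact this
    exact DFunLike.congr_fun h2 p
  obtain ⟨c, hc⟩ := sub_dvd_pow_sub_pow (e0 + e1 + emb p) e0 n
  have e : (e0 + e1 + emb p) ^ n = e0 ^ n + (e1 * c + emb p * c) := by
    linear_combination hc
  rw [e, map_add, map_add, map_add, map_add, k1, k2]
  simp

end

end NaeSat

namespace NaeSat

noncomputable section

set_option linter.unusedSectionVars false

variable {z : ℂ}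

/-! ### The recursion on free parts -/

/-- The total message measure with free part `p`. -/
def full (p : SpE) : SpB := e0 + e1 + emb p

/-- The unnormalized clause-to-variable message. -/
def qq (n : ℕ) (p : SpE) : SpA := flipL (full p ^ n)

/-- The mass of the clauses that contain both frozen values. -/
def mixed (n : ℕ) (t : ℂ) : ℂ := (2 + t) ^ n - 2 * (1 + t) ^ n + t ^ n

/-- The frozen mass after one step of the recursion. -/
def kap (n N : ℕ) (z : ℂ) (p : SpE) : ℂ := chi1 z (qq n p) ^ N - (chi1 z (qq n p) - 1) ^ N

/-- The recursion on free parts. -/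
def TT (n N : ℕ) (z : ℂ) (p : SpE) : SpE := (kap n N z p)⁻¹ • LL z (qq n p ^ N)

/-- Every monomial that contains both `e0` and `e1` is a multiple of the absorbing `zz`. The
monomials that miss one of them are counted by inclusion and exclusion. -/
lemma exists_smul_zz (p : SpB) (n : ℕ) : ∃ c : ℂ,
    (e0 + e1 + p) ^ n = c • zz + (e0 + p) ^ n + (e1 + p) ^ n - p ^ n := by
  induction n with
  | zero => exact ⟨0, by simp⟩
  | succ n ih =>
    obtain ⟨c, hc⟩ := ih
    obtain ⟨y, hy⟩ := sub_dvd_pow_sub_pow (e0 + p) p n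
    obtain ⟨y', hy'⟩ := sub_dvd_pow_sub_pow (e1 + p) p n
    refine ⟨mass wB (e0 + e1 + p) * c + mass wB y + mass wB y', ?_⟩
    have h1 : (e0 + e1 + p) * (c • zz) = (mass wB (e0 + e1 + p) * c) • zz := by
      rw [mul_smul_comm, mul_comm, zz_mul, smul_smul, mul_comm]
    have h2 : e1 * ((e0 + p) ^ n - p ^ n) = mass wB y • zz := by
      rw [hy, ← zz_mul, zz]; ring
    have h3 : e0 * ((e1 + p) ^ n - p ^ n) = mass wB y' • zz := by
      rw [hy', ← zz_mul, zz]; ring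
    rw [pow_succ', hc, add_smul, add_smul, ← h1, ← h2, ← h3]
    ring

/-- The coefficient of `zz` is identified by comparing total masses, since mass is multiplicative.
-/
lemma full_pow (p : SpE) (n : ℕ) : full p ^ n
    = mixed n (mass wE p) • zz + (e0 + emb p) ^ n + (e1 + emb p) ^ n - emb p ^ n := by
  obtain ⟨c, hc⟩ := exists_smul_zz (emb p) n
  rw [full, hc]
  have h := congrArg (mass wB) hc
  simp only [map_add, map_sub, map_smul, mass_pow, mass_e0, mass_e1, mass_emb, mass_zz,
    smul_eq_mul, mul_one] at h
  have : c = mixed n (mass wE p) := by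
    rw [mixed]
    linear_combination -h
  rw [this]

/-- The one-sided part of the clause message. -/
def remB (n : ℕ) (p : SpE) : SpB :=
  ((e0 + emb p) ^ n - e0) + ((e1 + emb p) ^ n - e1) - emb p ^ n

/-- The free non-trivial part of the clause-to-variable message. -/
def rem (n : ℕ) (p : SpE) : SpA := flipL (remB n p)

/-- The free part of the clause-to-variable message. -/
def freeq (n : ℕ) (p : SpE) : SpA := mixed n (mass wE p) • 1 + rem n p

lemma qq_eq (n : ℕ) (p : SpE) : qq n p = freeq n p + f1 + f0 := by
  have h : full p ^ n = mixed n (mass wE p) • zz + remB n p + e0 + e1 := by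
    rw [full_pow, remB]; abel
  rw [qq, h, map_add, map_add, map_add, map_smul, flipL_zz, flipL_e0, flipL_e1, freeq, rem]

lemma LL_qq_pow (hz : z ∈ strip) (n N : ℕ) (p : SpE) :
    LL z (qq n p ^ N) = LL z (freeq n p ^ N) := by
  obtain ⟨y, hy⟩ := sub_dvd_pow_sub_pow (freeq n p + f1 + f0) (freeq n p) N
  have e : qq n p ^ N = freeq n p ^ N + (f1 * y + f0 * y) := by
    rw [qq_eq]; linear_combination hy
  rw [e, map_add, map_add, LL_f1_mul hz, LL_f0_mul hz, add_zero, add_zero]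

lemma UF_qq_pow (hz : z ∈ strip) (n N : ℕ) (p : SpE) :
    UF z (qq n p ^ N) = UF z (freeq n p ^ N) := by
  obtain ⟨y, hy⟩ := sub_dvd_pow_sub_pow (freeq n p + f1 + f0) (freeq n p) N
  have e : qq n p ^ N = freeq n p ^ N + (f1 * y + f0 * y) := by
    rw [qq_eq]; linear_combination hy
  rw [e, map_add, map_add, UF_f1_mul hz, UF_f0_mul hz, add_zero, add_zero]

lemma chi1_qq (hz : z ∈ strip) (n : ℕ) (p : SpE) :
    chi1 z (qq n p) = mixed n (mass wE p) + chi1 z (rem n p) + 1 := by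
  rw [qq_eq, freeq, map_add, map_add, map_add, map_smul, chi1_one hz, chi1_f1 hz, chi1_f0 hz]
  simp

lemma e0_pow {n : ℕ} (hn : n ≠ 0) : e0 ^ n = e0 := by
  obtain ⟨n, rfl⟩ := Nat.exists_eq_succ_of_ne_zero hn
  exact IsIdempotentElem.pow_succ_eq n e0_mul_self
lemma e1_pow {n : ℕ} (hn : n ≠ 0) : e1 ^ n = e1 := by
  obtain ⟨n, rfl⟩ := Nat.exists_eq_succ_of_ne_zero hn
  exact IsIdempotentElem.pow_succ_eq n e1_mul_self

lemma xi1_f1 (hz : z ∈ strip) : xi1 z f1 = 1 := by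
  rw [f1, xi1, pd_xi1.powLift_delta hz, f1_fst, f1_snd, ind_true ⟨one_pos, rfl⟩]; simp

/-- The clause message forces its variable to 1 only when all n inputs are frozen at 0. This has
mass exactly one, independently of `p`. -/
lemma chiP_qq (hz : z ∈ strip) {n : ℕ} (hn : n ≠ 0) (p : SpE) :
    chiP z (qq n p) = chi1 z (qq n p) - 1 := by
  have h := xi1_flipL_pow hz p (n := n)
  rw [e0_pow hn, flipL_e0, xi1_f1 hz] at h
  rw [chi1_eq hz (qq n p), qq, full, h]
  ring

/-- The functional `xi1` is the difference of the characters `chi1` and `chiP`, so on an N-th power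
it is a difference of N-th powers. -/
lemma xi1_qq_pow (hz : z ∈ strip) {n : ℕ} (hn : n ≠ 0) (N : ℕ) (p : SpE) :
    xi1 z (qq n p ^ N) = kap n N z p := by
  have h := chi1_eq hz (qq n p ^ N)
  rw [chi1_pow hz, chiP_pow hz, chiP_qq hz hn] at h
  rw [kap]
  linear_combination -h

/-! ### Symmetry -/

/-- `x ↦ 1 - x` on free messages. -/
def Free.swap (x : Free) : Free := ⟨1 - x, by linarith [x.2.2], by linarith [x.2.1]⟩
/-- Exchange of the coordinates of a pair. -/
def swapPair (y : Pair) : Pair := (y.2, y.1)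
/-- Exchange of the coordinates of a clause pair. -/
def swapClause (s : Clause) : Clause := ⟨(s.1.2, s.1.1), by
  rcases s.2 with h | h
  · left; show (s.1.2 : ℝ) + s.1.1 ≤ 1; rw [add_comm]; exact h
  · right; rw [h]; rfl⟩

/-- The symmetry on `SpE`. -/
def swapE : SpE →L[ℂ] SpE := L1.lift wE fun x => L1.delta wE x.swap
/-- The symmetry on `SpA`. -/
def swapA : SpA →L[ℂ] SpA := L1.lift wA fun y => L1.delta wA (swapPair y)
/-- The symmetry on `SpB`. -/
def swapB : SpB →L[ℂ] SpB := L1.lift wB fun s => L1.delta wB (swapClause s)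

lemma swapE_bound (x : Free) : ‖L1.delta wE x.swap‖ ≤ 1 * wE x := by
  rw [L1.norm_delta, wE_apply, wE_apply, one_mul]
  show max (1 - (x : ℝ))⁻¹ (1 - (1 - (x : ℝ)))⁻¹ ≤ _
  rw [sub_sub_cancel, max_comm]
lemma swapA_bound (y : Pair) : ‖L1.delta wA (swapPair y)‖ ≤ 1 * wA y := by
  rw [L1.norm_delta, wA_apply, wA_apply, one_mul]
  show max 1 (max (y.2 : ℝ)⁻¹ (y.1 : ℝ)⁻¹) ≤ _
  rw [max_comm (y.2 : ℝ)⁻¹]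
lemma swapB_bound (s : Clause) : ‖L1.delta wB (swapClause s)‖ ≤ 1 * wB s := by
  rw [L1.norm_delta, one_mul]
  refine max_le (max_le (wB.one_le s) (inv_snd_le_wB s)) (max_le (inv_fst_le_wB s) ?_)
  refine le_trans (le_of_eq ?_) (inv_sub_le_wB s)
  show (1 - (s.1.2 : ℝ) - s.1.1)⁻¹ = _
  ring_nf

lemma swapE_delta (x : Free) : swapE (L1.delta wE x) = L1.delta wE x.swap :=
  L1.lift_delta swapE_bound x
lemma swapA_delta (y : Pair) : swapA (L1.delta wA y) = L1.delta wA (swapPair y) :=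
  L1.lift_delta swapA_bound y
lemma swapB_delta (s : Clause) : swapB (L1.delta wB s) = L1.delta wB (swapClause s) :=
  L1.lift_delta swapB_bound s

lemma swapA_mul (a b : SpA) : swapA (a * b) = swapA a * swapA b :=
  L1.lift_mul swapA_bound (fun x y => by rw [L1.delta_mul]; rfl) a b
lemma swapB_mul (a b : SpB) : swapB (a * b) = swapB a * swapB b :=
  L1.lift_mul swapB_bound (fun x y => by rw [L1.delta_mul]; rfl) a b
lemma swapA_one : swapA 1 = 1 := by rw [L1.one_def, swapA_delta]; rfl
lemma swapB_one : swapB 1 = 1 := by rw [L1.one_def, swapB_delta]; rfl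
lemma swapA_pow (a : SpA) (n : ℕ) : swapA (a ^ n) = swapA a ^ n := by
  induction n with
  | zero => simpa using swapA_one
  | succ n ih => rw [pow_succ, swapA_mul, ih, pow_succ]
lemma swapB_pow (a : SpB) (n : ℕ) : swapB (a ^ n) = swapB a ^ n := by
  induction n with
  | zero => simpa using swapB_one
  | succ n ih => rw [pow_succ, swapB_mul, ih, pow_succ]

lemma swapB_e0 : swapB e0 = e1 := by
  rw [e0, swapB_delta, e1]; congr 1
  exact clause_ext (pt_zero_snd.trans pt_one_fst.symm) (pt_zero_fst.trans pt_one_snd.symm)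
lemma swapB_e1 : swapB e1 = e0 := by
  rw [e0, e1, swapB_delta]; congr 1
  exact clause_ext (pt_one_snd.trans pt_zero_fst.symm) (pt_one_fst.trans pt_zero_snd.symm)

lemma swapB_emb (p : SpE) : swapB (emb p) = emb (swapE p) := by
  have : swapB ∘L emb = emb ∘L swapE := L1.clm_ext fun x => by
    rw [ContinuousLinearMap.comp_apply, ContinuousLinearMap.comp_apply, emb_delta, swapE_delta,
      emb_delta, swapB_delta]
    congr 1
    refine clause_ext ?_ ?_
    · rfl
    · show (x : ℝ) = 1 - (1 - (x : ℝ)); ring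
  exact DFunLike.congr_fun this p

lemma swapA_flipL (b : SpB) : swapA (flipL b) = flipL (swapB b) := by
  have : swapA ∘L flipL = flipL ∘L swapB := L1.clm_ext fun s => by
    rw [ContinuousLinearMap.comp_apply, ContinuousLinearMap.comp_apply, flipL_delta, swapB_delta,
      flipL_delta, swapA_delta]
    rfl
  exact DFunLike.congr_fun this b

lemma VV_swapB (hz : z ∈ strip) (b : SpB) : VV z (swapB b) = VV z b := by
  have : VV z ∘L swapB = VV z := L1.clm_ext fun s => by
    rw [ContinuousLinearMap.comp_apply, swapB_delta, VV_delta hz, VV_delta hz]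
    have e : 1 - ((swapClause s).1.1 : ℝ) - (swapClause s).1.2 = 1 - (s.1.1 : ℝ) - s.1.2 := by
      show 1 - (s.1.2 : ℝ) - s.1.1 = _
      ring
    rw [e]
  exact DFunLike.congr_fun this b

lemma xi1_swapA (hz : z ∈ strip) (a : SpA) : xi1 z (swapA a) = xi0 z a := by
  have : xi1 z ∘L swapA = xi0 z := L1.clm_ext fun s => by
    rw [ContinuousLinearMap.comp_apply, swapA_delta, xi1, xi0, pd_xi1.powLift_delta hz,
      pd_xi0.powLift_delta hz]
    rfl
  exact DFunLike.congr_fun this a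

lemma LL_swapA (hz : z ∈ strip) (a : SpA) : LL z (swapA a) = swapE (LL z a) := by
  have : LL z ∘L swapA = swapE ∘L LL z := L1.clm_ext fun y => by
    rw [ContinuousLinearMap.comp_apply, ContinuousLinearMap.comp_apply, swapA_delta, LL,
      pd_L.powLift_delta hz, pd_L.powLift_delta hz, map_smul]
    have e : ((swapPair y).1 : ℝ) + (swapPair y).2 = y.1 + y.2 := add_comm _ _
    rw [e]
    congr 1
    by_cases h : 0 < (y.1 : ℝ) ∧ 0 < (y.2 : ℝ)
    · have h' : 0 < ((swapPair y).1 : ℝ) ∧ 0 < ((swapPair y).2 : ℝ) := ⟨h.2, h.1⟩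
      rw [msg_pos h, msg_pos h', swapE_delta]
      congr 1
      refine Subtype.ext ?_
      show (y.2 : ℝ) / (y.2 + y.1) = 1 - (y.1 : ℝ) / (y.1 + y.2)
      have := add_pos h.1 h.2
      have := add_pos h.2 h.1
      field_simp
      ring
    · rw [msg_neg h, map_zero, msg_neg fun h' => h ⟨h'.2, h'.1⟩]
  exact DFunLike.congr_fun this a

/-- Invariance under `x ↦ 1 - x`. -/
def Symm (p : SpE) : Prop := swapE p = p

lemma symm_zero : Symm 0 := map_zero _

section
variable {p : SpE} (hp : Symm p)
include hp

lemma Symm.swapB_full : swapB (full p) = full p := by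
  rw [full, map_add, map_add, swapB_e0, swapB_e1, swapB_emb, hp, add_comm e1 e0]

lemma Symm.swapA_qq (n : ℕ) : swapA (qq n p) = qq n p := by
  rw [qq, swapA_flipL, swapB_pow, hp.swapB_full]

/-- Symmetry makes both frozen masses equal to `kap`. Dividing by `kap`, as `TT` does, therefore
restores the form δ_0 + δ_1 + p. -/
lemma Symm.xi0_qq_pow (hz : z ∈ strip) {n : ℕ} (hn : n ≠ 0) (N : ℕ) :
    xi0 z (qq n p ^ N) = kap n N z p := by
  rw [← xi1_swapA hz, swapA_pow, hp.swapA_qq, xi1_qq_pow hz hn]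

lemma Symm.TT (hz : z ∈ strip) (n N : ℕ) : Symm (TT n N z p) := by
  rw [Symm, NaeSat.TT, map_smul, ← LL_swapA hz, swapA_pow, hp.swapA_qq]

lemma Symm.VV_e0 (hz : z ∈ strip) (n : ℕ) :
    VV z ((e0 + emb p) ^ n) = VV z ((e1 + emb p) ^ n) := by
  rw [← VV_swapB hz, swapB_pow, map_add, swapB_e0, swapB_emb, hp]

end

end

end NaeSat

namespace NaeSat

noncomputable section

set_option linter.unusedSectionVars false

variable {z : ℂ} {n d : ℕ} {p : SpE}

/-! ### Estimates for the recursion -/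

/-- The number `2 ^ (-n)`. -/
def hh (n : ℕ) : ℝ := (1 / 2) ^ n

lemma hh_pos (n : ℕ) : 0 < hh n := by unfold hh; positivity

/-- The range of parameters in which the estimates hold. -/
structure Good (n d : ℕ) : Prop where
  small : 10 ^ 10 * (n : ℝ) ^ 4 * hh n ≤ 1
  three : 3 ≤ n
  pos : 1 ≤ d
  upper : d * hh n ≤ (n + 1) * Real.log 2
  lower : (n + 1) * Real.log 2 * (1 - 2 * hh n) ≤ d * hh n

/-- The radius of the ball on which the recursion is studied. -/
def rad (n : ℕ) : ℝ := 1 / (4000 * (n : ℝ) ^ 2)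

lemma Good.n_ge (hg : Good n d) : (3 : ℝ) ≤ n := by exact_mod_cast hg.three

lemma Good.upper' (hg : Good n d) : d * hh n ≤ n := by
  have := hg.upper
  have h3 := hg.n_ge
  nlinarith [Real.log_two_lt_d9]

lemma Good.nh_le (hg : Good n d) : (n : ℝ) * hh n ≤ 1 / 10 ^ 10 := by
  have h3 := hg.n_ge
  have h0 := hh_pos n
  have h1 : (n : ℝ) ≤ (n : ℝ) ^ 4 := le_self_pow₀ (by linarith) (by norm_num)
  have := hg.small
  have : (n : ℝ) * hh n ≤ (n : ℝ) ^ 4 * hh n := by gcongr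
  linarith

lemma Good.h_le (hg : Good n d) : hh n ≤ 1 / 10 ^ 10 := by
  have h3 := hg.n_ge
  have h0 := hh_pos n
  have := hg.nh_le
  nlinarith

lemma rad_pos (hg : Good n d) : 0 < rad n := by
  have := hg.n_ge
  unfold rad; positivity

/-- Since d h ≤ n, a relative error of order n‖p‖h in one clause message grows to order n²‖p‖ over d
of them. The radius is chosen to keep this small. -/
lemma Good.sq_le (hg : Good n d) (hp : ‖p‖ ≤ rad n) : (n : ℝ) ^ 2 * ‖p‖ ≤ 1 / 4000 := by
  have h3 := hg.n_ge
  rw [rad, le_div_iff₀ (by positivity)] at hp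
  linarith

lemma Good.n_le (hg : Good n d) (hp : ‖p‖ ≤ rad n) : (n : ℝ) * ‖p‖ ≤ 1 / 12000 := by
  have h3 := hg.n_ge
  have := hg.sq_le hp
  have h0 : 0 ≤ (n : ℝ) * ‖p‖ := by positivity
  nlinarith

lemma Good.p_le (hg : Good n d) (hp : ‖p‖ ≤ rad n) : ‖p‖ ≤ 1 / 36000 := by
  have h3 := hg.n_ge
  have := hg.n_le hp
  nlinarith [norm_nonneg p]

lemma norm_frozen_pow_le {e : SpB} (he : ‖e‖ = 1) (hpow : e ^ n = e) (h : n * ‖p‖ ≤ 1) :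
    ‖(e + emb p) ^ n - e‖ ≤ 2 * (n * ‖p‖) := by
  have h1 := norm_add_pow_sub_pow_le e (emb p) n
  rw [hpow, he, one_pow] at h1
  refine h1.trans (le_trans ?_ (one_add_pow_sub_one_le (norm_nonneg p) h))
  gcongr
  exact norm_emb_le p

lemma norm_emb_pow_le : ‖emb p ^ n‖ ≤ ‖p‖ ^ n :=
  (norm_pow_le _ _).trans (pow_le_pow_left₀ (norm_nonneg _) (norm_emb_le p) n)

lemma norm_rem_le (hg : Good n d) (hp : ‖p‖ ≤ rad n) : ‖rem n p‖ ≤ 5 * (n * ‖p‖) := by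
  have h3 := hg.n_ge
  have hn : n ≠ 0 := by have := hg.three; omega
  have hs := hg.n_le hp
  have h1 := norm_frozen_pow_le (p := p) norm_e0 (e0_pow hn) (by linarith)
  have h2 := norm_frozen_pow_le (p := p) norm_e1 (e1_pow hn) (by linarith)
  have h4 : ‖emb p ^ n‖ ≤ n * ‖p‖ := by
    refine norm_emb_pow_le.trans ((pow_le_of_le_one (norm_nonneg _) ?_ hn).trans ?_)
    · linarith [hg.p_le hp]
    · nlinarith [norm_nonneg p]
  refine (norm_flipL_le _).trans ?_
  rw [remB]
  calc _ ≤ ‖(e0 + emb p) ^ n - e0‖ + ‖(e1 + emb p) ^ n - e1‖ + ‖emb p ^ n‖ :=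
        (norm_sub_le _ _).trans (add_le_add_left (norm_add_le _ _) _)
    _ ≤ _ := by linarith

lemma norm_clm_apply_le {A B : Type*} [NormedAddCommGroup A] [NormedSpace ℂ A]
    [NormedAddCommGroup B] [NormedSpace ℂ B] {f : A →L[ℂ] B} (hf : ‖f‖ ≤ 6) (a : A) :
    ‖f a‖ ≤ 6 * ‖a‖ := f.le_of_opNorm_le hf a

lemma norm_one_add_pow_le {t : ℂ} {τ : ℝ} (ht : ‖t‖ ≤ τ) (h : n * τ ≤ 1 / 2) :
    ‖(1 + t) ^ n‖ ≤ 2 := by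
  have h1 : ‖(1 + t) ^ n - 1‖ ≤ 2 * (n * τ) :=
    norm_pow_sub_one_le (by simpa using ht) (by linarith)
  calc _ = ‖((1 + t) ^ n - 1) + 1‖ := by ring_nf
    _ ≤ ‖(1 + t) ^ n - 1‖ + ‖(1 : ℂ)‖ := norm_add_le _ _
    _ ≤ 2 := by rw [norm_one]; linarith

lemma hh_mul_two_pow (n : ℕ) : (hh n : ℂ) * 2 ^ n = 1 := by
  rw [hh]; push_cast; rw [← mul_pow]; norm_num

lemma norm_hh (n : ℕ) : ‖(hh n : ℂ)‖ = hh n := by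
  rw [Complex.norm_real, Real.norm_of_nonneg (hh_pos n).le]

/-- After multiplication by h the leading term is (1 + t/2)^n, close to 1, and the two other terms
carry a factor h. -/
lemma norm_mixed_le (hg : Good n d) (hp : ‖p‖ ≤ rad n) :
    ‖(hh n : ℂ) * mixed n (mass wE p) - 1‖ ≤ n * ‖p‖ + 5 * hh n := by
  have hn : n ≠ 0 := by have := hg.three; omega
  have hs := hg.n_le hp
  have ht := norm_mass_le wE p
  set t := mass wE p
  have h1 : ‖(1 + t / 2) ^ n - 1‖ ≤ 2 * (n * (‖p‖ / 2)) := by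
    refine norm_pow_sub_one_le ?_ (by linarith)
    rw [add_sub_cancel_left, norm_div, Complex.norm_ofNat]
    linarith
  have h2 : ‖(1 + t) ^ n‖ ≤ 2 := norm_one_add_pow_le ht (by linarith)
  have h3 : ‖t ^ n‖ ≤ 1 := by
    rw [norm_pow]
    exact pow_le_one₀ (norm_nonneg _) (by linarith [hg.p_le hp])
  have e : (hh n : ℂ) * mixed n t - 1
      = ((1 + t / 2) ^ n - 1) - (hh n : ℂ) * (2 * (1 + t) ^ n - t ^ n) := by
    have : (2 + t) ^ n = 2 ^ n * (1 + t / 2) ^ n := by rw [← mul_pow]; ring_nf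
    rw [mixed, this]
    linear_combination (1 + t / 2) ^ n * hh_mul_two_pow n
  rw [e]
  refine (norm_sub_le _ _).trans ?_
  rw [norm_mul, norm_hh]
  have h4 : ‖2 * (1 + t) ^ n - t ^ n‖ ≤ 5 := by
    refine (norm_sub_le _ _).trans ?_
    rw [norm_mul, Complex.norm_ofNat]; linarith
  have := mul_le_mul_of_nonneg_left h4 (hh_pos n).le
  linarith

/-- The free clause mass `m`. -/
def mm (n : ℕ) (z : ℂ) (p : SpE) : ℂ := chi1 z (qq n p) - 1

/-- The relative error of `m ≈ 2 ^ n`. -/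
def eta (n : ℕ) (p : SpE) : ℝ := 31 * (n * ‖p‖) + 5 * hh n

lemma eta_nonneg (n : ℕ) (p : SpE) : 0 ≤ eta n p := by
  have := hh_pos n
  unfold eta; positivity

lemma mm_eq (hz : z ∈ strip) (n : ℕ) (p : SpE) :
    mm n z p = mixed n (mass wE p) + chi1 z (rem n p) := by
  rw [mm, chi1_qq hz]; ring

lemma norm_chi1_rem_le (hz : z ∈ strip) (hg : Good n d) (hp : ‖p‖ ≤ rad n) :
    ‖chi1 z (rem n p)‖ ≤ 30 * (n * ‖p‖) := by
  have h1 := norm_clm_apply_le (pd_chi1.norm_powLift_le hz) (rem n p)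
  have h2 := norm_rem_le hg hp
  have h3 : ‖chi1 z (rem n p)‖ ≤ 6 * ‖rem n p‖ := h1
  linarith

lemma norm_mm_le (hz : z ∈ strip) (hg : Good n d) (hp : ‖p‖ ≤ rad n) :
    ‖(hh n : ℂ) * mm n z p - 1‖ ≤ eta n p := by
  have h1 := norm_mixed_le hg hp
  have h2 := norm_chi1_rem_le hz hg hp
  have h0 := hh_pos n
  have e : (hh n : ℂ) * mm n z p - 1
      = ((hh n : ℂ) * mixed n (mass wE p) - 1) + (hh n : ℂ) * chi1 z (rem n p) := by
    rw [mm_eq hz]; ring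
  rw [e]
  refine (norm_add_le _ _).trans ?_
  rw [norm_mul, norm_hh, eta]
  have h4 : hh n * ‖chi1 z (rem n p)‖ ≤ 1 * (30 * (n * ‖p‖)) := by
    gcongr
    linarith [hg.h_le]
  linarith

lemma eta_le (hg : Good n d) (hp : ‖p‖ ≤ rad n) : n * eta n p ≤ 1 / 100 := by
  have h1 := hg.sq_le hp
  have h2 := hg.nh_le
  unfold eta
  nlinarith

lemma eta_le' (hg : Good n d) (hp : ‖p‖ ≤ rad n) : eta n p ≤ 1 / 300 := by
  have h1 := eta_le hg hp
  have := hg.n_ge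
  have := eta_nonneg n p
  nlinarith

lemma le_norm_mm (hz : z ∈ strip) (hg : Good n d) (hp : ‖p‖ ≤ rad n) :
    1 ≤ 2 * hh n * ‖mm n z p‖ := by
  have h1 := norm_mm_le hz hg hp
  have h2 := eta_le' hg hp
  have h3 : ‖(1 : ℂ)‖ ≤ ‖(hh n : ℂ) * mm n z p‖ + ‖(hh n : ℂ) * mm n z p - 1‖ := by
    have := norm_sub_le ((hh n : ℂ) * mm n z p) ((hh n : ℂ) * mm n z p - 1)
    simpa using this
  rw [norm_one, norm_mul, norm_hh] at h3
  linarith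

lemma mm_ne_zero (hz : z ∈ strip) (hg : Good n d) (hp : ‖p‖ ≤ rad n) : mm n z p ≠ 0 := by
  intro h
  have := le_norm_mm hz hg hp
  rw [h, norm_zero] at this
  linarith

lemma norm_mm_add_one_le (hz : z ∈ strip) (hg : Good n d) (hp : ‖p‖ ≤ rad n) :
    ‖(hh n : ℂ) * (mm n z p + 1) - 1‖ ≤ eta n p + hh n := by
  have e : (hh n : ℂ) * (mm n z p + 1) - 1 = ((hh n : ℂ) * mm n z p - 1) + hh n := by ring
  rw [e]
  refine (norm_add_le _ _).trans ?_
  rw [norm_hh]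
  linarith [norm_mm_le hz hg hp]

lemma mm_add_one_ne_zero (hz : z ∈ strip) (hg : Good n d) (hp : ‖p‖ ≤ rad n) :
    mm n z p + 1 ≠ 0 := by
  intro h
  have := norm_mm_add_one_le hz hg hp
  rw [h, mul_zero, zero_sub, norm_neg, norm_one] at this
  linarith [eta_le' hg hp, hg.h_le]

lemma norm_inv_one_add_sub_one_le {δ : ℂ} {ε : ℝ} (h : ‖δ‖ ≤ ε) (hε : ε ≤ 1 / 2) :
    ‖(1 + δ)⁻¹ - 1‖ ≤ 2 * ε := by
  have h1 : 1 / 2 ≤ ‖1 + δ‖ := by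
    have := norm_sub_le (1 + δ) δ
    rw [add_sub_cancel_right, norm_one] at this
    linarith
  have hne : 1 + δ ≠ 0 := by
    intro h0; rw [h0, norm_zero] at h1; linarith
  have e : (1 + δ)⁻¹ - 1 = -δ / (1 + δ) := by field_simp; ring
  rw [e, norm_div, norm_neg, div_le_iff₀ (by linarith)]
  nlinarith [norm_nonneg δ]

/-- Since h m ≈ 1, m/(m+1) = 1 - 1/(m+1) ≈ 1 - h ≈ e^(-h). Dividing by e^(-h) leaves an error with a
factor h, which up to d powers enlarge only to order n(`eta` + h). -/
lemma norm_ratio_le (hz : z ∈ strip) (hg : Good n d) (hp : ‖p‖ ≤ rad n) :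
    ‖mm n z p / (mm n z p + 1) * (Real.exp (hh n) : ℂ) - 1‖
      ≤ 4 * (hh n * eta n p) + 5 * hh n ^ 2 := by
  have hne := mm_add_one_ne_zero hz hg hp
  have h0 := hh_pos n
  have hle := hg.h_le
  have hη := eta_le' hg hp
  have hη0 := eta_nonneg n p
  set m := mm n z p with hm
  set δ : ℂ := (hh n : ℂ) * (m + 1) - 1 with hδ
  have h1 : ‖δ‖ ≤ eta n p + hh n := norm_mm_add_one_le hz hg hp
  have h2 := norm_inv_one_add_sub_one_le h1 (by linarith)
  have hhne : (hh n : ℂ) ≠ 0 := by exact_mod_cast h0.ne'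
  have e1 : m / (m + 1) = 1 - hh n - hh n * ((1 + δ)⁻¹ - 1) := by
    have : 1 + δ = (hh n : ℂ) * (m + 1) := by rw [hδ]; ring
    rw [this, mul_inv]
    field_simp
    ring
  have hexp2 : Real.exp (hh n) ≤ 2 := by
    calc _ ≤ Real.exp (1 / 2) := Real.exp_le_exp.2 (by linarith)
      _ ≤ 2 := by
        have := Real.exp_one_lt_d9
        have h : Real.exp (1 / 2) * Real.exp (1 / 2) = Real.exp 1 := by
          rw [← Real.exp_add]; norm_num
        nlinarith [Real.exp_pos (1 / 2)]
  have hb := Real.abs_exp_sub_one_sub_id_le (x := hh n) (by rw [abs_of_pos h0]; linarith)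
  have e2 : m / (m + 1) * (Real.exp (hh n) : ℂ) - 1
      = (((1 - hh n) * Real.exp (hh n) - 1 : ℝ) : ℂ)
        - hh n * ((1 + δ)⁻¹ - 1) * (Real.exp (hh n) : ℂ) := by
    rw [e1]; push_cast; ring
  rw [e2]
  refine (norm_sub_le _ _).trans ?_
  rw [norm_mul, norm_mul, norm_hh, Complex.norm_real, Complex.norm_real,
    Real.norm_of_nonneg (Real.exp_pos _).le, Real.norm_eq_abs]
  have hlow := Real.add_one_le_exp (hh n)
  rw [abs_le] at hb
  have h5 : |(1 - hh n) * Real.exp (hh n) - 1| ≤ hh n ^ 2 := by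
    rw [abs_le]
    constructor <;> nlinarith
  have h6 : hh n * ‖(1 + δ)⁻¹ - 1‖ * Real.exp (hh n)
      ≤ hh n * (2 * (eta n p + hh n)) * 2 := by gcongr
  nlinarith

/-- The relative error of `(m / (m + 1)) ^ j ≈ exp (-j 2 ^ (-n))`. -/
lemma norm_ratio_pow_le (hz : z ∈ strip) (hg : Good n d) (hp : ‖p‖ ≤ rad n) {j : ℕ} (hj : j ≤ d) :
    ‖(mm n z p / (mm n z p + 1) * (Real.exp (hh n) : ℂ)) ^ j - 1‖
      ≤ 8 * (n * eta n p) + 10 * (n * hh n) := by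
  have h0 := hh_pos n
  have hη := eta_nonneg n p
  have hjh : j * hh n ≤ n := (mul_le_mul_of_nonneg_right (by exact_mod_cast hj) h0.le).trans hg.upper'
  have hb : (j : ℝ) * (4 * (hh n * eta n p) + 5 * hh n ^ 2) ≤ 4 * (n * eta n p) + 5 * (n * hh n) := by
    calc _ = (j * hh n) * (4 * eta n p + 5 * hh n) := by ring
      _ ≤ n * (4 * eta n p + 5 * hh n) := by gcongr
      _ = _ := by ring
  have h1 := eta_le hg hp
  have h2 := hg.nh_le
  refine (norm_pow_sub_one_le (norm_ratio_le hz hg hp) (n := j) (by linarith)).trans (by linarith)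

lemma exp_neg_mul_log_two (n : ℕ) : Real.exp (-((n + 1) * Real.log 2)) = hh n / 2 := by
  rw [hh, show -(((n : ℝ) + 1) * Real.log 2) = Real.log 2 * (-((n + 1 : ℕ) : ℝ)) by push_cast; ring,
    ← Real.rpow_def_of_pos (by norm_num), Real.rpow_neg (by norm_num), Real.rpow_natCast, pow_succ,
    one_div, inv_pow, mul_inv, div_eq_mul_inv]

/-- The lower end of the density range enters here: d h falls short of (n+1) log 2 by at most O(n
h), and e^(-(n+1) log 2) = h/2. -/
lemma exp_neg_le (hg : Good n d) : Real.exp (-(d * hh n)) ≤ hh n / 2 * (1 + 4 * (n * hh n)) := by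
  have h0 := hh_pos n
  have h3 := hg.n_ge
  have hl := Real.log_two_lt_d9
  have hl' := Real.log_two_gt_d9
  have hlow := hg.lower
  have e1 : Real.exp (-(d * hh n)) ≤ Real.exp (-((n + 1) * Real.log 2)) *
      Real.exp (2 * (n * hh n)) := by
    rw [← Real.exp_add]
    refine Real.exp_le_exp.2 ?_
    have : (n + 1) * Real.log 2 * hh n ≤ n * hh n := by
      refine mul_le_mul_of_nonneg_right ?_ h0.le
      nlinarith
    nlinarith
  have h2 : |2 * (n * hh n)| ≤ 1 := by
    rw [abs_of_nonneg (by positivity)]; linarith [hg.nh_le]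
  have e3 := Real.abs_exp_sub_one_le h2
  rw [abs_of_nonneg (show 0 ≤ 2 * (n * hh n) by positivity)] at e3
  have e4 : Real.exp (2 * (n * hh n)) ≤ 1 + 4 * (n * hh n) := by
    linarith [le_abs_self (Real.exp (2 * (n * hh n)) - 1)]
  rw [exp_neg_mul_log_two] at e1
  exact e1.trans (mul_le_mul_of_nonneg_left e4 (by linarith))

lemma le_exp_neg (hg : Good n d) : hh n / 2 ≤ Real.exp (-(d * hh n)) := by
  rw [← exp_neg_mul_log_two]
  exact Real.exp_le_exp.2 (neg_le_neg hg.upper)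

lemma ratio_pow_eq (n j : ℕ) (z : ℂ) (p : SpE) :
    (mm n z p / (mm n z p + 1)) ^ j
      = (mm n z p / (mm n z p + 1) * (Real.exp (hh n) : ℂ)) ^ j * (Real.exp (-(j * hh n)) : ℂ) := by
  rw [mul_pow, ← Complex.ofReal_pow, ← Real.exp_nat_mul, mul_assoc, ← Complex.ofReal_mul,
    ← Real.exp_add]
  simp

/-- The relative weight of avoiding all d - 1 forcing clauses is about e^(-dh) ≈ h/2. This is the
source of smallness for the whole recursion. -/
lemma norm_ratio_pow_pred_le (hz : z ∈ strip) (hg : Good n d) (hp : ‖p‖ ≤ rad n) :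
    ‖(mm n z p / (mm n z p + 1)) ^ (d - 1)‖ ≤ 3 * hh n := by
  have h0 := hh_pos n
  have h1 := norm_ratio_pow_le hz hg hp (Nat.sub_le d 1)
  have h2 := eta_le hg hp
  have h3 := hg.nh_le
  rw [ratio_pow_eq, norm_mul, Complex.norm_real, Real.norm_of_nonneg (Real.exp_pos _).le]
  set a := (mm n z p / (mm n z p + 1) * (Real.exp (hh n) : ℂ)) ^ (d - 1)
  have h4 : ‖a‖ ≤ 2 := by
    have := norm_add_le (a - 1) 1
    rw [sub_add_cancel, norm_one] at this
    linarith
  have h5 : Real.exp (-(((d - 1 : ℕ) : ℝ) * hh n)) ≤ 3 / 2 * hh n := by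
    have e : -(((d - 1 : ℕ) : ℝ) * hh n) = -(d * hh n) + hh n := by
      rw [Nat.cast_sub hg.pos]; push_cast; ring
    rw [e, Real.exp_add]
    have h6 : Real.exp (hh n) ≤ 2 := by
      have := Real.abs_exp_sub_one_le (x := hh n) (by rw [abs_of_pos h0]; linarith [hg.h_le])
      rw [abs_of_pos h0] at this
      linarith [le_abs_self (Real.exp (hh n) - 1), hg.h_le]
    calc _ ≤ (hh n / 2 * (1 + 4 * (n * hh n))) * 2 := by
          gcongr
          exact exp_neg_le hg
      _ ≤ _ := by nlinarith
  calc _ ≤ 2 * (3 / 2 * hh n) := by gcongr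
    _ = _ := by ring

/-- The free clause message relative to its mass. -/
def bb (n : ℕ) (z : ℂ) (p : SpE) : SpA := (mm n z p)⁻¹ • freeq n p

lemma freeq_eq (hz : z ∈ strip) (hg : Good n d) (hp : ‖p‖ ≤ rad n) :
    freeq n p = mm n z p • bb n z p := by
  rw [bb, smul_smul, mul_inv_cancel₀ (mm_ne_zero hz hg hp), one_smul]

/-- The nontrivial part of the message has norm O(n‖p‖) while its free mass is about 1/h, so
relative to its mass the message is trivial up to a factor h. -/
lemma norm_bb_le (hz : z ∈ strip) (hg : Good n d) (hp : ‖p‖ ≤ rad n) :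
    ‖bb n z p - 1‖ ≤ 70 * (n * ‖p‖) * hh n := by
  have hne := mm_ne_zero hz hg hp
  have hle := le_norm_mm hz hg hp
  have e : bb n z p - 1 = (mm n z p)⁻¹ • (rem n p - chi1 z (rem n p) • (1 : SpA)) := by
    have e1 : (1 : SpA) = (mm n z p)⁻¹ • (mm n z p • (1 : SpA)) := by
      rw [smul_smul, inv_mul_cancel₀ hne, one_smul]
    conv_lhs => rw [e1]
    rw [bb, ← smul_sub, freeq, mm_eq hz]
    congr 1
    module
  rw [e, norm_smul, norm_inv]
  have h1 := norm_rem_le hg hp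
  have h2 := norm_chi1_rem_le hz hg hp
  have h3 : ‖rem n p - chi1 z (rem n p) • (1 : SpA)‖ ≤ 35 * (n * ‖p‖) := by
    refine (norm_sub_le _ _).trans ?_
    rw [norm_smul, norm_one, mul_one]
    linarith
  have hpos : 0 < ‖mm n z p‖ := norm_pos_iff.2 hne
  rw [inv_mul_le_iff₀ hpos]
  have : 35 * (n * ‖p‖) * 1 ≤ 35 * (n * ‖p‖) * (2 * hh n * ‖mm n z p‖) := by gcongr
  linarith

lemma norm_bb_pow_le (hz : z ∈ strip) (hg : Good n d) (hp : ‖p‖ ≤ rad n) {j : ℕ} (hj : j ≤ d) :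
    ‖bb n z p ^ j - 1‖ ≤ 140 * (n ^ 2 * ‖p‖) := by
  have h0 := hh_pos n
  have hjh : j * hh n ≤ n := (mul_le_mul_of_nonneg_right (by exact_mod_cast hj) h0.le).trans hg.upper'
  have hb : (j : ℝ) * (70 * (n * ‖p‖) * hh n) ≤ 70 * (n ^ 2 * ‖p‖) := by
    calc _ = (j * hh n) * (70 * (n * ‖p‖)) := by ring
      _ ≤ n * (70 * (n * ‖p‖)) := by gcongr
      _ = _ := by ring
  have h1 := hg.sq_le hp
  refine (norm_pow_sub_one_le (norm_bb_le hz hg hp) (n := j) (by linarith)).trans (by linarith)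

lemma kap_eq (hz : z ∈ strip) (hg : Good n d) (hp : ‖p‖ ≤ rad n) (N : ℕ) :
    kap n N z p = (mm n z p + 1) ^ N * (1 - (mm n z p / (mm n z p + 1)) ^ N) := by
  have hne := mm_add_one_ne_zero hz hg hp
  rw [div_pow, mul_sub, mul_one, mul_div_cancel₀ _ (pow_ne_zero N hne), kap, mm]
  ring

lemma one_sub_ratio_ne_zero (hz : z ∈ strip) (hg : Good n d) (hp : ‖p‖ ≤ rad n) :
    1 / 2 ≤ ‖1 - (mm n z p / (mm n z p + 1)) ^ (d - 1)‖ := by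
  have h := norm_ratio_pow_pred_le hz hg hp
  have h1 := norm_add_le (1 - (mm n z p / (mm n z p + 1)) ^ (d - 1))
    ((mm n z p / (mm n z p + 1)) ^ (d - 1))
  rw [sub_add_cancel, norm_one] at h1
  linarith [hg.h_le]

lemma kap_ne_zero (hz : z ∈ strip) (hg : Good n d) (hp : ‖p‖ ≤ rad n) :
    kap n (d - 1) z p ≠ 0 := by
  rw [kap_eq hz hg hp]
  refine mul_ne_zero (pow_ne_zero _ (mm_add_one_ne_zero hz hg hp)) fun h => ?_
  have := one_sub_ratio_ne_zero hz hg hp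
  rw [h, norm_zero] at this
  linarith

/-- With g = m/(m+1), the output is g^(d-1)/(1 - g^(d-1)) times the image of a vector close to 1.
The constant is 2 · 3 · 12: the inverse denominator, the bound on g^(d-1), and 6 times the norm
bound 2 of that vector. -/
lemma norm_TT_le (hz : z ∈ strip) (hg : Good n d) (hp : ‖p‖ ≤ rad n) :
    ‖TT n (d - 1) z p‖ ≤ 72 * hh n := by
  have h0 := hh_pos n
  have hne := mm_add_one_ne_zero hz hg hp
  have h1 := norm_ratio_pow_pred_le hz hg hp
  have h2 := one_sub_ratio_ne_zero hz hg hp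
  have h3 := norm_bb_pow_le hz hg hp (Nat.sub_le d 1)
  have h4 := hg.sq_le hp
  set g := mm n z p / (mm n z p + 1) with hgdef
  have e : TT n (d - 1) z p = ((1 - g ^ (d - 1))⁻¹ * g ^ (d - 1)) • LL z (bb n z p ^ (d - 1)) := by
    rw [TT, LL_qq_pow hz, freeq_eq hz hg hp, smul_pow, map_smul, smul_smul, kap_eq hz hg hp,
      ← hgdef, mul_inv]
    congr 1
    rw [hgdef, div_pow]
    field_simp
  have h5 : ‖bb n z p ^ (d - 1)‖ ≤ 2 := by
    have := norm_add_le (bb n z p ^ (d - 1) - 1) 1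
    rw [sub_add_cancel, norm_one] at this
    linarith
  have h6 : ‖LL z (bb n z p ^ (d - 1))‖ ≤ 12 := by
    have : ‖LL z (bb n z p ^ (d - 1))‖ ≤ 6 * ‖bb n z p ^ (d - 1)‖ :=
      norm_clm_apply_le (pd_L.norm_powLift_le hz) _
    linarith
  rw [e, norm_smul, norm_mul, norm_inv]
  have h7 : ‖1 - g ^ (d - 1)‖⁻¹ ≤ 2 := by
    rw [inv_le_comm₀ (by linarith) (by norm_num)]
    linarith
  calc _ ≤ (2 * (3 * hh n)) * 12 := by gcongr
    _ = _ := by ring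

end

end NaeSat

namespace NaeSat

noncomputable section

set_option linter.unusedSectionVars false

variable {z : ℂ} {n d : ℕ} {p : SpE}

/-! ### The fixed point -/

lemma differentiableAt_full_pow {P : ℂ → SpE} {x : ℂ} (hP : DifferentiableAt ℂ P x) (n : ℕ) :
    DifferentiableAt ℂ (fun y => full (P y) ^ n) x := by
  refine DifferentiableAt.fun_pow ?_ n
  exact (differentiableAt_const _).add (emb.differentiableAt.comp x hP)

lemma differentiableAt_qq {P : ℂ → SpE} {x : ℂ} (hP : DifferentiableAt ℂ P x) (n : ℕ) :
    DifferentiableAt ℂ (fun y => qq n (P y)) x :=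
  flipL.differentiableAt.comp x (differentiableAt_full_pow hP n)

lemma PowData.differentiableAt_comp {I : Type*} {w : Weight I} {F : Type*} [NormedAddCommGroup F]
    [NormedSpace ℂ F] [CompleteSpace F] {s : I → ℝ} {b : I → F} (h : PowData w s b) {Z : ℂ → ℂ}
    {x : ℂ} (hZ : DifferentiableAt ℂ Z x) (hx : Z x ∈ strip) :
    DifferentiableAt ℂ (fun y => powLift w s b (Z y)) x :=
  (h.hasDerivAt hx).differentiableAt.comp x hZ

lemma differentiableAt_chi1_qq {P : ℂ → SpE} {Z : ℂ → ℂ} {x : ℂ} (hP : DifferentiableAt ℂ P x)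
    (hZ : DifferentiableAt ℂ Z x) (hx : Z x ∈ strip) (n : ℕ) :
    DifferentiableAt ℂ (fun y => chi1 (Z y) (qq n (P y))) x :=
  (pd_chi1.differentiableAt_comp hZ hx).clm_apply (differentiableAt_qq hP n)

lemma differentiableAt_TT (hg : Good n d) {P : ℂ → SpE} {Z : ℂ → ℂ} {x : ℂ}
    (hP : DifferentiableAt ℂ P x) (hZ : DifferentiableAt ℂ Z x) (hx : Z x ∈ strip)
    (hPx : ‖P x‖ ≤ rad n) : DifferentiableAt ℂ (fun y => TT n (d - 1) (Z y) (P y)) x := by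
  have h1 := differentiableAt_chi1_qq hP hZ hx n
  have h2 : DifferentiableAt ℂ (fun y => kap n (d - 1) (Z y) (P y)) x :=
    (h1.fun_pow _).sub ((h1.sub_const 1).fun_pow _)
  have h3 : DifferentiableAt ℂ (fun y => LL (Z y) (qq n (P y) ^ (d - 1))) x :=
    (pd_L.differentiableAt_comp hZ hx).clm_apply ((differentiableAt_qq hP n).fun_pow _)
  exact (h2.fun_inv (kap_ne_zero hx hg hPx)).fun_smul h3

lemma Good.n2h (hg : Good n d) : (n : ℝ) ^ 2 * hh n ≤ 1 / 10 ^ 10 := by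
  have h3 := hg.n_ge
  have h0 := hh_pos n
  have h1 : (n : ℝ) ^ 2 ≤ (n : ℝ) ^ 4 := pow_le_pow_right₀ (by linarith) (by norm_num)
  have := hg.small
  have : (n : ℝ) ^ 2 * hh n ≤ (n : ℝ) ^ 4 * hh n := by gcongr
  linarith

lemma Good.seventy_two (hg : Good n d) : 72 * hh n ≤ rad n / 8 := by
  have h3 := hg.n_ge
  have := hg.n2h
  rw [rad, div_div, le_div_iff₀ (by positivity)]
  linarith

/-- Schwarz's lemma along the complex line through p and p': a holomorphic map of a ball of radius
of order n^(-2) into one of radius O(h) has Lipschitz constant O(n²h) well inside. No derivative of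
the recursion is computed. -/
lemma norm_TT_sub_le (hz : z ∈ strip) (hg : Good n d) {p p' : SpE} (hp : ‖p‖ ≤ rad n / 8)
    (hp' : ‖p'‖ ≤ rad n / 8) :
    ‖TT n (d - 1) z p' - TT n (d - 1) z p‖ ≤ 1 / 2 * ‖p' - p‖ := by
  have h0 := hh_pos n
  have hr := rad_pos hg
  rcases eq_or_ne p' p with rfl | hne
  · simp
  have hδ : 0 < ‖p' - p‖ := norm_pos_iff.2 (sub_ne_zero.2 hne)
  have hδ' : ‖p' - p‖ < rad n / 2 := (norm_sub_le _ _).trans_lt (by linarith)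
  set f : ℂ → SpE := fun w => TT n (d - 1) z (p + w • (p' - p)) with hf
  -- For |w| < ρ the point p + w(p' - p) has norm at most rad/8 + rad/2, hence stays in the large
  -- ball, and ρ > 1 so that w = 1 is admissible.
  set ρ : ℝ := rad n / 2 / ‖p' - p‖ with hρ
  have hball : ∀ w ∈ Metric.ball (0 : ℂ) ρ, ‖p + w • (p' - p)‖ ≤ rad n := by
    intro w hw
    rw [mem_ball_zero_iff, hρ, lt_div_iff₀ hδ, ← norm_smul] at hw
    exact (norm_add_le _ _).trans (by linarith)
  have hd : DifferentiableOn ℂ f (Metric.ball 0 ρ) := fun w hw => by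
    refine (differentiableAt_TT (P := fun w => p + w • (p' - p)) (Z := fun _ => z) hg ?_
      (differentiableAt_const z) hz (hball w hw)).differentiableWithinAt
    have h1 : DifferentiableAt ℂ (fun w : ℂ => w • (p' - p)) w :=
      ((ContinuousLinearMap.id ℂ ℂ).smulRight (p' - p)).differentiableAt
    exact h1.const_add p
  have h00 : (0 : ℂ) ∈ Metric.ball (0 : ℂ) ρ := by
    rw [mem_ball_zero_iff, norm_zero]; positivity
  have h10 : (1 : ℂ) ∈ Metric.ball (0 : ℂ) ρ := by
    rw [mem_ball_zero_iff, norm_one, hρ, one_lt_div hδ]; exact hδ'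
  have hm : MapsTo f (Metric.ball 0 ρ) (Metric.closedBall (f 0) (145 * hh n)) := fun w hw => by
    rw [Metric.mem_closedBall, dist_eq_norm]
    have h1 := norm_TT_le hz hg (hball w hw)
    have h2 := norm_TT_le hz hg (hball 0 h00)
    exact (norm_sub_le _ _).trans (by linarith)
  have key := Complex.dist_le_div_mul_dist_of_mapsTo_ball hd hm h10
  have e0 : f 0 = TT n (d - 1) z p := by simp [hf]
  have e1 : f 1 = TT n (d - 1) z p' := by simp [hf]
  rw [e0, e1, dist_eq_norm, dist_zero_right, norm_one, mul_one] at key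
  refine key.trans ?_
  have h3 := hg.n_ge
  have h4 := hg.n2h
  have e2 : 145 * hh n / ρ = (290 * hh n / rad n) * ‖p' - p‖ := by
    rw [hρ]; field_simp; norm_num
  rw [e2]
  refine mul_le_mul_of_nonneg_right ?_ hδ.le
  rw [rad, div_div_eq_mul_div, div_one]
  linarith

/-- The iterates of the recursion, started from zero. -/
def iter (n d : ℕ) (z : ℂ) : ℕ → SpE
  | 0 => 0
  | l + 1 => TT n (d - 1) z (iter n d z l)

lemma norm_iter_le (hz : z ∈ strip) (hg : Good n d) (l : ℕ) : ‖iter n d z l‖ ≤ 72 * hh n := by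
  have h0 := hh_pos n
  have hr := rad_pos hg
  have h1 := hg.seventy_two
  induction l with
  | zero => rw [iter, norm_zero]; linarith
  | succ l ih => exact norm_TT_le hz hg (by linarith)

lemma dist_iter_le (hz : z ∈ strip) (hg : Good n d) (l : ℕ) :
    dist (iter n d z l) (iter n d z (l + 1)) ≤ 144 * hh n / 2 / 2 ^ l := by
  have h1 := hg.seventy_two
  induction l with
  | zero =>
    rw [iter, dist_zero_left]
    have := norm_iter_le hz hg (0 + 1)
    rw [pow_zero, div_one]; linarith
  | succ l ih =>
    have a1 := norm_iter_le hz hg l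
    have a2 := norm_iter_le hz hg (l + 1)
    have := norm_TT_sub_le hz hg (a2.trans h1) (a1.trans h1)
    rw [dist_eq_norm] at ih ⊢
    calc _ ≤ 1 / 2 * ‖iter n d z l - iter n d z (l + 1)‖ := this
      _ ≤ 1 / 2 * (144 * hh n / 2 / 2 ^ l) := by gcongr
      _ = _ := by rw [pow_succ]; ring

/-- The fixed point of the recursion. -/
def fixp (n d : ℕ) (z : ℂ) : SpE := limUnder atTop (iter n d z)

lemma tendsto_iter (hz : z ∈ strip) (hg : Good n d) :
    Tendsto (iter n d z) atTop (𝓝 (fixp n d z)) :=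
  CauchySeq.tendsto_limUnder (cauchySeq_of_le_geometric_two (dist_iter_le hz hg))

lemma dist_iter_fixp_le (hz : z ∈ strip) (hg : Good n d) (l : ℕ) :
    dist (iter n d z l) (fixp n d z) ≤ 144 * hh n / 2 ^ l :=
  dist_le_of_le_geometric_two_of_tendsto (dist_iter_le hz hg) (tendsto_iter hz hg) l

lemma norm_fixp_le (hz : z ∈ strip) (hg : Good n d) : ‖fixp n d z‖ ≤ 72 * hh n :=
  le_of_tendsto (tendsto_iter hz hg).norm (Eventually.of_forall (norm_iter_le hz hg))

lemma norm_fixp_le_rad (hz : z ∈ strip) (hg : Good n d) : ‖fixp n d z‖ ≤ rad n := by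
  have := norm_fixp_le hz hg
  have := hg.seventy_two
  have := rad_pos hg
  linarith

lemma TT_fixp (hz : z ∈ strip) (hg : Good n d) : TT n (d - 1) z (fixp n d z) = fixp n d z := by
  have h1 := hg.seventy_two
  have h2 : Tendsto (fun l => TT n (d - 1) z (iter n d z l)) atTop (𝓝 (TT n (d - 1) z (fixp n d z))) := by
    rw [tendsto_iff_norm_sub_tendsto_zero]
    have h3 := (tendsto_iff_norm_sub_tendsto_zero.1 (tendsto_iter hz hg)).const_mul (1 / 2)
    rw [mul_zero] at h3
    refine squeeze_zero (fun _ => norm_nonneg _) (fun l => ?_) h3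
    exact norm_TT_sub_le hz hg ((norm_fixp_le hz hg).trans h1) ((norm_iter_le hz hg l).trans h1)
  exact tendsto_nhds_unique h2 ((tendsto_add_atTop_iff_nat 1).2 (tendsto_iter hz hg))

lemma symm_iter (hz : z ∈ strip) (l : ℕ) : Symm (iter n d z l) := by
  induction l with
  | zero => exact symm_zero
  | succ l ih => exact ih.TT hz n (d - 1)

lemma symm_fixp (hz : z ∈ strip) (hg : Good n d) : Symm (fixp n d z) := by
  have h := tendsto_iter hz hg
  have h1 := (swapE.continuous.tendsto _).comp h
  refine tendsto_nhds_unique h1 (h.congr fun l => ?_)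
  exact (symm_iter hz l).symm

lemma differentiableOn_iter (hg : Good n d) (l : ℕ) :
    DifferentiableOn ℂ (fun z => iter n d z l) strip := by
  induction l with
  | zero => exact differentiableOn_const _
  | succ l ih =>
    intro z hz
    have h1 := hg.seventy_two
    have hr := rad_pos hg
    refine (differentiableAt_TT hg (ih.differentiableAt (isOpen_strip.mem_nhds hz))
      differentiableAt_id hz ?_).differentiableWithinAt
    have := norm_iter_le hz hg l
    linarith

/-- The iterates are holomorphic in z and converge at a geometric rate that does not depend on z, so
Weierstrass' theorem applies. -/
lemma differentiableOn_fixp (hg : Good n d) : DifferentiableOn ℂ (fixp n d) strip := by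
  have h : TendstoUniformlyOn (fun l z => iter n d z l) (fixp n d) atTop strip := by
    rw [Metric.tendstoUniformlyOn_iff]
    intro ε hε
    have ht : Tendsto (fun l : ℕ => 144 * hh n / (2 : ℝ) ^ l) atTop (𝓝 0) := by
      have := (tendsto_pow_atTop_nhds_zero_of_lt_one (r := (1 / 2 : ℝ)) (by norm_num)
        (by norm_num)).const_mul (144 * hh n)
      rw [mul_zero] at this
      refine this.congr fun l => ?_
      rw [one_div, inv_pow, div_eq_mul_inv]
    filter_upwards [ht.eventually_lt_const hε] with l hl z hz
    rw [dist_comm]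
    exact (dist_iter_fixp_le hz hg l).trans_lt hl
  exact h.tendstoLocallyUniformlyOn.differentiableOn
    (Eventually.of_forall fun l => differentiableOn_iter hg l) isOpen_strip

lemma differentiableAt_fixp (hz : z ∈ strip) (hg : Good n d) : DifferentiableAt ℂ (fixp n d) z :=
  (differentiableOn_fixp hg).differentiableAt (isOpen_strip.mem_nhds hz)

end

end NaeSat

namespace NaeSat

noncomputable section

set_option linter.unusedSectionVars false

variable {z : ℂ} {n d : ℕ} {p : SpE}

/-! ### Estimates for the free energy -/

/-- The clause partition function. -/
def HH (n : ℕ) (z : ℂ) (p : SpE) : ℂ := VV z (full p ^ (n + 1))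

/-- The variable partition function. -/
def DD (n d : ℕ) (z : ℂ) (p : SpE) : ℂ := UU z (qq n p ^ d)

/-- The first order contribution of a single free message to a one-sided clause. -/
def aa (z : ℂ) (p : SpE) : ℂ := VV z (e1 * emb p)

lemma norm_VV_le (hz : z ∈ strip) (b : SpB) : ‖VV z b‖ ≤ 6 * ‖b‖ :=
  norm_clm_apply_le (pd_V.norm_powLift_le hz) b

/-- A clause all of whose inputs are frozen at 1 is violated. -/
lemma VV_e1 (hz : z ∈ strip) : VV z e1 = 0 := by
  rw [e1, VV_delta hz, pt_one_fst, pt_one_snd, ind_false (by norm_num), mul_zero]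

lemma VV_zz (hz : z ∈ strip) : VV z zz = 1 := by
  have := VV_zz_mul hz 1
  rw [mul_one] at this
  rw [this]
  exact mass_delta wB 1

lemma e1_mul_zz : e1 * zz = zz := by
  rw [mul_comm, zz_mul, mass_e1, one_smul]

lemma norm_aa_le (hz : z ∈ strip) (p : SpE) : ‖aa z p‖ ≤ 6 * ‖p‖ := by
  refine (norm_VV_le hz _).trans ?_
  have := norm_mul_le e1 (emb p)
  rw [norm_e1, one_mul] at this
  linarith [norm_emb_le p]

lemma exists_pow_expansion {j : ℕ} (hj : 2 ≤ j) (h : j * ‖p‖ ≤ 1) :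
    ∃ r : SpB, (e1 + emb p) ^ j = e1 + j * (e1 * emb p) + r ∧ ‖r‖ ≤ (j * ‖p‖) ^ 2 := by
  refine ⟨(e1 + emb p) ^ j - e1 - j * (e1 * emb p), by ring, ?_⟩
  obtain ⟨i, rfl⟩ : ∃ i, j = i + 1 := ⟨j - 1, by omega⟩
  have h1 := norm_add_pow_sub_sub_le e1 (emb p) i
  rw [e1_pow (by omega), e1_pow (by omega), norm_e1, one_pow, one_pow, one_mul] at h1
  have h2 : (1 + ‖emb p‖) ^ (i + 1) - 1 - (i + 1) * ‖emb p‖ ≤ ((i + 1 : ℕ) * ‖emb p‖) ^ 2 := by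
    have h3 : ((i + 1 : ℕ) : ℝ) * ‖emb p‖ ≤ 1 := by
      refine le_trans ?_ h
      gcongr
      exact norm_emb_le p
    have := one_add_pow_sub_sub_le (norm_nonneg (emb p)) h3
    push_cast at this ⊢
    linarith
  have h3 : ‖emb p‖ ≤ ‖p‖ := norm_emb_le p
  have h4 : (((i + 1 : ℕ) : ℝ) * ‖emb p‖) ^ 2 ≤ (((i + 1 : ℕ) : ℝ) * ‖p‖) ^ 2 := by gcongr
  refine le_trans (le_of_eq ?_) ((h1.trans h2).trans h4)
  push_cast
  rfl

lemma natCast_mul_eq_smul (j : ℕ) (b : SpB) : (j : SpB) * b = (j : ℂ) • b := by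
  rw [← nsmul_eq_mul, Nat.cast_smul_eq_nsmul]

/-- The constant term belongs to a violated clause and vanishes. The linear coefficient per message
is the same `aa` here and in `VV_e1_mul_pow`; this agreement is behind the cancellation in
`Fc_approx`. -/
lemma VV_pow (hz : z ∈ strip) {j : ℕ} (hj : 2 ≤ j) (h : j * ‖p‖ ≤ 1) :
    ‖VV z ((e1 + emb p) ^ j) - j * aa z p‖ ≤ 6 * (j * ‖p‖) ^ 2 := by
  obtain ⟨r, hr, hn⟩ := exists_pow_expansion (p := p) hj h
  rw [hr, map_add, map_add, VV_e1 hz, natCast_mul_eq_smul, map_smul, smul_eq_mul, ← aa, zero_add,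
    add_sub_cancel_left]
  exact (norm_VV_le hz r).trans (by linarith)

lemma VV_e1_mul_pow (hz : z ∈ strip) {j : ℕ} (hj : 2 ≤ j) (h : j * ‖p‖ ≤ 1) :
    ‖VV z (e1 * (e1 + emb p) ^ j) - j * aa z p‖ ≤ 6 * (j * ‖p‖) ^ 2 := by
  obtain ⟨r, hr, hn⟩ := exists_pow_expansion (p := p) hj h
  have e : e1 * (e1 + emb p) ^ j = e1 + j * (e1 * emb p) + e1 * r := by
    rw [hr]; linear_combination (1 + j * emb p) * e1_mul_self
  rw [e, map_add, map_add, VV_e1 hz, natCast_mul_eq_smul, map_smul, smul_eq_mul, ← aa, zero_add,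
    add_sub_cancel_left]
  have h1 := norm_mul_le e1 r
  rw [norm_e1, one_mul] at h1
  exact (norm_VV_le hz _).trans (by linarith)

/-- By `chi1_flipL` the left side is the weight of a clause with an additional frozen 1. Every term
that also contains a frozen 0 is a multiple of `zz` and contributes its mass; the rest is the
one-sided clause. -/
lemma mm_add_one_eq (hz : z ∈ strip) (n : ℕ) (p : SpE) :
    mm n z p + 1 = (2 + mass wE p) ^ n - (1 + mass wE p) ^ n + VV z (e1 * (e1 + emb p) ^ n) := by
  obtain ⟨y, hy⟩ := sub_dvd_pow_sub_pow (e0 + emb p) (emb p) n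
  rw [add_sub_cancel_right] at hy
  have hm := congrArg (mass wB) hy
  rw [map_sub, mass_pow, mass_pow, map_add, mass_mul, mass_e0, mass_emb, one_mul] at hm
  have e : e1 * full p ^ n = mixed n (mass wE p) • zz + zz * y + e1 * (e1 + emb p) ^ n := by
    have h1 : e1 * (mixed n (mass wE p) • zz) = mixed n (mass wE p) • zz := by
      rw [mul_smul_comm, e1_mul_zz]
    rw [full_pow, mul_sub, mul_add, mul_add, h1, zz]
    linear_combination e1 * hy
  rw [mm, sub_add_cancel, qq, chi1_flipL hz, e, map_add, map_add, VV_zz_mul hz, map_smul,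
    VV_zz hz, ← hm, mixed, smul_eq_mul]
  ring

lemma HH_eq (hz : z ∈ strip) (hp : Symm p) (n : ℕ) :
    HH n z p = mixed (n + 1) (mass wE p) + 2 * VV z ((e1 + emb p) ^ (n + 1))
      - VV z (emb p ^ (n + 1)) := by
  rw [HH, full_pow, map_sub, map_add, map_add, map_smul, VV_zz hz, hp.VV_e0 hz, smul_eq_mul]
  ring

/-- To first order the numerator is 1 + j(t - a) and the denominator 1 + jt/2, so the quotient is 1
+ j(t/2 - a). Everything else is quadratic in jτ. -/
lemma norm_quotient_le {j : ℕ} {t a E : ℂ} {τ : ℝ} (ht : ‖t‖ ≤ τ) (ha : ‖a‖ ≤ 6 * τ)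
    (hE : ‖E‖ ≤ 20 * (j * τ) ^ 2) (h : j * τ ≤ 1 / 100) :
    (1 + t / 2) ^ j ≠ 0 ∧
    ‖(1 + j * (t - a) + E) / (1 + t / 2) ^ j - 1 - j * (t / 2 - a)‖ ≤ 60 * (j * τ) ^ 2 := by
  have hτ : 0 ≤ τ := (norm_nonneg t).trans ht
  have hjτ : 0 ≤ j * τ := by positivity
  have ht2 : ‖t / 2‖ ≤ τ / 2 := by rw [norm_div, Complex.norm_ofNat]; linarith
  have h1 : ‖(1 + t / 2) ^ j - 1‖ ≤ 2 * (j * (τ / 2)) :=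
    norm_pow_sub_one_le (by simpa using ht2) (by linarith)
  have h2 : 1 / 2 ≤ ‖(1 + t / 2) ^ j‖ := by
    have := norm_sub_le ((1 + t / 2) ^ j) ((1 + t / 2) ^ j - 1)
    rw [sub_sub_cancel, norm_one] at this
    linarith
  have hne : (1 + t / 2) ^ j ≠ 0 := by
    intro h0; rw [h0, norm_zero] at h2; linarith
  refine ⟨hne, ?_⟩
  set E' : ℂ := (1 + t / 2) ^ j - 1 - j * (t / 2) with hE'
  have h3 : ‖E'‖ ≤ (j * τ) ^ 2 / 4 := by
    rcases j with _ | i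
    · simp [hE']
    · have h4 := norm_add_pow_sub_sub_le (1 : ℂ) (t / 2) i
      simp only [one_pow, norm_one, one_mul] at h4
      have h5 := one_add_pow_sub_sub_le (x := ‖t / 2‖) (norm_nonneg _) (n := i + 1) (by
        calc ((i + 1 : ℕ) : ℝ) * ‖t / 2‖ ≤ ((i + 1 : ℕ) : ℝ) * (τ / 2) := by gcongr
          _ ≤ 1 := by linarith)
      have h6 : (((i + 1 : ℕ) : ℝ) * ‖t / 2‖) ^ 2 ≤ (((i + 1 : ℕ) : ℝ) * (τ / 2)) ^ 2 := by gcongr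
      push_cast at h5 h6 hE' ⊢
      rw [hE']
      refine h4.trans (h5.trans (h6.trans (le_of_eq ?_)))
      ring
  set β : ℂ := t / 2 - a with hβ
  have hβn : ‖β‖ ≤ 13 / 2 * τ := (norm_sub_le _ _).trans (by linarith)
  have e : (1 + j * (t - a) + E) / (1 + t / 2) ^ j - 1 - j * β
      = (E - j * β * (j * (t / 2)) - (1 + j * β) * E') / (1 + t / 2) ^ j := by
    have : (1 + t / 2) ^ j = 1 + j * (t / 2) + E' := by rw [hE']; ring
    rw [eq_div_iff hne, sub_mul, sub_mul, div_mul_cancel₀ _ hne, this, hβ]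
    ring
  rw [e, norm_div, div_le_iff₀ (by linarith)]
  have h7 : ‖(j : ℂ) * β‖ ≤ 13 / 2 * (j * τ) := by
    rw [norm_mul, Complex.norm_natCast]
    calc _ ≤ (j : ℝ) * (13 / 2 * τ) := by gcongr
      _ = _ := by ring
  have h8 : ‖(j : ℂ) * (t / 2)‖ ≤ j * τ / 2 := by
    rw [norm_mul, Complex.norm_natCast]
    calc _ ≤ (j : ℝ) * (τ / 2) := by gcongr
      _ = _ := by ring
  have h9 : ‖1 + (j : ℂ) * β‖ ≤ 2 := by
    refine (norm_add_le _ _).trans ?_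
    rw [norm_one]; linarith
  have h10 : ‖E - j * β * (j * (t / 2)) - (1 + j * β) * E'‖
      ≤ 20 * (j * τ) ^ 2 + 13 / 2 * (j * τ) * (j * τ / 2) + 2 * ((j * τ) ^ 2 / 4) := by
    refine (norm_sub_le _ _).trans (add_le_add ((norm_sub_le _ _).trans (add_le_add hE ?_)) ?_)
    · rw [norm_mul]; gcongr
    · rw [norm_mul]; gcongr
  nlinarith [sq_nonneg (j * τ)]

/-- The normalized frozen clause mass. -/
def nu1 (n : ℕ) (z : ℂ) (p : SpE) : ℂ := (mm n z p + 1) / ((2 + mass wE p) ^ n * (1 - hh n : ℝ))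

/-- The normalized clause partition function. -/
def nu2 (n : ℕ) (z : ℂ) (p : SpE) : ℂ := HH n z p / ((2 + mass wE p) ^ (n + 1) * (1 - hh n : ℝ))

/-- The normalized variable partition function. -/
def xx (n d : ℕ) (z : ℂ) (p : SpE) : ℂ := DD n d z p / (2 * (mm n z p + 1) ^ d)

/-- The first order deviation of `nu1` and `nu2`. -/
def bet (z : ℂ) (p : SpE) : ℂ := mass wE p / 2 - aa z p

/-- The ratio `h / (1 - h)`. -/
def h' (n : ℕ) : ℝ := hh n / (1 - hh n)

lemma h'_le (hg : Good n d) : h' n ≤ 2 * hh n := by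
  have := hg.h_le
  have h0 := hh_pos n
  rw [h', div_le_iff₀ (by linarith)]
  nlinarith

lemma h'_nonneg (hg : Good n d) : 0 ≤ h' n := by
  have := hg.h_le
  have h0 := hh_pos n
  rw [h']
  exact div_nonneg h0.le (by linarith)

lemma one_sub_hh_ne (hg : Good n d) : ((1 - hh n : ℝ) : ℂ) ≠ 0 := by
  have := hg.h_le
  have : (1 - hh n : ℝ) ≠ 0 := by intro h; linarith
  exact_mod_cast this

lemma nu_aux (hg : Good n d) (y : ℂ) :
    (1 - (hh n : ℂ) * y) / ((1 - hh n : ℝ) : ℂ) - 1 = -((h' n : ℂ) * (y - 1)) := by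
  have h1 := one_sub_hh_ne hg
  rw [h', Complex.ofReal_div]
  field_simp
  push_cast
  ring

lemma two_add_pow (j : ℕ) (t : ℂ) : (2 + t) ^ j = 2 ^ j * (1 + t / 2) ^ j := by
  rw [← mul_pow]; ring_nf

lemma pow_expansion_scalar {j : ℕ} {t : ℂ} {τ : ℝ} (hj : 1 ≤ j) (ht : ‖t‖ ≤ τ)
    (h : j * τ ≤ 1) : ‖(1 + t) ^ j - 1 - j * t‖ ≤ (j * τ) ^ 2 := by
  obtain ⟨i, rfl⟩ : ∃ i, j = i + 1 := ⟨j - 1, by omega⟩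
  have h4 := norm_add_pow_sub_sub_le (1 : ℂ) t i
  simp only [one_pow, norm_one, one_mul] at h4
  have h5 := one_add_pow_sub_sub_le (x := ‖t‖) (norm_nonneg _) (n := i + 1) (by
    calc ((i + 1 : ℕ) : ℝ) * ‖t‖ ≤ ((i + 1 : ℕ) : ℝ) * τ := by gcongr
      _ ≤ 1 := h)
  have h6 : (((i + 1 : ℕ) : ℝ) * ‖t‖) ^ 2 ≤ (((i + 1 : ℕ) : ℝ) * τ) ^ 2 := by gcongr
  push_cast at h5 h6 ⊢
  exact h4.trans (h5.trans h6)

lemma Good.succ_le (hg : Good n d) (hp : ‖p‖ ≤ rad n) : ((n + 1 : ℕ) : ℝ) * ‖p‖ ≤ 1 / 100 := by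
  have h1 := hg.n_le hp
  have h2 := hg.p_le hp
  push_cast
  linarith

/-- In `mm_add_one_eq` the power (2 + t)^n is the main term and the remainder is relatively h y,
with y the quotient of `norm_quotient_le`. Dividing by 1 - h as well leaves a deviation that is
linear in y - 1 with a factor of order h. -/
lemma nu1_approx (hz : z ∈ strip) (hg : Good n d) (hp : ‖p‖ ≤ rad n) :
    ∃ y : ℂ, nu1 n z p = 1 - h' n * (y - 1) ∧ ‖y - 1 - n * bet z p‖ ≤ 60 * (n * ‖p‖) ^ 2 := by
  have hs := hg.n_le hp
  have h3 := hg.three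
  have ht := norm_mass_le wE p
  set t := mass wE p with htdef
  set E : ℂ := ((1 + t) ^ n - 1 - n * t) - (VV z (e1 * (e1 + emb p) ^ n) - n * aa z p) with hE
  have hEn : ‖E‖ ≤ 20 * (n * ‖p‖) ^ 2 := by
    have a1 := pow_expansion_scalar (j := n) (by omega) ht (by linarith)
    have a2 := VV_e1_mul_pow (p := p) hz (j := n) (by omega) (by linarith)
    refine (norm_sub_le _ _).trans ?_
    nlinarith [sq_nonneg (n * ‖p‖)]
  obtain ⟨hne, hq⟩ := norm_quotient_le ht (norm_aa_le hz p) hEn (by linarith)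
  refine ⟨_, ?_, hq⟩
  rw [← neg_neg ((h' n : ℂ) * _), ← nu_aux hg, nu1, mm_add_one_eq hz, ← htdef, two_add_pow]
  have h1 := one_sub_hh_ne hg
  have h2 : (2 : ℂ) ^ n ≠ 0 := pow_ne_zero n two_ne_zero
  have h4 := hh_mul_two_pow n
  have h5 : (hh n : ℂ) = ((2 : ℂ) ^ n)⁻¹ := eq_inv_of_mul_eq_one_left h4
  have e : (1 + t) ^ n - VV z (e1 * (e1 + emb p) ^ n) = 1 + n * (t - aa z p) + E := by
    rw [hE]; ring
  rw [← e, h5]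
  clear_value t
  generalize (1 + t / 2) ^ n = G at hne ⊢
  generalize (2 : ℂ) ^ n = G' at h2 ⊢
  field_simp
  ring

/-- The same expansion with exponent n + 1. The two one-sided contributions agree by symmetry, and
their factor 2 turns 2^(-(n+1)) into h; hence prefactor and slope `bet` coincide with those of
`nu1`. -/
lemma nu2_approx (hz : z ∈ strip) (hg : Good n d) (hsy : Symm p) (hp : ‖p‖ ≤ rad n) :
    ∃ y : ℂ, nu2 n z p = 1 - h' n * (y - 1) ∧
      ‖y - 1 - (n + 1 : ℕ) * bet z p‖ ≤ 60 * ((n + 1 : ℕ) * ‖p‖) ^ 2 := by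
  have hs := hg.succ_le hp
  have h3 := hg.three
  have hn3 := hg.n_ge
  have hp1 := hg.p_le hp
  have ht := norm_mass_le wE p
  set t := mass wE p with htdef
  set E : ℂ := ((1 + t) ^ (n + 1) - 1 - (n + 1 : ℕ) * t)
    - (VV z ((e1 + emb p) ^ (n + 1)) - (n + 1 : ℕ) * aa z p)
    + (VV z (emb p ^ (n + 1)) - t ^ (n + 1)) / 2 with hE
  have hEn : ‖E‖ ≤ 20 * ((n + 1 : ℕ) * ‖p‖) ^ 2 := by
    have a1 := pow_expansion_scalar (j := n + 1) (by omega) ht (by linarith)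
    have a2 := VV_pow (p := p) hz (j := n + 1) (by omega) (by linarith)
    have b : ‖p‖ ^ (n + 1) ≤ ((n + 1 : ℕ) * ‖p‖) ^ 2 := by
      calc ‖p‖ ^ (n + 1) ≤ ‖p‖ ^ 2 :=
            pow_le_pow_of_le_one (norm_nonneg _) (by linarith) (by omega)
        _ ≤ _ := by
            gcongr
            refine le_mul_of_one_le_left (norm_nonneg _) ?_
            push_cast; linarith
    have a3 : ‖VV z (emb p ^ (n + 1))‖ ≤ 6 * ‖p‖ ^ (n + 1) :=
      (norm_VV_le hz _).trans (mul_le_mul_of_nonneg_left norm_emb_pow_le (by norm_num))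
    have a4 : ‖t ^ (n + 1)‖ ≤ ‖p‖ ^ (n + 1) := by
      rw [norm_pow]; exact pow_le_pow_left₀ (norm_nonneg _) ht _
    have a5 : ‖(VV z (emb p ^ (n + 1)) - t ^ (n + 1)) / 2‖ ≤ 7 / 2 * ((n + 1 : ℕ) * ‖p‖) ^ 2 := by
      rw [norm_div, Complex.norm_ofNat]
      have := norm_sub_le (VV z (emb p ^ (n + 1))) (t ^ (n + 1))
      linarith
    refine (norm_add_le _ _).trans ((add_le_add (norm_sub_le _ _) a5).trans ?_)
    nlinarith [sq_nonneg ((n + 1 : ℕ) * ‖p‖)]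
  obtain ⟨hne, hq⟩ := norm_quotient_le ht (norm_aa_le hz p) hEn (by linarith)
  refine ⟨_, ?_, hq⟩
  rw [← neg_neg ((h' n : ℂ) * _), ← nu_aux hg, nu2, HH_eq hz hsy, ← htdef, two_add_pow, mixed]
  have h1 := one_sub_hh_ne hg
  have h2 : (2 : ℂ) ^ n ≠ 0 := pow_ne_zero n two_ne_zero
  have h4 := hh_mul_two_pow n
  have h5 : (hh n : ℂ) = ((2 : ℂ) ^ n)⁻¹ := eq_inv_of_mul_eq_one_left h4
  have e : (1 + t) ^ (n + 1) - VV z ((e1 + emb p) ^ (n + 1))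
      + (VV z (emb p ^ (n + 1)) - t ^ (n + 1)) / 2
      = 1 + (n + 1 : ℕ) * (t - aa z p) + E := by
    rw [hE]; ring
  rw [← e, h5, two_add_pow, pow_succ (2 : ℂ) n]
  clear_value t
  generalize (1 + t / 2) ^ (n + 1) = G at hne ⊢
  generalize (2 : ℂ) ^ n = G' at h2 ⊢
  field_simp
  ring

end

end NaeSat

/-! ### Logarithms of the normalized partition functions and the expansion of the free energy. -/

namespace NaeSat

noncomputable section

set_option linter.unusedSectionVars false

variable {z : ℂ} {n d : ℕ} {p : SpE}

lemma Good.small_p (hg : Good n d) (hp : ‖p‖ ≤ 72 * hh n) : ‖p‖ ≤ rad n := by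
  have := hg.seventy_two
  have := rad_pos hg
  linarith

lemma norm_log_one_add_sub_le {w : ℂ} (h : ‖w‖ ≤ 1 / 2) : ‖Complex.log (1 + w) - w‖ ≤ ‖w‖ ^ 2 := by
  refine (Complex.norm_log_one_add_sub_self_le (by linarith)).trans ?_
  have h1 : (1 - ‖w‖)⁻¹ ≤ 2 := by
    rw [inv_le_comm₀ (by linarith) (by norm_num)]; linarith
  nlinarith [sq_nonneg ‖w‖]

/-- An equation for the logarithm of a normalized clause mass. -/
lemma log_approx_of_approx (hg : Good n d) {y β : ℂ} {c τ : ℝ} (hτ : c * τ ≤ 1 / 100)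
    (hc : 0 ≤ c * τ) (hβ : ‖β‖ ≤ 7 * τ) (hc0 : 0 ≤ c)
    (hy : ‖y - 1 - c * β‖ ≤ 60 * (c * τ) ^ 2) :
    ‖(h' n : ℂ) * (y - 1)‖ ≤ 16 * (hh n * (c * τ)) ∧
    ‖Complex.log (1 - h' n * (y - 1)) + h' n * (c * β)‖ ≤ 150 * (hh n * (c * τ) ^ 2) := by
  have h0 := hh_pos n
  have h1 := h'_le hg
  have h2 := h'_nonneg hg
  have hn : ‖(h' n : ℂ)‖ = h' n := by rw [Complex.norm_real, Real.norm_of_nonneg h2]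
  have hcβ : ‖(c : ℂ) * β‖ ≤ 7 * (c * τ) := by
    rw [norm_mul, Complex.norm_real, Real.norm_of_nonneg hc0]
    calc c * ‖β‖ ≤ c * (7 * τ) := by gcongr
      _ = _ := by ring
  have hy1 : ‖y - 1‖ ≤ 8 * (c * τ) := by
    have := norm_add_le (y - 1 - c * β) (c * β)
    rw [sub_add_cancel] at this
    nlinarith
  have hw : ‖(h' n : ℂ) * (y - 1)‖ ≤ 16 * (hh n * (c * τ)) := by
    rw [norm_mul, hn]
    calc h' n * ‖y - 1‖ ≤ 2 * hh n * (8 * (c * τ)) := by gcongr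
      _ = _ := by ring
  refine ⟨hw, ?_⟩
  have h3 := hg.h_le
  have h4 : ‖-((h' n : ℂ) * (y - 1))‖ ≤ 1 / 2 := by
    rw [norm_neg]
    nlinarith
  have h5 := norm_log_one_add_sub_le h4
  rw [← sub_eq_add_neg, norm_neg] at h5
  have e : Complex.log (1 - h' n * (y - 1)) + h' n * (c * β)
      = (Complex.log (1 - h' n * (y - 1)) - -(h' n * (y - 1))) - h' n * (y - 1 - c * β) := by ring
  rw [e]
  refine (norm_sub_le _ _).trans ?_
  have h6 : ‖(h' n : ℂ) * (y - 1 - c * β)‖ ≤ 2 * hh n * (60 * (c * τ) ^ 2) := by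
    rw [norm_mul, hn]; gcongr
  have h7 : ‖(h' n : ℂ) * (y - 1)‖ ^ 2 ≤ (16 * (hh n * (c * τ))) ^ 2 := by gcongr
  have h8 : (16 * (hh n * (c * τ))) ^ 2 = 256 * hh n * (hh n * (c * τ) ^ 2) := by ring
  have h9 : 0 ≤ hh n * (c * τ) ^ 2 := by positivity
  nlinarith

lemma norm_bet_le (hz : z ∈ strip) (p : SpE) : ‖bet z p‖ ≤ 7 * ‖p‖ := by
  have h1 := norm_aa_le hz p
  have h2 := norm_mass_le wE p
  refine (norm_sub_le _ _).trans ?_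
  rw [norm_div, Complex.norm_ofNat]
  linarith [norm_nonneg p]

lemma nu1_log (hz : z ∈ strip) (hg : Good n d) (hp : ‖p‖ ≤ rad n) :
    ‖nu1 n z p - 1‖ ≤ 1 / 2 ∧
    ‖Complex.log (nu1 n z p) + h' n * (n * bet z p)‖ ≤ 150 * (hh n * (n * ‖p‖) ^ 2) := by
  obtain ⟨y, hy, hn⟩ := nu1_approx hz hg hp
  have hs := hg.n_le hp
  have := log_approx_of_approx hg (c := n) (τ := ‖p‖) (by linarith) (by positivity)
    (norm_bet_le hz p) (by positivity) (by exact_mod_cast hn)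
  rw [hy]
  refine ⟨?_, by exact_mod_cast this.2⟩
  have h3 := hg.h_le
  have h0 := hh_pos n
  rw [sub_sub_cancel_left, norm_neg]
  nlinarith [this.1]

lemma nu2_log (hz : z ∈ strip) (hg : Good n d) (hsy : Symm p) (hp : ‖p‖ ≤ rad n) :
    ‖nu2 n z p - 1‖ ≤ 1 / 2 ∧
    ‖Complex.log (nu2 n z p) + h' n * ((n + 1 : ℕ) * bet z p)‖
      ≤ 150 * (hh n * ((n + 1 : ℕ) * ‖p‖) ^ 2) := by
  obtain ⟨y, hy, hn⟩ := nu2_approx hz hg hsy hp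
  have hs := hg.succ_le hp
  have := log_approx_of_approx hg (c := (n + 1 : ℕ)) (τ := ‖p‖) (by linarith) (by positivity)
    (norm_bet_le hz p) (by positivity) (by exact_mod_cast hn)
  rw [hy]
  refine ⟨?_, by exact_mod_cast this.2⟩
  have h3 := hg.h_le
  have h0 := hh_pos n
  rw [sub_sub_cancel_left, norm_neg]
  nlinarith [this.1]

/-- The variable partition function is a free part plus twice the frozen mass (m+1)^d (1 - g^d),
where g = m/(m+1), and the free part is m^d times `UF` of the normalized message. -/
lemma xx_eq (hz : z ∈ strip) (hg : Good n d) (hsy : Symm p) (hp : ‖p‖ ≤ rad n) :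
    xx n d z p = 1 + 1 / 2 * (mm n z p / (mm n z p + 1)) ^ d * (UF z (bb n z p ^ d) - 2) := by
  have hn : n ≠ 0 := by have := hg.three; omega
  have hne := mm_add_one_ne_zero hz hg hp
  have hne' := pow_ne_zero d hne
  rw [xx, DD, UU_eq hz, UF_qq_pow hz, xi1_qq_pow hz hn, hsy.xi0_qq_pow hz hn, kap_eq hz hg hp,
    freeq_eq hz hg hp, smul_pow, map_smul, smul_eq_mul, div_pow]
  field_simp
  ring

lemma norm_two_cpow_le (hz : z ∈ strip) : ‖(2 : ℂ) ^ z‖ ≤ 3 := by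
  have h : ‖(2 : ℂ) ^ z‖ = (2 : ℝ) ^ z.re := by
    have := Complex.norm_cpow_eq_rpow_re_of_pos (x := 2) (by norm_num) z
    exact_mod_cast this
  rw [h]
  calc (2 : ℝ) ^ z.re ≤ 2 ^ (3 / 2 : ℝ) := by
        apply Real.rpow_le_rpow_of_exponent_le (by norm_num)
        exact hz.2.le
    _ ≤ 3 := by
        rw [show (3 / 2 : ℝ) = 1 + 1 / 2 by norm_num, Real.rpow_add (by norm_num), Real.rpow_one,
          ← Real.sqrt_eq_rpow]
        have : Real.sqrt 2 ≤ 3 / 2 := Real.sqrt_le_iff.2 (by norm_num)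
        linarith

lemma Good.n_sq_ge (hg : Good n d) : (n : ℝ) ≤ n ^ 2 ∧ (1 : ℝ) ≤ (n : ℝ) ^ 2 := by
  have := hg.n_ge
  constructor <;> nlinarith

lemma Good.n2h' (hg : Good n d) : (n : ℝ) ^ 2 * hh n ≤ 1 / 10 ^ 10 := by
  have h3 := hg.n_ge
  have h0 := hh_pos n
  have h1 : (n : ℝ) ^ 2 ≤ (n : ℝ) ^ 4 := pow_le_pow_right₀ (by linarith) (by norm_num)
  have := hg.small
  have : (n : ℝ) ^ 2 * hh n ≤ (n : ℝ) ^ 4 * hh n := by gcongr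
  linarith

lemma norm_ratio_pow_sub_le (hz : z ∈ strip) (hg : Good n d) (hp : ‖p‖ ≤ 72 * hh n) :
    ‖(mm n z p / (mm n z p + 1)) ^ d - (hh n / 2 : ℝ)‖ ≤ 20000 * (n ^ 2 * hh n ^ 2) := by
  have hp' := hg.small_p hp
  have h0 := hh_pos n
  have h3 := hg.n_ge
  have h1 := norm_ratio_pow_le hz hg hp' le_rfl
  obtain ⟨hn1, hn2⟩ := hg.n_sq_ge
  have hR : 8 * (n * eta n p) + 10 * (n * hh n) ≤ 18000 * (n ^ 2 * hh n) := by
    have a1 : (n : ℝ) ^ 2 * ‖p‖ ≤ n ^ 2 * (72 * hh n) := by gcongr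
    have a2 : (n : ℝ) * hh n ≤ n ^ 2 * hh n := by gcongr
    unfold eta
    nlinarith
  rw [ratio_pow_eq]
  set R := (mm n z p / (mm n z p + 1) * (Real.exp (hh n) : ℂ)) ^ d
  have h4 := exp_neg_le hg
  have h5 := le_exp_neg hg
  set E := Real.exp (-(d * hh n))
  have e : R * (E : ℂ) - (hh n / 2 : ℝ) = (R - 1) * (E : ℂ) + ((E - hh n / 2 : ℝ) : ℂ) := by
    push_cast; ring
  rw [e]
  refine (norm_add_le _ _).trans ?_
  rw [norm_mul, Complex.norm_real, Complex.norm_real, Real.norm_of_nonneg (by linarith),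
    Real.norm_of_nonneg (by linarith)]
  have h6 := hg.nh_le
  have hE : E ≤ hh n := by nlinarith
  have h7 : ‖R - 1‖ * E ≤ 18000 * (n ^ 2 * hh n) * hh n := by
    gcongr
    · linarith
  have h8 : E - hh n / 2 ≤ 2 * (n ^ 2 * hh n) * hh n := by
    have a2 : (n : ℝ) * hh n ≤ n ^ 2 * hh n := by gcongr
    nlinarith
  nlinarith [mul_pos h0 h0]

lemma norm_UF_bb_sub_le (hz : z ∈ strip) (hg : Good n d) (hp : ‖p‖ ≤ 72 * hh n) :
    ‖UF z (bb n z p ^ d) - 2 ^ z‖ ≤ 60480 * (n ^ 2 * hh n) := by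
  have hp' := hg.small_p hp
  have h1 := norm_bb_pow_le hz hg hp' le_rfl
  rw [← UF_one hz, ← map_sub]
  have h2 := norm_clm_apply_le (pd_UF.norm_powLift_le hz) (bb n z p ^ d - 1)
  refine h2.trans ?_
  have a1 : (n : ℝ) ^ 2 * ‖p‖ ≤ n ^ 2 * (72 * hh n) := by gcongr
  nlinarith

/-- Here g^d ≈ h/2, and a free variable has weight close to 2^z, because both its values are
allowed. All z-dependence of the free energy at order h comes from this term. -/
lemma xx_approx (hz : z ∈ strip) (hg : Good n d) (hsy : Symm p) (hp : ‖p‖ ≤ 72 * hh n) :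
    ‖xx n d z p - 1 - (hh n / 4 : ℝ) * (2 ^ z - 2)‖ ≤ 80000 * (n ^ 2 * hh n ^ 2) := by
  have hp' := hg.small_p hp
  have h0 := hh_pos n
  have h1 := norm_ratio_pow_sub_le hz hg hp
  have h2 := norm_UF_bb_sub_le hz hg hp
  have h3 := norm_two_cpow_le hz
  have h4 := hg.n2h'
  rw [xx_eq hz hg hsy hp']
  set G := (mm n z p / (mm n z p + 1)) ^ d
  set u := UF z (bb n z p ^ d)
  have e : 1 + 1 / 2 * G * (u - 2) - 1 - (hh n / 4 : ℝ) * ((2 : ℂ) ^ z - 2)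
      = 1 / 2 * (G - (hh n / 2 : ℝ)) * (u - 2) + (hh n / 4 : ℝ) * (u - 2 ^ z) := by
    push_cast; ring
  rw [e]
  refine (norm_add_le _ _).trans ?_
  have hu : ‖u - 2‖ ≤ 6 := by
    have e2 : u - 2 = (u - 2 ^ z) + (2 ^ z - 2) := by ring
    rw [e2]
    have a1 := norm_add_le (u - 2 ^ z) (2 ^ z - 2)
    have a2 := norm_sub_le ((2 : ℂ) ^ z) 2
    rw [Complex.norm_ofNat] at a2
    linarith
  rw [norm_mul, norm_mul, norm_mul, Complex.norm_real, Real.norm_of_nonneg (by positivity)]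
  have h5 : ‖(1 / 2 : ℂ)‖ = 1 / 2 := by norm_num
  rw [h5]
  have h6 : 1 / 2 * ‖G - (hh n / 2 : ℝ)‖ * ‖u - 2‖ ≤ 1 / 2 * (20000 * (n ^ 2 * hh n ^ 2)) * 6 := by
    gcongr
  have h7 : hh n / 4 * ‖u - 2 ^ z‖ ≤ hh n / 4 * (60480 * (n ^ 2 * hh n)) := by gcongr
  have h8 : 0 ≤ (n : ℝ) ^ 2 * hh n ^ 2 := by positivity
  nlinarith

lemma xx_log (hz : z ∈ strip) (hg : Good n d) (hsy : Symm p) (hp : ‖p‖ ≤ 72 * hh n) :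
    ‖xx n d z p - 1‖ ≤ 1 / 2 ∧
    ‖Complex.log (xx n d z p) - (hh n / 4 : ℝ) * (2 ^ z - 2)‖ ≤ 80010 * (n ^ 2 * hh n ^ 2) := by
  have h1 := xx_approx hz hg hsy hp
  have h0 := hh_pos n
  have h3 := norm_two_cpow_le hz
  have h4 := hg.n2h'
  have h5 := hg.h_le
  have hn := hg.n_sq_ge.2
  have hw : ‖xx n d z p - 1‖ ≤ 2 * hh n := by
    have a1 := norm_add_le (xx n d z p - 1 - (hh n / 4 : ℝ) * (2 ^ z - 2))
      ((hh n / 4 : ℝ) * (2 ^ z - 2))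
    rw [sub_add_cancel, norm_mul, Complex.norm_real, Real.norm_of_nonneg (by positivity)] at a1
    have a2 := norm_sub_le ((2 : ℂ) ^ z) 2
    rw [Complex.norm_ofNat] at a2
    have a3 : hh n / 4 * ‖(2 : ℂ) ^ z - 2‖ ≤ hh n / 4 * 5 := by gcongr; linarith
    nlinarith
  refine ⟨by linarith, ?_⟩
  have h6 := norm_log_one_add_sub_le (w := xx n d z p - 1) (by linarith)
  rw [add_sub_cancel] at h6
  have e : Complex.log (xx n d z p) - (hh n / 4 : ℝ) * (2 ^ z - 2)
      = (Complex.log (xx n d z p) - (xx n d z p - 1))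
        + (xx n d z p - 1 - (hh n / 4 : ℝ) * (2 ^ z - 2)) := by ring
  rw [e]
  have h7 : ‖xx n d z p - 1‖ ^ 2 ≤ (2 * hh n) ^ 2 := by gcongr
  have h8 : hh n ^ 2 ≤ n ^ 2 * hh n ^ 2 := le_mul_of_one_le_left (by positivity) hn
  refine (norm_add_le _ _).trans ?_
  nlinarith

/-- The free energy as a function of the free part of the message. -/
def Fc (n d : ℕ) (z : ℂ) (p : SpE) : ℂ :=
  (Real.log 2 + d / (n + 1) * Real.log (1 - hh n) : ℝ) + d * Complex.log (nu1 n z p)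
    - (d * n / (n + 1) : ℝ) * Complex.log (nu2 n z p) + Complex.log (xx n d z p)

/-- The leading part of the free energy. -/
def Fmain (n d : ℕ) (z : ℂ) : ℂ :=
  (Real.log 2 + d / (n + 1) * Real.log (1 - hh n) : ℝ) + (hh n / 4 : ℝ) * (2 ^ z - 2)

/-- The first order terms cancel: d · n β from `nu1` against (dn/(n+1)) · (n+1) β from `nu2`. What
remains is of order d h (n‖p‖)², which is n³h² because d h ≤ n and ‖p‖ = O(h). -/
lemma Fc_approx (hz : z ∈ strip) (hg : Good n d) (hsy : Symm p) (hp : ‖p‖ ≤ 72 * hh n) :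
    ‖Fc n d z p - Fmain n d z‖ ≤ 3 * 10 ^ 6 * (n ^ 3 * hh n ^ 2) := by
  have hp' := hg.small_p hp
  have h0 := hh_pos n
  have hn := hg.n_ge
  have a1 := (nu1_log hz hg hp').2
  have a2 := (nu2_log hz hg hsy hp').2
  have a3 := (xx_log hz hg hsy hp).2
  have hd := hg.upper'
  have e : Fc n d z p - Fmain n d z
      = d * (Complex.log (nu1 n z p) + h' n * (n * bet z p))
        - (d * n / (n + 1) : ℝ) * (Complex.log (nu2 n z p) + h' n * ((n + 1 : ℕ) * bet z p))
        + (Complex.log (xx n d z p) - (hh n / 4 : ℝ) * (2 ^ z - 2)) := by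
    rw [Fc, Fmain]
    have : ((n : ℂ) + 1) ≠ 0 := by exact_mod_cast n.succ_ne_zero
    push_cast
    field_simp
    ring
  rw [e]
  have hnp : (n : ℝ) * ‖p‖ ≤ n * (72 * hh n) := by gcongr
  have hkp : ((n + 1 : ℕ) : ℝ) * ‖p‖ ≤ 96 * (n * hh n) := by
    push_cast
    calc ((n : ℝ) + 1) * ‖p‖ ≤ (4 / 3 * n) * (72 * hh n) := by gcongr; linarith
      _ = _ := by ring
  have b1 : ‖(d : ℂ) * (Complex.log (nu1 n z p) + h' n * (n * bet z p))‖
      ≤ d * (150 * (hh n * (n * (72 * hh n)) ^ 2)) := by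
    rw [norm_mul, Complex.norm_natCast]
    refine mul_le_mul_of_nonneg_left (a1.trans ?_) (by positivity)
    gcongr
  have b2 : ‖((d * n / (n + 1) : ℝ) : ℂ)
        * (Complex.log (nu2 n z p) + h' n * ((n + 1 : ℕ) * bet z p))‖
      ≤ d * (150 * (hh n * (96 * (n * hh n)) ^ 2)) := by
    rw [norm_mul, Complex.norm_real, Real.norm_of_nonneg (by positivity)]
    have : (d * n / (n + 1) : ℝ) ≤ d := by
      rw [div_le_iff₀ (by positivity)]; nlinarith [Nat.cast_nonneg (α := ℝ) d]
    refine mul_le_mul this (a2.trans ?_) (norm_nonneg _) (by positivity)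
    gcongr
  have c1 : d * (150 * (hh n * (n * (72 * hh n)) ^ 2)) ≤ 777600 * (n ^ 3 * hh n ^ 2) := by
    calc _ = (d * hh n) * (777600 * (n ^ 2 * hh n ^ 2)) := by ring
      _ ≤ n * (777600 * (n ^ 2 * hh n ^ 2)) := by gcongr
      _ = _ := by ring
  have c2 : d * (150 * (hh n * (96 * (n * hh n)) ^ 2)) ≤ 1382400 * (n ^ 3 * hh n ^ 2) := by
    calc _ = (d * hh n) * (1382400 * (n ^ 2 * hh n ^ 2)) := by ring
      _ ≤ n * (1382400 * (n ^ 2 * hh n ^ 2)) := by gcongr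
      _ = _ := by ring
  have c3 : 3 * ((n : ℝ) ^ 2 * hh n ^ 2) ≤ n ^ 3 * hh n ^ 2 := by
    calc _ ≤ (n : ℝ) * (n ^ 2 * hh n ^ 2) := by gcongr
      _ = _ := by ring
  refine (norm_add_le _ _).trans ((add_le_add ((norm_sub_le _ _).trans (add_le_add b1 b2))
    a3).trans ?_)
  linarith [show 0 ≤ (n : ℝ) ^ 3 * hh n ^ 2 by positivity]

end

end NaeSat

namespace NaeSat

noncomputable section

set_option linter.unusedSectionVars false

variable {z : ℂ} {n d : ℕ} {p : SpE}

/-! ### The derivative of the free energy -/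

/-- The derivative of `UU`. -/
def UUlog (z : ℂ) : SpA →L[ℂ] ℂ :=
  logLift wA (fun y => (y.1 : ℝ) + y.2) (fun y => ind (0 < (y.1 : ℝ) + y.2)) z

/-- The derivative of `VV`. -/
def VVlog (z : ℂ) : SpB →L[ℂ] ℂ :=
  logLift wB (fun s => 1 - (s.1.1 : ℝ) - s.1.2) (fun s => ind (0 < 1 - (s.1.1 : ℝ) - s.1.2)) z

/-- At a symmetric fixed point the outgoing message of d - 1 clauses is `kap` times `full p`, so the
duality holds against every test element `b`. It is used for the partition functions, for their
variation in the message, and for the logarithmic corrections. -/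
lemma UU_qq_pow_mul_flipL (hz : z ∈ strip) (hn : n ≠ 0) (hsy : Symm p)
    (hk : kap n (d - 1) z p ≠ 0) (hT : TT n (d - 1) z p = p) (b : SpB) :
    UU z (qq n p ^ (d - 1) * flipL b) = kap n (d - 1) z p * VV z (full p * b) := by
  have hL : LL z (qq n p ^ (d - 1)) = kap n (d - 1) z p • p := by
    nth_rewrite 3 [← hT]
    rw [TT, smul_smul, mul_inv_cancel₀ hk, one_smul]
  rw [UU_mul_flipL hz, hL, xi1_qq_pow hz hn, hsy.xi0_qq_pow hz hn, map_smul, smul_mul_assoc,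
    map_smul, full, add_mul, add_mul, map_add, map_add, smul_eq_mul]
  ring

lemma DD_eq_kap_mul (hz : z ∈ strip) (hn : n ≠ 0) (hd : 1 ≤ d) (hsy : Symm p)
    (hk : kap n (d - 1) z p ≠ 0) (hT : TT n (d - 1) z p = p) :
    DD n d z p = kap n (d - 1) z p * HH n z p := by
  obtain ⟨N, rfl⟩ : ∃ N, d = N + 1 := ⟨d - 1, by omega⟩
  rw [DD, pow_succ, HH, pow_succ']
  exact UU_qq_pow_mul_flipL hz hn hsy hk hT (full p ^ n)

lemma hasDerivAt_full_pow {P : ℂ → SpE} {P' : SpE} (hP : HasDerivAt P P' z) (j : ℕ) :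
    HasDerivAt (fun y => full (P y) ^ j) (j * full (P z) ^ (j - 1) * emb P') z := by
  have h1 : HasDerivAt (fun y => full (P y)) (emb P') z := by
    have := (emb.hasFDerivAt (x := P z)).comp_hasDerivAt z hP
    exact this.const_add (e0 + e1)
  exact h1.fun_pow j

lemma hasDerivAt_HH {P : ℂ → SpE} {P' : SpE} (hz : z ∈ strip) (hP : HasDerivAt P P' z) :
    HasDerivAt (fun y => HH n y (P y)) (VVlog z (full (P z) ^ (n + 1))
      + (n + 1) * VV z (full (P z) ^ n * emb P')) z := by
  have h := (pd_V.hasDerivAt hz).clm_apply (hasDerivAt_full_pow hP (n + 1))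
  refine HasDerivAt.congr_deriv h ?_
  rw [show (((n + 1 : ℕ) : SpB) * full (P z) ^ (n + 1 - 1) * emb P')
    = (n + 1 : ℂ) • (full (P z) ^ n * emb P') by
      rw [mul_assoc, natCast_mul_eq_smul, Nat.add_sub_cancel]; push_cast; rfl]
  rw [map_smul, smul_eq_mul]
  rfl

lemma hasDerivAt_DD {P : ℂ → SpE} {P' : SpE} (hz : z ∈ strip) (hn : n ≠ 0)
    (hsy : Symm (P z)) (hk : kap n (d - 1) z (P z) ≠ 0) (hT : TT n (d - 1) z (P z) = P z)
    (hP : HasDerivAt P P' z) :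
    HasDerivAt (fun y => DD n d y (P y)) (UUlog z (qq n (P z) ^ d)
      + d * n * (kap n (d - 1) z (P z) * VV z (full (P z) ^ n * emb P'))) z := by
  have h1 : HasDerivAt (fun y => qq n (P y)) (flipL (n * full (P z) ^ (n - 1) * emb P')) z :=
    (flipL.hasFDerivAt).comp_hasDerivAt z (hasDerivAt_full_pow hP n)
  have h := (pd_U.hasDerivAt hz).clm_apply (h1.fun_pow d)
  refine HasDerivAt.congr_deriv h ?_
  have e : (d : SpA) * qq n (P z) ^ (d - 1) * flipL (n * full (P z) ^ (n - 1) * emb P')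
      = (d * n : ℂ) • (qq n (P z) ^ (d - 1) * flipL (full (P z) ^ (n - 1) * emb P')) := by
    have e1 : (n : SpB) * full (P z) ^ (n - 1) * emb P'
        = (n : ℂ) • (full (P z) ^ (n - 1) * emb P') := by rw [mul_assoc, natCast_mul_eq_smul]
    rw [e1, map_smul, mul_smul_comm, mul_smul, smul_comm (d : ℂ), mul_assoc, ← nsmul_eq_mul,
      Nat.cast_smul_eq_nsmul]
    simp only [Nat.cast_smul_eq_nsmul]
  rw [e, map_smul, smul_eq_mul]
  have e2 := UU_qq_pow_mul_flipL (d := d) hz hn hsy hk hT (full (P z) ^ (n - 1) * emb P')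
  have e3 : full (P z) * (full (P z) ^ (n - 1) * emb P') = full (P z) ^ n * emb P' := by
    rw [← mul_assoc, ← pow_succ', Nat.sub_add_cancel (Nat.one_le_iff_ne_zero.2 hn)]
  rw [e3] at e2
  rw [← e2]
  rfl

lemma ne_zero_of_norm_sub_one_le {w : ℂ} (h : ‖w - 1‖ ≤ 1 / 2) : w ≠ 0 := by
  rintro rfl
  rw [zero_sub, norm_neg, norm_one] at h
  linarith

lemma mem_slitPlane_of_norm_sub_one_le {w : ℂ} (h : ‖w - 1‖ ≤ 1 / 2) : w ∈ Complex.slitPlane := by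
  have := Complex.mem_slitPlane_of_norm_lt_one (z := w - 1) (by linarith)
  rwa [add_sub_cancel] at this

lemma HH_ne_zero (hz : z ∈ strip) (hg : Good n d) (hsy : Symm p) (hp : ‖p‖ ≤ rad n) :
    HH n z p ≠ 0 := fun h =>
  ne_zero_of_norm_sub_one_le (nu2_log hz hg hsy hp).1 (by rw [nu2, h, zero_div])

lemma DD_ne_zero (hz : z ∈ strip) (hg : Good n d) (hsy : Symm p) (hp : ‖p‖ ≤ 72 * hh n) :
    DD n d z p ≠ 0 := fun h =>
  ne_zero_of_norm_sub_one_le (xx_log hz hg hsy hp).1 (by rw [xx, h, zero_div])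

lemma two_add_mass_ne_zero (hg : Good n d) (hp : ‖p‖ ≤ rad n) : 2 + mass wE p ≠ 0 := by
  intro h
  have h1 := norm_mass_le wE p
  have h2 := hg.p_le hp
  rw [eq_neg_of_add_eq_zero_right h, norm_neg, Complex.norm_ofNat] at h1
  linarith

/-- The derivative of the free energy. -/
def Sc (n d : ℕ) (z : ℂ) (p : SpE) : ℂ :=
  UUlog z (qq n p ^ d) / DD n d z p
    - (d * n / (n + 1) : ℝ) * (VVlog z (full p ^ (n + 1)) / HH n z p)

lemma logDeriv_div_const_mul {f g : ℂ → ℂ} {f' g' c : ℂ} (hf : HasDerivAt f f' z)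
    (hg : HasDerivAt g g' z) (hf0 : f z ≠ 0) (hg0 : g z ≠ 0) (hc : c ≠ 0)
    (hs : f z / (g z * c) ∈ Complex.slitPlane) :
    HasDerivAt (fun y => Complex.log (f y / (g y * c))) (f' / f z - g' / g z) z := by
  have h := ((hf.fun_div (hg.mul_const c) (mul_ne_zero hg0 hc))).clog hs
  convert h using 1
  field_simp

/-- At the fixed point the free energy is stationary in the message. -/
theorem hasDerivAt_Fc (hz : z ∈ strip) (hg : Good n d) :
    HasDerivAt (fun y => Fc n d y (fixp n d y)) (Sc n d z (fixp n d z)) z := by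
  have hn : n ≠ 0 := by have := hg.three; omega
  have hp := norm_fixp_le hz hg
  have hp' := norm_fixp_le_rad hz hg
  have hsy := symm_fixp hz hg
  have hT := TT_fixp hz hg
  have hk := kap_ne_zero hz hg hp'
  have hP := (differentiableAt_fixp hz hg).hasDerivAt
  set P' := deriv (fixp n d) z
  have hHH := hasDerivAt_HH (n := n) hz hP
  have hDD := hasDerivAt_DD hz hn hsy hk hT hP
  have hM : DifferentiableAt ℂ (fun y => mm n y (fixp n d y) + 1) z :=
    ((differentiableAt_chi1_qq (differentiableAt_fixp hz hg) differentiableAt_id hz n).sub_const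
      1).add_const 1
  have hM' := hM.hasDerivAt
  set M' := deriv (fun y => mm n y (fixp n d y) + 1) z
  have ht : HasDerivAt (fun y => 2 + mass wE (fixp n d y)) (mass wE P') z :=
    ((mass wE).hasFDerivAt.comp_hasDerivAt z hP).const_add 2
  have hM0 := mm_add_one_ne_zero hz hg hp'
  have hH0 := HH_ne_zero hz hg hsy hp'
  have hD0 := DD_ne_zero hz hg hsy hp
  have ht0 := two_add_mass_ne_zero hg hp'
  have h1 := logDeriv_div_const_mul hM' (ht.fun_pow n) hM0 (pow_ne_zero _ ht0) (one_sub_hh_ne hg)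
    (mem_slitPlane_of_norm_sub_one_le (nu1_log hz hg hp').1)
  have h2 := logDeriv_div_const_mul hHH (ht.fun_pow (n + 1)) hH0 (pow_ne_zero _ ht0)
    (one_sub_hh_ne hg) (mem_slitPlane_of_norm_sub_one_le (nu2_log hz hg hsy hp').1)
  have hx := (xx_log hz hg hsy hp).1
  rw [xx, mul_comm 2] at hx
  have h3 := logDeriv_div_const_mul hDD (hM'.fun_pow d) hD0 (pow_ne_zero _ hM0) two_ne_zero
    (mem_slitPlane_of_norm_sub_one_le hx)
  have h := (((h1.const_mul (d : ℂ)).const_add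
    ((Real.log 2 + d / (n + 1) * Real.log (1 - hh n) : ℝ) : ℂ)).sub
      (h2.const_mul ((d * n / (n + 1) : ℝ) : ℂ))).add h3
  refine (h.congr_deriv ?_).congr_of_eventuallyEq (Eventually.of_forall fun y => ?_)
  -- The variation of the message contributes dn VV/HH through `DD` = `kap` · `HH` and
  -- -(dn/(n+1))(n+1) VV/HH through `HH`, which cancel. So do the derivatives of the normalizers mm
  -- + 1 and 2 + mass.
  · rw [Sc, DD_eq_kap_mul hz hn hg.pos hsy hk hT]
    have hd1 : ∀ (w : ℂ), w ≠ 0 → w ^ (d - 1) / w ^ d = 1 / w := fun w hw => by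
      rw [div_eq_div_iff (pow_ne_zero _ hw) hw, one_mul, ← pow_succ,
        Nat.sub_add_cancel hg.pos]
    have hn1 : ∀ (w : ℂ), w ≠ 0 → w ^ (n - 1) / w ^ n = 1 / w := fun w hw => by
      rw [div_eq_div_iff (pow_ne_zero _ hw) hw, one_mul, ← pow_succ,
        Nat.sub_add_cancel (Nat.one_le_iff_ne_zero.2 hn)]
    have e1 : ∀ w' : ℂ, (d : ℂ) * (mm n z (fixp n d z) + 1) ^ (d - 1) * w'
        / (mm n z (fixp n d z) + 1) ^ d = d * w' / (mm n z (fixp n d z) + 1) := fun w' => by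
      have := hd1 _ hM0
      rw [mul_right_comm, mul_div_assoc, this]; ring
    have e2 : ∀ w' : ℂ, (n : ℂ) * (2 + mass wE (fixp n d z)) ^ (n - 1) * w'
        / (2 + mass wE (fixp n d z)) ^ n = n * w' / (2 + mass wE (fixp n d z)) := fun w' => by
      have := hn1 _ ht0
      rw [mul_right_comm, mul_div_assoc, this]; ring
    rw [e1, e2, Nat.add_sub_cancel]
    have hn' : (n : ℂ) + 1 ≠ 0 := by exact_mod_cast n.succ_ne_zero
    push_cast
    field_simp
    ring
  · simp only [Fc, nu1, nu2, xx, Pi.add_apply, Pi.sub_apply, mul_comm (2 : ℂ) ((mm n y _ + 1) ^ d)]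

end

end NaeSat

namespace NaeSat

noncomputable section

set_option linter.unusedSectionVars false

/-! ### Discrete measures attached to elements with nonnegative coefficients -/

section Meas

variable {I : Type} {w : Weight I} {a b : L1 w}

/-- The coefficients are nonnegative reals. -/
def Pos (a : L1 w) : Prop := ∀ i, ((‖L1.coef i a‖ : ℝ) : ℂ) = L1.coef i a

lemma norm_add_of_eq {x y : ℂ} (hx : ((‖x‖ : ℝ) : ℂ) = x) (hy : ((‖y‖ : ℝ) : ℂ) = y) :
    ‖x + y‖ = ‖x‖ + ‖y‖ := by
  nth_rewrite 1 [← hx, ← hy]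
  rw [← Complex.ofReal_add, Complex.norm_real, Real.norm_of_nonneg (by positivity)]

lemma Pos.zero : Pos (0 : L1 w) := fun i => by rw [L1.coef_zero, norm_zero, Complex.ofReal_zero]

lemma Pos.add (ha : Pos a) (hb : Pos b) : Pos (a + b) := fun i => by
  rw [L1.coef_add, norm_add_of_eq (ha i) (hb i), Complex.ofReal_add, ha i, hb i]

lemma Pos.smul (ha : Pos a) {c : ℂ} (hc : ((‖c‖ : ℝ) : ℂ) = c) : Pos (c • a) := fun i => by
  rw [L1.coef_smul, norm_mul, Complex.ofReal_mul, hc, ha i]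

lemma Pos.delta (i : I) : Pos (L1.delta w i) := fun j => by
  classical
  rw [L1.coef_delta]
  split_ifs <;> simp

lemma Pos.of_tendsto {f : ℕ → L1 w} (h : Tendsto f atTop (𝓝 a)) (hf : ∀ l, Pos (f l)) : Pos a := by
  intro i
  have h1 := (L1.continuous_coef i).tendsto a |>.comp h
  have h2 := (Complex.continuous_ofReal.tendsto _).comp h1.norm
  exact tendsto_nhds_unique (h2.congr fun l => hf l i) h1

/-- Nonnegative reals, described as the complex numbers equal to their own norm, form a closed cone.
-/
lemma eq_norm_of_hasSum {ι : Type*} {f : ι → ℂ} {x : ℂ} (hf : HasSum f x)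
    (h : ∀ i, ((‖f i‖ : ℝ) : ℂ) = f i) : ((‖x‖ : ℝ) : ℂ) = x := by
  have h1 : HasSum (fun i => ((‖f i‖ : ℝ) : ℂ)) x := by simpa only [h] using hf
  have h2 : HasSum (fun i => ‖f i‖) x.re := by simpa using Complex.hasSum_re h1
  have h3 := h1.unique (Complex.hasSum_ofReal.2 h2)
  have h4 : 0 ≤ x.re := h2.nonneg fun i => norm_nonneg _
  rw [h3, Complex.norm_real, Real.norm_of_nonneg h4]

lemma Pos.lift {J : Type} {w' : Weight J} {v : I → L1 w'} {C : ℝ} (h : ∀ i, ‖v i‖ ≤ C * w i)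
    (hv : ∀ i, Pos (v i)) (ha : Pos a) : Pos (L1.lift w v a) := by
  intro j
  have h1 := L1.hasSum_lift h a
  have h2 : HasSum (fun i => L1.coef j (L1.coef i a • v i)) (L1.coef j (L1.lift w v a)) := by
    simp only [L1.coef_eq_lift j]
    exact h1.mapL _
  refine eq_norm_of_hasSum h2 fun i => ?_
  rw [L1.coef_smul, norm_mul, Complex.ofReal_mul, ha i, hv i j]

section Real

variable {v : I → ℝ} {C : ℝ}

lemma Pos.hasSum (ha : Pos a) (h : ∀ i, ‖((v i : ℝ) : ℂ)‖ ≤ C * w i) :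
    HasSum (fun i => ‖L1.coef i a‖ * v i) (L1.lift w (fun i => ((v i : ℝ) : ℂ)) a).re := by
  have h1 := L1.hasSum_lift h a
  have h2 : HasSum (fun i => ((‖L1.coef i a‖ * v i : ℝ) : ℂ))
      (L1.lift w (fun i => ((v i : ℝ) : ℂ)) a) := by
    refine h1.congr_fun fun i => ?_
    rw [Complex.ofReal_mul, ha i, smul_eq_mul]
  simpa using Complex.hasSum_re h2

lemma Pos.lift_eq_re (ha : Pos a) (h : ∀ i, ‖((v i : ℝ) : ℂ)‖ ≤ C * w i) :
    (((L1.lift w (fun i => ((v i : ℝ) : ℂ)) a).re : ℝ) : ℂ)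
      = L1.lift w (fun i => ((v i : ℝ) : ℂ)) a := by
  refine (Complex.hasSum_ofReal.2 (ha.hasSum h)).unique ?_
  refine (L1.hasSum_lift h a).congr_fun fun i => ?_
  rw [Complex.ofReal_mul, ha i, smul_eq_mul]

lemma Pos.re_nonneg (ha : Pos a) (h : ∀ i, ‖((v i : ℝ) : ℂ)‖ ≤ C * w i) (hv : ∀ i, 0 ≤ v i) :
    0 ≤ (L1.lift w (fun i => ((v i : ℝ) : ℂ)) a).re :=
  (ha.hasSum h).nonneg fun i => mul_nonneg (norm_nonneg _) (hv i)

end Real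

variable [MeasurableSpace I]

/-- The measure whose point masses are the norms of the coefficients. -/
def meas (a : L1 w) : Measure I := Measure.sum fun i => ‖L1.coef i a‖ₑ • Measure.dirac i

variable [MeasurableSingletonClass I]

lemma lintegral_meas (a : L1 w) (f : I → ℝ≥0∞) :
    ∫⁻ i, f i ∂meas a = ∑' i, ‖L1.coef i a‖ₑ * f i := by
  rw [meas, lintegral_sum_measure]
  simp only [lintegral_smul_measure, lintegral_dirac, smul_eq_mul]

/-- The dictionary between the two sides: for nonnegative coefficients, integration against `meas a`
is a bounded functional of `a`. Only the functional is continued to complex exponents. -/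
lemma Pos.lintegral {v : I → ℝ} {C : ℝ} (ha : Pos a) (h : ∀ i, ‖((v i : ℝ) : ℂ)‖ ≤ C * w i)
    (hv : ∀ i, 0 ≤ v i) : ∫⁻ i, ENNReal.ofReal (v i) ∂meas a
      = ENNReal.ofReal (L1.lift w (fun i => ((v i : ℝ) : ℂ)) a).re := by
  have h1 := ha.hasSum h
  rw [lintegral_meas, ← h1.tsum_eq,
    ENNReal.ofReal_tsum_of_nonneg (fun i => mul_nonneg (norm_nonneg _) (hv i)) h1.summable]
  refine tsum_congr fun i => ?_
  rw [ENNReal.ofReal_mul (norm_nonneg _), ofReal_norm]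

lemma enorm_lift_meas (a : L1 w) {v : I → ℝ} {C : ℝ} (h : ∀ i, ‖((v i : ℝ) : ℂ)‖ ≤ C * w i) :
    ∫⁻ i, ‖v i‖ₑ ∂meas a < ∞ := by
  have h1 : Summable fun i => ‖L1.coef i a‖ * ‖v i‖ := by
    refine Summable.of_nonneg_of_le (fun i => by positivity) (fun i => ?_)
      ((L1.hasSum_norm a).summable.mul_left C)
    have := h i
    rw [Complex.norm_real] at this
    calc _ ≤ ‖L1.coef i a‖ * (C * w i) := by gcongr
      _ = _ := by ring
  rw [lintegral_meas]
  have e : ∀ i, ‖L1.coef i a‖ₑ * ‖v i‖ₑ = ENNReal.ofReal (‖L1.coef i a‖ * ‖v i‖) := fun i => by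
    rw [ENNReal.ofReal_mul (norm_nonneg _), ofReal_norm, ofReal_norm]
  simp only [e]
  rw [← ENNReal.ofReal_tsum_of_nonneg (fun i => by positivity) h1]
  exact ENNReal.ofReal_lt_top

lemma integrable_meas (a : L1 w) {v : I → ℝ} {C : ℝ} (hm : Measurable v)
    (h : ∀ i, ‖((v i : ℝ) : ℂ)‖ ≤ C * w i) : Integrable v (meas a) :=
  ⟨hm.aestronglyMeasurable, enorm_lift_meas a h⟩

lemma Pos.integral {v : I → ℝ} {C : ℝ} (ha : Pos a) (hm : Measurable v)
    (h : ∀ i, ‖((v i : ℝ) : ℂ)‖ ≤ C * w i) :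
    ∫ i, v i ∂meas a = (L1.lift w (fun i => ((v i : ℝ) : ℂ)) a).re := by
  have h1 := hasSum_integral_measure (integrable_meas a hm h)
  refine h1.unique ?_
  refine (ha.hasSum h).congr_fun fun i => ?_
  rw [integral_smul_measure, integral_dirac, smul_eq_mul, toReal_enorm]

instance (a : L1 w) : IsFiniteMeasure (meas a) := by
  constructor
  have h := enorm_lift_meas a (v := fun _ => 1) (C := 1) fun i => by simpa using w.one_le i
  simpa using h

open scoped Classical in
/-- The indicator function of a set. -/
def chr (s : Set I) (i : I) : ℝ := if i ∈ s then 1 else 0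

lemma chr_nonneg (s : Set I) (i : I) : 0 ≤ chr s i := by unfold chr; split_ifs <;> norm_num

lemma chr_bound (s : Set I) (i : I) : ‖((chr s i : ℝ) : ℂ)‖ ≤ 1 * w i := by
  have := w.one_le i
  unfold chr
  split_ifs
  · simpa using this
  · simpa using w.pos i |>.le

lemma ofReal_chr (s : Set I) (i : I) : ENNReal.ofReal (chr s i) = s.indicator 1 i := by
  classical
  unfold chr
  by_cases h : i ∈ s <;> simp [h]

/-- The functional with values in `[0,∞)` that integrates the indicator of `s`. -/
def evalSet (w : Weight I) (s : Set I) : L1 w →L[ℂ] ℂ := L1.lift w fun i => ((chr s i : ℝ) : ℂ)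

lemma evalSet_delta (s : Set I) (i : I) : evalSet w s (L1.delta w i) = ((chr s i : ℝ) : ℂ) :=
  L1.lift_delta (chr_bound s) i

lemma Pos.evalSet_nonneg (ha : Pos a) (s : Set I) : 0 ≤ (evalSet w s a).re :=
  ha.re_nonneg (chr_bound s) (chr_nonneg s)

lemma Pos.evalSet_eq_re (ha : Pos a) (s : Set I) :
    (((evalSet w s a).re : ℝ) : ℂ) = evalSet w s a := ha.lift_eq_re (chr_bound s)

lemma Pos.meas_apply (ha : Pos a) {s : Set I} (hs : MeasurableSet s) :
    meas a s = ENNReal.ofReal (evalSet w s a).re := by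
  rw [evalSet, ← ha.lintegral (chr_bound s) (chr_nonneg s), ← lintegral_indicator_one hs]
  simp only [ofReal_chr]

lemma Pos.meas_add (ha : Pos a) (hb : Pos b) : meas (a + b) = meas a + meas b := by
  ext s hs
  rw [(ha.add hb).meas_apply hs, Measure.add_apply, ha.meas_apply hs, hb.meas_apply hs, map_add,
    Complex.add_re, ENNReal.ofReal_add (ha.evalSet_nonneg s) (hb.evalSet_nonneg s)]

lemma meas_delta (i : I) : meas (L1.delta w i) = Measure.dirac i := by
  ext s hs
  rw [(Pos.delta i).meas_apply hs, evalSet_delta, Complex.ofReal_re, ofReal_chr,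
    Measure.dirac_apply' _ hs]

lemma meas_smul {c : ℂ} (a : L1 w) : meas (c • a) = ‖c‖ₑ • meas a := by
  ext s hs
  rw [Measure.smul_apply, ← lintegral_indicator_one hs, ← lintegral_indicator_one hs,
    lintegral_meas, lintegral_meas, smul_eq_mul, ← ENNReal.tsum_mul_left]
  refine tsum_congr fun i => ?_
  rw [L1.coef_smul, enorm_mul, mul_assoc]

lemma Pos.meas_lift_delta {J : Type} [MeasurableSpace J] [MeasurableSingletonClass J]
    {w' : Weight J} {g : I → J} {C : ℝ} (hg : Measurable g)
    (h : ∀ i, ‖L1.delta w' (g i)‖ ≤ C * w i) (ha : Pos a) :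
    meas (L1.lift w (fun i => L1.delta w' (g i)) a) = (meas a).map g := by
  have hp : Pos (L1.lift w (fun i => L1.delta w' (g i)) a) := Pos.lift h (fun i => Pos.delta _) ha
  ext s hs
  rw [Measure.map_apply hg hs, hp.meas_apply hs, ha.meas_apply (hg hs)]
  congr 2
  have : evalSet w' s ∘L L1.lift w (fun i => L1.delta w' (g i)) = evalSet w (g ⁻¹' s) :=
    L1.clm_ext fun i => by
      rw [ContinuousLinearMap.comp_apply, L1.lift_delta h, evalSet_delta, evalSet_delta]
      rfl
  exact congrArg (fun f => f a) this

/-! ### Convolution as the law of a product of independent variables. -/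

section Mul

variable [CommMonoid I] [MeasurableMul₂ I] [Submul w]

lemma Pos.one : Pos (1 : L1 w) := by rw [L1.one_def]; exact Pos.delta 1

lemma meas_one : meas (1 : L1 w) = Measure.dirac 1 := by rw [L1.one_def]; exact meas_delta 1

lemma coef_delta_mul_nonneg (i : I) (hb : Pos b) : Pos (L1.delta w i * b) := by
  have h : L1.mulCLM w (L1.delta w i) b = L1.delta w i * b := (L1.mul_def _ _).symm
  have h2 : L1.mulCLM w (L1.delta w i) = L1.lift w fun j => L1.delta w (i * j) := by
    refine L1.clm_ext fun j => ?_
    rw [L1.mulCLM_delta, L1.lift_delta (C := w i)]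
    intro j
    rw [L1.norm_delta]
    exact Submul.map_mul_le i j
  rw [← h, h2]
  refine Pos.lift (C := w i) (fun j => ?_) (fun j => Pos.delta _) hb
  rw [L1.norm_delta]
  exact Submul.map_mul_le i j

lemma Pos.mul (ha : Pos a) (hb : Pos b) : Pos (a * b) := by
  have h1 : L1.lift w (fun i => L1.delta w i * b) = (L1.mulCLM w).flip b := by
    refine L1.clm_ext fun i => ?_
    rw [L1.lift_delta (C := ‖b‖), ContinuousLinearMap.flip_apply, ← L1.mul_def]
    intro i
    refine (norm_mul_le _ _).trans ?_
    rw [L1.norm_delta, mul_comm]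
  have h2 : a * b = L1.lift w (fun i => L1.delta w i * b) a := by
    rw [h1, ContinuousLinearMap.flip_apply, ← L1.mul_def]
  rw [h2]
  refine Pos.lift (C := ‖b‖) (fun i => ?_) (fun i => coef_delta_mul_nonneg i hb) ha
  refine (norm_mul_le _ _).trans ?_
  rw [L1.norm_delta, mul_comm]

lemma Pos.pow (ha : Pos a) (n : ℕ) : Pos (a ^ n) := by
  induction n with
  | zero => rw [pow_zero]; exact Pos.one
  | succ n ih => rw [pow_succ]; exact ih.mul ha

/-- Fubini: the mass of a slice is a functional of `b`, and integrating it against `a` gives a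
bilinear form. It agrees on basis vectors with evaluating the convolution on the set. -/
lemma Pos.meas_mul (ha : Pos a) (hb : Pos b) :
    ((meas a).prod (meas b)).map (fun x => x.1 * x.2) = meas (a * b) := by
  ext s hs
  have hm : Measurable fun x : I × I => x.1 * x.2 := measurable_mul
  rw [Measure.map_apply hm hs, Measure.prod_apply (hm hs), (ha.mul hb).meas_apply hs]
  have h1 : ∀ i, meas b (Prod.mk i ⁻¹' ((fun x : I × I => x.1 * x.2) ⁻¹' s))
      = ENNReal.ofReal (evalSet w ((fun j => i * j) ⁻¹' s) b).re := fun i =>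
    hb.meas_apply (measurable_const_mul i hs)
  simp only [h1]
  have hbd : ∀ i, ‖(((evalSet w ((fun j => i * j) ⁻¹' s) b).re : ℝ) : ℂ)‖ ≤ ‖b‖ * w i := fun i => by
    rw [hb.evalSet_eq_re]
    have h2 := L1.norm_lift_apply_le (chr_bound (w := w) ((fun j => i * j) ⁻¹' s)) b
    have := w.one_le i
    refine h2.trans ?_
    nlinarith [norm_nonneg b]
  rw [ha.lintegral hbd fun i => hb.evalSet_nonneg _]
  congr 2
  have h3 : L1.lift w (fun i => (((evalSet w ((fun j => i * j) ⁻¹' s) b).re : ℝ) : ℂ))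
      = evalSet w s ∘L ((L1.mulCLM w).flip b) := by
    refine L1.clm_ext fun i => ?_
    rw [L1.lift_delta hbd, hb.evalSet_eq_re, ContinuousLinearMap.comp_apply,
      ContinuousLinearMap.flip_apply]
    have : evalSet w ((fun j => i * j) ⁻¹' s) = evalSet w s ∘L L1.mulCLM w (L1.delta w i) := by
      refine L1.clm_ext fun j => ?_
      rw [ContinuousLinearMap.comp_apply, L1.mulCLM_delta, evalSet_delta, evalSet_delta]
      rfl
    rw [this, ContinuousLinearMap.comp_apply]
  rw [h3, ContinuousLinearMap.comp_apply, ContinuousLinearMap.flip_apply, ← L1.mul_def]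

lemma measurable_fin_prod (n : ℕ) : Measurable fun x : Fin n → I => ∏ i, x i := by
  fun_prop

/-- An arbitrary coordinate is singled out: the first one in the induction for powers, every one of
them in turn in `lintegral_dot`. -/
lemma map_insertNth (a : L1 w) (n : ℕ) (i : Fin (n + 1)) {β : Type} [MeasurableSpace β]
    {f : I × (Fin n → I) → β} (hf : Measurable f) :
    (Measure.pi fun _ : Fin (n + 1) => meas a).map (fun x => f (x i, fun j => x (i.succAbove j)))
      = ((meas a).prod (Measure.pi fun _ : Fin n => meas a)).map f := by
  have h := measurePreserving_piFinSuccAbove (fun _ : Fin (n + 1) => meas a) i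
  rw [← h.map_eq, Measure.map_map hf h.measurable]
  rfl

lemma Pos.map_prod_pi (ha : Pos a) (n : ℕ) :
    (Measure.pi fun _ : Fin n => meas a).map (fun x => ∏ i, x i) = meas (a ^ n) := by
  induction n with
  | zero =>
    rw [pow_zero, meas_one, Measure.pi_of_empty (fun _ : Fin 0 => meas a) default,
      Measure.map_dirac' (measurable_fin_prod 0)]
    simp
  | succ n ih =>
    have hf : Measurable fun x : I × (Fin n → I) => x.1 * ∏ j, x.2 j :=
      measurable_fst.mul ((measurable_fin_prod n).comp measurable_snd)
    have h := map_insertNth a n 0 hf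
    simp only [← Fin.prod_univ_succAbove] at h
    have h2 : ((meas a).prod (Measure.pi fun _ : Fin n => meas a)).map
        (fun x => x.1 * ∏ j, x.2 j)
        = (((meas a).map id).prod ((Measure.pi fun _ : Fin n => meas a).map
          fun x => ∏ j, x j)).map (fun x => x.1 * x.2) := by
      rw [Measure.map_prod_map _ _ measurable_id (measurable_fin_prod n),
        Measure.map_map measurable_mul (measurable_id.prodMap (measurable_fin_prod n))]
      rfl
    rw [h, h2, ih, Measure.map_id, ha.meas_mul (ha.pow n), pow_succ']

end Mul

end Meas

end

end NaeSat

namespace NaeSat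

noncomputable section

set_option linter.unusedSectionVars false

/-! ### Reweighted measures -/

section Reweight

variable {Ω Ω' : Type} [MeasurableSpace Ω] [MeasurableSpace Ω'] {lam : ℝ}

@[fun_prop]
lemma measurable_tpow (lam : ℝ) : Measurable fun x => tpow x lam :=
  Measurable.ite (measurableSet_singleton 0) measurable_const (measurable_id.pow_const lam)

lemma tpow_nonneg {x : ℝ} (hx : 0 ≤ x) : 0 ≤ tpow x lam := by
  unfold tpow; split_ifs <;> positivity

lemma tpow_zero : tpow 0 lam = 0 := if_pos rfl

/-- The convention 0^0 = 0 keeps the power multiplicative on [0,∞): for exponent zero it is the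
indicator of x ≠ 0. -/
lemma tpow_mul {x y : ℝ} (hx : 0 ≤ x) (hy : 0 ≤ y) : tpow (x * y) lam = tpow x lam * tpow y lam := by
  rcases eq_or_ne x 0 with rfl | hx'
  · rw [zero_mul, tpow_zero, zero_mul]
  rcases eq_or_ne y 0 with rfl | hy'
  · rw [mul_zero, tpow_zero, mul_zero]
  rw [tpow, tpow, tpow, if_neg (mul_ne_zero hx' hy'), if_neg hx', if_neg hy', Real.mul_rpow hx hy]

lemma tpow_prod {ι : Type*} (s : Finset ι) {x : ι → ℝ} (hs : s.Nonempty) (hx : ∀ i, 0 ≤ x i) :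
    tpow (∏ i ∈ s, x i) lam = ∏ i ∈ s, tpow (x i) lam := by
  induction hs using Finset.Nonempty.cons_induction with
  | singleton a => simp
  | cons a s ha hs ih =>
    rw [Finset.prod_cons, Finset.prod_cons, tpow_mul (hx a) (Finset.prod_nonneg fun i _ => hx i), ih]

lemma partFn_map {P : Measure Ω} {T : Ω → Ω'} (hT : Measurable T) {W : Ω' → ℝ}
    (hW : Measurable W) : partFn lam (P.map T) W = partFn lam P fun x => W (T x) := by
  rw [partFn, lintegral_map (by fun_prop) hT]
  rfl

lemma partFn_smul (c : ℝ≥0∞) (P : Measure Ω) (W : Ω → ℝ) :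
    partFn lam (c • P) W = c * partFn lam P W := by
  rw [partFn, lintegral_smul_measure]; rfl

lemma partFn_withDensity {P : Measure Ω} {f : Ω → ℝ≥0∞} (hf : Measurable f) {W W' : Ω → ℝ}
    (hW : Measurable W)
    (h : ∀ x, f x * ENNReal.ofReal (tpow (W x) lam) = ENNReal.ofReal (tpow (W' x) lam)) :
    partFn lam (P.withDensity f) W = partFn lam P W' := by
  rw [partFn, lintegral_withDensity_eq_lintegral_mul _ hf (by fun_prop)]
  exact lintegral_congr h

lemma map_withDensity {P : Measure Ω} {T : Ω → Ω'} (hT : Measurable T) {f : Ω' → ℝ≥0∞}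
    (hf : Measurable f) : (P.map T).withDensity f = (P.withDensity fun x => f (T x)).map T := by
  ext s hs
  rw [withDensity_apply _ hs, Measure.map_apply hT hs, withDensity_apply _ (hT hs),
    setLIntegral_map hs hf hT]

lemma reweight_map {P : Measure Ω} {T : Ω → Ω'} (hT : Measurable T) {W G : Ω' → ℝ}
    (hW : Measurable W) (hG : Measurable G) :
    reweight lam (P.map T) W G = reweight lam P (fun x => W (T x)) fun x => G (T x) := by
  rw [reweight, reweight, partFn_map hT hW, map_withDensity hT (by fun_prop),
    Measure.map_map hG hT]
  rfl

lemma reweight_smul {c : ℝ≥0∞} (h0 : c ≠ 0) (h1 : c ≠ ∞) (P : Measure Ω) (W G : Ω → ℝ) :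
    reweight lam (c • P) W G = reweight lam P W G := by
  rw [reweight, reweight, partFn_smul, withDensity_smul_measure, Measure.map_smul, smul_smul,
    ENNReal.mul_inv (Or.inl h0) (Or.inl h1), mul_assoc, mul_comm _ c, ← mul_assoc,
    ENNReal.inv_mul_cancel h0 h1, one_mul]

lemma reweight_withDensity {P : Measure Ω} {f : Ω → ℝ≥0∞} (hf : Measurable f) {W W' G : Ω → ℝ}
    (hW : Measurable W)
    (h : ∀ x, f x * ENNReal.ofReal (tpow (W x) lam) = ENNReal.ofReal (tpow (W' x) lam)) :
    reweight lam (P.withDensity f) W G = reweight lam P W' G := by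
  have e : (f * fun x => ENNReal.ofReal (tpow (W x) lam))
      = fun x => ENNReal.ofReal (tpow (W' x) lam) := funext h
  rw [reweight, reweight, partFn_withDensity hf hW h, ← withDensity_mul _ hf (by fun_prop), e]

lemma isProbabilityMeasure_reweight {P : Measure Ω} {W G : Ω → ℝ} (hG : Measurable G)
    (h0 : partFn lam P W ≠ 0) (h1 : partFn lam P W ≠ ∞) :
    IsProbabilityMeasure (reweight lam P W G) := by
  constructor
  rw [reweight, Measure.smul_apply, Measure.map_apply hG MeasurableSet.univ, preimage_univ,
    withDensity_apply _ MeasurableSet.univ, setLIntegral_univ, smul_eq_mul]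
  exact ENNReal.inv_mul_cancel h0 h1

lemma lintegral_pi_prod (m : Measure Ω) [SigmaFinite m] (n : ℕ) {g : Fin n → Ω → ℝ≥0∞}
    (hg : ∀ i, Measurable (g i)) :
    ∫⁻ x, ∏ i, g i (x i) ∂(Measure.pi fun _ : Fin n => m) = ∏ i, ∫⁻ x, g i x ∂m := by
  induction n with
  | zero => simp [Measure.pi_of_empty (fun _ : Fin 0 => m) default]
  | succ n ih =>
    have h := measurePreserving_piFinSuccAbove (fun _ : Fin (n + 1) => m) 0
    have hm : Measurable fun x : Ω × (Fin n → Ω) => g 0 x.1 * ∏ i : Fin n, g i.succ (x.2 i) := by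
      refine ((hg 0).comp measurable_fst).mul ?_
      exact Finset.measurable_fun_prod _ fun i _ =>
        (hg _).comp ((measurable_pi_apply i).comp measurable_snd)
    have h2 := h.lintegral_comp hm
    rw [Fin.prod_univ_succ, ← ih fun i => hg i.succ]
    have h3 : ∫⁻ x, ∏ i, g i (x i) ∂(Measure.pi fun _ : Fin (n + 1) => m)
        = ∫⁻ x : Ω × (Fin n → Ω), g 0 x.1 * ∏ i : Fin n, g i.succ (x.2 i)
          ∂(m.prod (Measure.pi fun _ : Fin n => m)) := by
      rw [← h2]
      refine lintegral_congr fun x => ?_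
      rw [Fin.prod_univ_succ]
      rfl
    rw [h3]
    exact lintegral_prod_mul (hg 0).aemeasurable (Finset.measurable_fun_prod _ fun i _ =>
        (hg _).comp (measurable_pi_apply i)).aemeasurable

/-- It suffices to compare on rectangles, whose indicator is a product of indicators. -/
lemma pi_withDensity (m : Measure Ω) [SigmaFinite m] {f : Ω → ℝ≥0∞} (hf : Measurable f)
    [SigmaFinite (m.withDensity f)] (n : ℕ) : Measure.pi (fun _ : Fin n => m.withDensity f)
      = (Measure.pi fun _ : Fin n => m).withDensity fun x => ∏ i, f (x i) := by
  refine Measure.pi_eq fun s hs => ?_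
  rw [withDensity_apply _ (MeasurableSet.univ_pi hs), ← lintegral_indicator (MeasurableSet.univ_pi hs)]
  have e : ∀ x : Fin n → Ω, (univ.pi s).indicator (fun x => ∏ i, f (x i)) x
      = ∏ i, (s i).indicator f (x i) := fun x => by
    by_cases h : x ∈ univ.pi s
    · rw [indicator_of_mem h]
      exact Finset.prod_congr rfl fun i _ => (indicator_of_mem (h i trivial) f).symm
    · rw [indicator_of_notMem h]
      simp only [Set.mem_pi, mem_univ, true_implies, not_forall] at h
      obtain ⟨i, hi⟩ := h
      exact (Finset.prod_eq_zero (Finset.mem_univ i) (indicator_of_notMem hi f)).symm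
  simp only [e]
  rw [lintegral_pi_prod m n fun i => hf.indicator (hs i)]
  refine Finset.prod_congr rfl fun i _ => ?_
  rw [withDensity_apply _ (hs i), lintegral_indicator (hs i)]

lemma iid_smul (n : ℕ) (c : ℝ≥0∞) (m : Measure ℝ) [IsFiniteMeasure m] (hc : c ≠ ∞) :
    iid n (c • m) = c ^ n • iid n m := by
  have : IsFiniteMeasure (c • m) := Measure.smul_finite m hc
  refine Measure.pi_eq fun s hs => ?_
  rw [Measure.smul_apply, iid, Measure.pi_pi]
  simp [Finset.prod_mul_distrib]

lemma iid_map (n : ℕ) (m : Measure Ω) [IsFiniteMeasure m] {T : Ω → ℝ} (hT : Measurable T) :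
    iid n (m.map T) = (Measure.pi fun _ : Fin n => m).map fun x i => T (x i) := by
  exact (Measure.pi_map_pi fun _ => hT.aemeasurable).symm

@[fun_prop]
lemma measurable_agree (n : ℕ) : Measurable (agree : (Fin n → ℝ) → ℝ) := by
  unfold agree; fun_prop

end Reweight

/-! ### Normalization of pairs -/

/-- The sum of the two entries of a pair. -/
def sumf (y : Pair) : ℝ := y.1 + y.2

/-- The normalized first entry of a pair. -/
def ratf (y : Pair) : ℝ := y.1 / (y.1 + y.2)

@[fun_prop]
lemma measurable_sumf : Measurable sumf := by unfold sumf; fun_prop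

@[fun_prop]
lemma measurable_ratf : Measurable ratf := by unfold ratf; fun_prop

lemma sumf_nonneg (y : Pair) : 0 ≤ sumf y := add_nonneg y.1.2.1 y.2.2.1

lemma coe_prod_fst {ι : Type*} (s : Finset ι) (y : ι → Pair) :
    ((∏ i ∈ s, y i).1 : ℝ) = ∏ i ∈ s, ((y i).1 : ℝ) := by
  classical
  induction s using Finset.induction_on with
  | empty => simp
  | insert a s ha ih => rw [Finset.prod_insert ha, Finset.prod_insert ha, pair_mul_fst, ih]

lemma coe_prod_snd {ι : Type*} (s : Finset ι) (y : ι → Pair) :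
    ((∏ i ∈ s, y i).2 : ℝ) = ∏ i ∈ s, ((y i).2 : ℝ) := by
  classical
  induction s using Finset.induction_on with
  | empty => simp
  | insert a s ha ih => rw [Finset.prod_insert ha, Finset.prod_insert ha, pair_mul_snd, ih]

lemma sumf_prod {n : ℕ} (y : Fin n → Pair) :
    sumf (∏ i, y i) = ∏ i, ((y i).1 : ℝ) + ∏ i, ((y i).2 : ℝ) := by
  rw [sumf, coe_prod_fst, coe_prod_snd]

lemma one_sub_ratf {y : Pair} (h : sumf y ≠ 0) : 1 - ratf y = y.2 / sumf y := by
  have h' : (y.1 : ℝ) + y.2 ≠ 0 := h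
  rw [ratf, sumf]; field_simp; ring

lemma fst_eq_zero_of_sumf {y : Pair} (h : sumf y = 0) : (y.1 : ℝ) = 0 := by
  have h1 := y.1.2.1
  have h2 := y.2.2.1
  unfold sumf at h
  linarith

lemma snd_eq_zero_of_sumf {y : Pair} (h : sumf y = 0) : (y.2 : ℝ) = 0 := by
  have h1 := y.1.2.1
  have h2 := y.2.2.1
  unfold sumf at h
  linarith

lemma agree_ratf {n : ℕ} {y : Fin n → Pair} (h : ∀ i, sumf (y i) ≠ 0) :
    agree (fun i => ratf (y i)) = sumf (∏ i, y i) / ∏ i, sumf (y i) := by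
  rw [agree, sumf_prod, add_div, ← Finset.prod_div_distrib, ← Finset.prod_div_distrib]
  congr 1
  exact Finset.prod_congr rfl fun i _ => one_sub_ratf (h i)

lemma sumf_prod_eq_zero {n : ℕ} {y : Fin n → Pair} {i : Fin n} (h : sumf (y i) = 0) :
    sumf (∏ i, y i) = 0 := by
  rw [sumf_prod, Finset.prod_eq_zero (Finset.mem_univ i) (fst_eq_zero_of_sumf h),
    Finset.prod_eq_zero (Finset.mem_univ i) (snd_eq_zero_of_sumf h), add_zero]

/-- The density of a pair with respect to its normalization. -/
def dens (lam : ℝ) (y : Pair) : ℝ≥0∞ := ENNReal.ofReal (tpow (sumf y) lam)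

@[fun_prop]
lemma measurable_dens (lam : ℝ) : Measurable (dens lam) := by unfold dens; fun_prop

/-- Tilting each pair by its sum and then the tuple by `agree` of the normalized messages is the
same as tilting once by the sum of the product pair. This is what allows normalization to be
postponed. If some pair is (0, 0), both sides vanish thanks to 0^0 = 0. -/
lemma prod_dens_mul {n : ℕ} (hn : n ≠ 0) (lam : ℝ) (y : Fin n → Pair) :
    (∏ i, dens lam (y i)) * ENNReal.ofReal (tpow (agree fun i => ratf (y i)) lam)
      = ENNReal.ofReal (tpow (sumf (∏ i, y i)) lam) := by
  by_cases h : ∀ i, sumf (y i) ≠ 0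
  · have : Nonempty (Fin n) := ⟨⟨0, Nat.pos_of_ne_zero hn⟩⟩
    have h1 : 0 ≤ ∏ i, sumf (y i) := Finset.prod_nonneg fun i _ => sumf_nonneg _
    have h2 : ∏ i, sumf (y i) ≠ 0 := Finset.prod_ne_zero_iff.2 fun i _ => h i
    unfold dens
    rw [← ENNReal.ofReal_prod_of_nonneg fun i _ => tpow_nonneg (sumf_nonneg _),
      ← tpow_prod _ Finset.univ_nonempty fun i => sumf_nonneg _,
      ← ENNReal.ofReal_mul (tpow_nonneg h1), agree_ratf h,
      ← tpow_mul h1 (div_nonneg (sumf_nonneg _) h1), mul_div_cancel₀ _ h2]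
  · push Not at h
    obtain ⟨i, hi⟩ := h
    rw [sumf_prod_eq_zero hi, tpow_zero, ENNReal.ofReal_zero,
      Finset.prod_eq_zero (Finset.mem_univ i), zero_mul]
    rw [dens, hi, tpow_zero, ENNReal.ofReal_zero]

lemma prod_ratf_div_agree {n : ℕ} (y : Fin n → Pair) :
    (∏ i, ratf (y i)) / agree (fun i => ratf (y i)) = ratf (∏ i, y i) := by
  by_cases h : ∀ i, sumf (y i) ≠ 0
  · have h2 : ∏ i, sumf (y i) ≠ 0 := Finset.prod_ne_zero_iff.2 fun i _ => h i
    rw [agree_ratf h]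
    have e : ∏ i, ratf (y i) = (∏ i, ((y i).1 : ℝ)) / ∏ i, sumf (y i) := by
      rw [← Finset.prod_div_distrib]; rfl
    rw [e, div_div_div_cancel_right₀ h2, ratf, ← sumf, coe_prod_fst]
  · push Not at h
    obtain ⟨i, hi⟩ := h
    have h1 := fst_eq_zero_of_sumf hi
    rw [Finset.prod_eq_zero (Finset.mem_univ i) (by rw [ratf, h1, zero_div]), zero_div, ratf,
      coe_prod_fst, Finset.prod_eq_zero (Finset.mem_univ i) h1, zero_div]

/-! ### The variable recursion on unnormalized pairs. -/

section Recursion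

variable {lam : ℝ} {m : Measure Pair} [IsFiniteMeasure m]

lemma iid_reweight (n : ℕ) (h0 : partFn lam m sumf ≠ 0) (h1 : partFn lam m sumf ≠ ∞) :
    iid n (reweight lam m sumf ratf) = ((partFn lam m sumf)⁻¹) ^ n •
      ((Measure.pi fun _ : Fin n => m).withDensity fun y => ∏ i, dens lam (y i)).map
        fun y i => ratf (y i) := by
  have hf : IsFiniteMeasure (m.withDensity (dens lam)) := by
    refine isFiniteMeasure_withDensity ?_
    exact h1
  rw [← pi_withDensity m (measurable_dens lam), ← iid_map n _ measurable_ratf]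
  have hf' : IsFiniteMeasure ((m.withDensity (dens lam)).map ratf) := inferInstance
  exact @iid_smul n _ _ hf' (ENNReal.inv_ne_top.2 h0)

lemma measurable_prod_dens (n : ℕ) (lam : ℝ) :
    Measurable fun y : Fin n → Pair => ∏ i, dens lam (y i) := by fun_prop

lemma measurable_ratf_pi (n : ℕ) : Measurable fun (y : Fin n → Pair) i => ratf (y i) := by
  fun_prop

lemma partFn_iid_reweight {n : ℕ} (hn : n ≠ 0) (h0 : partFn lam m sumf ≠ 0)
    (h1 : partFn lam m sumf ≠ ∞) :
    partFn lam (iid n (reweight lam m sumf ratf)) agree = ((partFn lam m sumf)⁻¹) ^ n *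
      partFn lam ((Measure.pi fun _ : Fin n => m).map fun y => ∏ i, y i) sumf := by
  rw [iid_reweight n h0 h1, partFn_smul, partFn_map (measurable_ratf_pi n) (measurable_agree n),
    partFn_withDensity (measurable_prod_dens n lam) (by fun_prop) (prod_dens_mul hn lam),
    partFn_map (by fun_prop) measurable_sumf]

/-- The scalars from the d - 1 normalizations drop out of a reweighted measure, and the densities
combine by `prod_dens_mul`. The condition on d makes the product nonempty. -/
lemma varRec_reweight {d : ℕ} (hd : 2 ≤ d) (h0 : partFn lam m sumf ≠ 0)
    (h1 : partFn lam m sumf ≠ ∞) :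
    varRec d lam (reweight lam m sumf ratf)
      = reweight lam ((Measure.pi fun _ : Fin (d - 1) => m).map fun y => ∏ i, y i) sumf ratf := by
  have hc0 : ((partFn lam m sumf)⁻¹) ^ (d - 1) ≠ 0 := pow_ne_zero _ (ENNReal.inv_ne_zero.2 h1)
  have hc1 : ((partFn lam m sumf)⁻¹) ^ (d - 1) ≠ ∞ := ENNReal.pow_ne_top (ENNReal.inv_ne_top.2 h0)
  rw [varRec, iid_reweight _ h0 h1, reweight_smul hc0 hc1,
    reweight_map (measurable_ratf_pi _) (measurable_agree _) (by fun_prop),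
    reweight_withDensity (measurable_prod_dens _ lam) (by fun_prop) (prod_dens_mul (by omega) lam),
    reweight_map (by fun_prop) measurable_sumf measurable_ratf]
  simp only [prod_ratf_div_agree]

end Recursion

end

end NaeSat

namespace NaeSat

noncomputable section

set_option linter.unusedSectionVars false

variable {n d : ℕ} {p : SpE} {lam : ℝ}

/-! ### The message measures -/

/-- The complex power has 0^0 = 1. The indicator of a condition that implies positivity removes this
value, so the functionals respect 0^0 = 0 even at exponent zero. -/
lemma cpow_mul_ind {s : ℝ} {P : Prop} [Decidable P] (hs : P → 0 < s) :
    (s : ℂ) ^ (lam : ℂ) • ind P = ((if P then tpow s lam else 0 : ℝ) : ℂ) := by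
  by_cases h : P
  · rw [ind_true h, if_pos h, tpow, if_neg (hs h).ne', Complex.ofReal_cpow (hs h).le, smul_eq_mul,
      mul_one]
  · rw [ind_false h, if_neg h, smul_zero, Complex.ofReal_zero]

lemma UU_fam (y : Pair) : powFam (fun y : Pair => (y.1 : ℝ) + y.2)
    (fun y => ind (0 < (y.1 : ℝ) + y.2)) lam y = ((tpow (sumf y) lam : ℝ) : ℂ) := by
  classical
  have h := cpow_mul_ind (lam := lam) (s := (y.1 : ℝ) + y.2) (P := 0 < (y.1 : ℝ) + y.2) id
  rw [powFam, h]
  split_ifs with h1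
  · rfl
  · have : sumf y = 0 := le_antisymm (not_lt.1 h1) (sumf_nonneg y)
    rw [this, tpow_zero]

open scoped Classical in
lemma xi1_fam (y : Pair) : powFam (fun y : Pair => (y.1 : ℝ))
    (fun y => ind (0 < (y.1 : ℝ) ∧ (y.2 : ℝ) = 0)) lam y
      = ((if 0 < (y.1 : ℝ) ∧ (y.2 : ℝ) = 0 then tpow y.1 lam else 0 : ℝ) : ℂ) :=
  cpow_mul_ind fun h => h.1

open scoped Classical in
lemma xi0_fam (y : Pair) : powFam (fun y : Pair => (y.2 : ℝ))
    (fun y => ind (0 < (y.2 : ℝ) ∧ (y.1 : ℝ) = 0)) lam y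
      = ((if 0 < (y.2 : ℝ) ∧ (y.1 : ℝ) = 0 then tpow y.2 lam else 0 : ℝ) : ℂ) :=
  cpow_mul_ind fun h => h.1

lemma pos_msg (y : Pair) : Pos (msg y) := by
  by_cases h : 0 < (y.1 : ℝ) ∧ 0 < (y.2 : ℝ)
  · rw [msg_pos h]; exact Pos.delta _
  · rw [msg_neg h]; exact Pos.zero

lemma norm_cpow_eq {s : ℝ} (hs : 0 ≤ s) :
    ((‖(s : ℂ) ^ (lam : ℂ)‖ : ℝ) : ℂ) = (s : ℂ) ^ (lam : ℂ) := by
  rw [← Complex.ofReal_cpow hs, Complex.norm_real, Real.norm_of_nonneg (by positivity)]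

section Functionals

variable (hlam : lam ∈ Icc (0 : ℝ) 1) {a : SpA} (ha : Pos a)
include hlam ha

lemma Pos.LL : Pos (LL lam a) :=
  Pos.lift (pd_L.powFam_bound (ofReal_mem_strip hlam))
    (fun y => (pos_msg y).smul (norm_cpow_eq (sumf_nonneg y))) ha

lemma norm_eq_of_lift {v : Pair → ℝ} {f : Pair → ℂ} {C : ℝ} (h : ∀ y, ‖f y‖ ≤ C * wA y)
    (e : ∀ y, f y = ((v y : ℝ) : ℂ)) (hv : ∀ y, 0 ≤ v y) :
    ((‖L1.lift wA f a‖ : ℝ) : ℂ) = L1.lift wA f a := by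
  obtain rfl : f = fun y => ((v y : ℝ) : ℂ) := funext e
  have h1 := ha.lift_eq_re h
  have h2 := ha.re_nonneg h hv
  rw [← h1, Complex.norm_real, Real.norm_of_nonneg h2]

lemma Pos.xi1 : ((‖xi1 lam a‖ : ℝ) : ℂ) = xi1 lam a := by
  classical
  exact norm_eq_of_lift hlam ha (pd_xi1.powFam_bound (ofReal_mem_strip hlam)) xi1_fam
    fun y => by split_ifs <;> [exact tpow_nonneg y.1.2.1; exact le_rfl]

lemma Pos.xi0 : ((‖xi0 lam a‖ : ℝ) : ℂ) = xi0 lam a := by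
  classical
  exact norm_eq_of_lift hlam ha (pd_xi0.powFam_bound (ofReal_mem_strip hlam)) xi0_fam
    fun y => by split_ifs <;> [exact tpow_nonneg y.2.2.1; exact le_rfl]

lemma Pos.UU : ((‖UU lam a‖ : ℝ) : ℂ) = UU lam a :=
  norm_eq_of_lift hlam ha (pd_U.powFam_bound (ofReal_mem_strip hlam)) UU_fam
    fun y => tpow_nonneg (sumf_nonneg y)

/-- For λ ∈ [0,1] and nonnegative coefficients the holomorphic functional is a nonnegative real
number, hence equal to its norm. -/
lemma partFn_meas_sumf : partFn lam (meas a) sumf = ‖NaeSat.UU lam a‖ₑ := by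
  have hb := pd_U.powFam_bound (ofReal_mem_strip hlam)
  rw [show powFam (fun y : Pair => (y.1 : ℝ) + y.2) (fun y => ind (0 < (y.1 : ℝ) + y.2)) lam
    = fun y => ((tpow (sumf y) lam : ℝ) : ℂ) from funext UU_fam] at hb
  have h := ha.lintegral hb fun y => tpow_nonneg (sumf_nonneg y)
  rw [partFn, h, ← ofReal_norm]
  congr 1
  have e : NaeSat.UU lam a = L1.lift wA (fun y => ((tpow (sumf y) lam : ℝ) : ℂ)) a := by
    rw [← funext UU_fam]; rfl
  rw [← e]
  have := ha.UU hlam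
  rw [← this, Complex.ofReal_re, Complex.norm_real, norm_norm]

end Functionals

lemma evalSet_free (s : Set ℝ) (x : Free) :
    evalSet wE {x : Free | (x : ℝ) ∈ s} (L1.delta wE x) = ((chr s (x : ℝ) : ℝ) : ℂ) :=
  evalSet_delta _ x

/-- The law of the normalized message of a pair. -/
lemma map_ratf_withDensity (hlam : lam ∈ Icc (0 : ℝ) 1) {a : SpA} (ha : Pos a) :
    ((meas a).withDensity (dens lam)).map ratf
      = ‖xi1 lam a‖ₑ • Measure.dirac 1 + ‖xi0 lam a‖ₑ • Measure.dirac 0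
        + (meas (LL lam a)).map (fun x : Free => (x : ℝ)) := by
  have hz := ofReal_mem_strip hlam
  ext s hs
  have hs' : MeasurableSet {x : Free | (x : ℝ) ∈ s} := measurable_subtype_coe hs
  set v : Pair → ℝ := fun y => tpow (sumf y) lam * chr s (ratf y) with hv
  have hv0 : ∀ y, 0 ≤ v y := fun y => mul_nonneg (tpow_nonneg (sumf_nonneg y)) (chr_nonneg _ _)
  have hvb : ∀ y, ‖((v y : ℝ) : ℂ)‖ ≤ 6 * wA y := fun y => by
    have h1 := pd_U.powFam_bound hz y
    rw [UU_fam] at h1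
    rw [hv, Complex.ofReal_mul, norm_mul]
    have h2 : ‖((chr s (ratf y) : ℝ) : ℂ)‖ ≤ 1 := by
      unfold chr; split_ifs <;> simp
    calc _ ≤ ‖((tpow (sumf y) lam : ℝ) : ℂ)‖ * 1 := by gcongr
      _ ≤ _ := by linarith
  have hL : ((meas a).withDensity (dens lam)).map ratf s
      = ENNReal.ofReal (L1.lift wA (fun y => ((v y : ℝ) : ℂ)) a).re := by
    rw [← ha.lintegral hvb hv0, Measure.map_apply measurable_ratf hs,
      withDensity_apply _ (measurable_ratf hs), ← lintegral_indicator (measurable_ratf hs)]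
    refine lintegral_congr fun y => ?_
    rw [hv, ENNReal.ofReal_mul (tpow_nonneg (sumf_nonneg y)), ofReal_chr]
    by_cases h : ratf y ∈ s
    · rw [indicator_of_mem (by exact h), indicator_of_mem h]; simp [dens]
    · rw [indicator_of_notMem (by exact h), indicator_of_notMem h]; simp
  -- On a basis vector (u, v) the normalized message is 1 if v = 0 < u, 0 if u = 0 < v, and free if
  -- both are positive; (0, 0) has weight zero.
  have key : L1.lift wA (fun y => ((v y : ℝ) : ℂ))
      = ((chr s 1 : ℝ) : ℂ) • xi1 lam + ((chr s 0 : ℝ) : ℂ) • xi0 lam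
        + evalSet wE {x : Free | (x : ℝ) ∈ s} ∘L LL lam := by
    classical
    refine L1.clm_ext fun y => ?_
    rw [L1.lift_delta hvb, add_apply, add_apply, smul_apply, smul_apply,
      ContinuousLinearMap.comp_apply, xi1, xi0, LL, pd_xi1.powLift_delta hz,
      pd_xi0.powLift_delta hz, pd_L.powLift_delta hz, map_smul]
    have hx1 := xi1_fam (lam := lam) y
    have hx0 := xi0_fam (lam := lam) y
    rw [powFam] at hx1 hx0
    rw [hx1, hx0]
    rcases y.1.2.1.eq_or_lt with h1 | h1 <;> rcases y.2.2.1.eq_or_lt with h2 | h2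
    · rw [msg_neg (by rw [← h1]; simp), hv]
      have : sumf y = 0 := by rw [sumf, ← h1, ← h2, add_zero]
      simp [this, tpow_zero, ← h1, ← h2]
    · rw [msg_neg (by rw [← h1]; simp), hv]
      have e1 : sumf y = y.2 := by rw [sumf, ← h1, zero_add]
      have e2 : ratf y = 0 := by rw [ratf, ← h1, zero_div]
      simp [e1, e2, ← h1, h2, mul_comm]
    · rw [msg_neg (by rw [← h2]; simp), hv]
      have e1 : sumf y = y.1 := by rw [sumf, ← h2, add_zero]
      have e2 : ratf y = 1 := by rw [ratf, ← h2, add_zero, div_self h1.ne']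
      simp [e1, e2, ← h2, h1, mul_comm]
    · rw [msg_pos ⟨h1, h2⟩, evalSet_free, hv]
      have e2 : ((y.free ⟨h1, h2⟩ : Free) : ℝ) = ratf y := rfl
      have h3 : 0 < (y.1 : ℝ) + y.2 := add_pos h1 h2
      rw [e2, if_neg (fun h => h2.ne' h.2), if_neg (fun h => h1.ne' h.2)]
      simp only [Complex.ofReal_zero, mul_zero, zero_add, Complex.ofReal_mul, smul_eq_mul]
      rw [sumf, tpow, if_neg h3.ne', Complex.ofReal_cpow h3.le]
  have h1 := ha.xi1 hlam
  have h0 := ha.xi0 hlam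
  have hLL := ha.LL hlam
  have h2 := hLL.evalSet_nonneg {x : Free | (x : ℝ) ∈ s}
  rw [hL, key, add_apply, add_apply, smul_apply, smul_apply, ContinuousLinearMap.comp_apply,
    Measure.add_apply, Measure.add_apply, Measure.smul_apply, Measure.smul_apply,
    Measure.map_apply measurable_subtype_coe hs, hLL.meas_apply (measurable_subtype_coe hs),
    Complex.add_re, Complex.add_re, smul_eq_mul, smul_eq_mul, Complex.re_ofReal_mul,
    Complex.re_ofReal_mul]
  have h1' : (xi1 lam a).re = ‖xi1 lam a‖ := by rw [← h1, Complex.ofReal_re, Complex.norm_real, norm_norm]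
  have h0' : (xi0 lam a).re = ‖xi0 lam a‖ := by rw [← h0, Complex.ofReal_re, Complex.norm_real, norm_norm]
  rw [h1', h0', ENNReal.ofReal_add, ENNReal.ofReal_add, ENNReal.ofReal_mul (chr_nonneg _ _),
    ENNReal.ofReal_mul (chr_nonneg _ _), ofReal_norm, ofReal_norm, ofReal_chr,
    ofReal_chr, Measure.dirac_apply' _ hs, Measure.dirac_apply' _ hs, smul_eq_mul, smul_eq_mul,
    mul_comm (s.indicator 1 1), mul_comm (s.indicator 1 0)]
  · rfl
  · exact mul_nonneg (chr_nonneg _ _) (norm_nonneg _)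
  · exact mul_nonneg (chr_nonneg _ _) (norm_nonneg _)
  · exact add_nonneg (mul_nonneg (chr_nonneg _ _) (norm_nonneg _))
      (mul_nonneg (chr_nonneg _ _) (norm_nonneg _))
  · exact h2

/-- The message measure on the unit interval. -/
def measI (p : SpE) : Measure unitInterval :=
  Measure.dirac 0 + Measure.dirac 1 + (meas p).map Free.toI

/-- The message measure. -/
def msgMeas (p : SpE) : Measure ℝ := (measI p).map (Subtype.val : unitInterval → ℝ)

lemma measurable_toI : Measurable Free.toI :=
  Measurable.subtype_mk measurable_subtype_coe

lemma measurable_pt : Measurable pt := by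
  refine Measurable.subtype_mk (measurable_id.prodMk ?_)
  exact unitInterval.continuous_symm.measurable

lemma measurable_flipPt : Measurable flipPt := by
  have := unitInterval.continuous_symm.measurable
  unfold flipPt
  fun_prop

instance (p : SpE) : IsFiniteMeasure (measI p) := by unfold measI; infer_instance

instance (p : SpE) : IsFiniteMeasure (msgMeas p) := by unfold msgMeas; infer_instance

lemma msgMeas_eq (p : SpE) :
    msgMeas p = Measure.dirac 0 + Measure.dirac 1 + (meas p).map (fun x : Free => (x : ℝ)) := by
  rw [msgMeas, measI, Measure.map_add _ _ measurable_subtype_coe,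
    Measure.map_add _ _ measurable_subtype_coe, Measure.map_dirac' measurable_subtype_coe,
    Measure.map_dirac' measurable_subtype_coe, Measure.map_map measurable_subtype_coe measurable_toI]
  rfl

lemma pos_e0 : Pos e0 := Pos.delta _

lemma pos_e1 : Pos e1 := Pos.delta _

lemma Pos.emb (hp : Pos p) : Pos (emb p) := Pos.lift emb_bound (fun _ => Pos.delta _) hp

lemma Pos.full (hp : Pos p) : Pos (full p) := (pos_e0.add pos_e1).add hp.emb

/-- The message law, transported by x ↦ (x, 1 - x), is the algebra element `full p`. Products of
independent messages become its powers. -/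
lemma map_pt_measI (hp : Pos p) : (measI p).map pt = meas (full p) := by
  rw [measI, full, (pos_e0.add pos_e1).meas_add hp.emb,
    pos_e0.meas_add pos_e1, e0, e1, meas_delta, meas_delta,
    Measure.map_add _ _ measurable_pt, Measure.map_add _ _ measurable_pt,
    Measure.map_dirac' measurable_pt, Measure.map_dirac' measurable_pt,
    Measure.map_map measurable_pt measurable_toI]
  congr 1
  exact (hp.meas_lift_delta (measurable_pt.comp measurable_toI) emb_bound).symm

lemma map_prod_measI (hp : Pos p) (n : ℕ) :
    (Measure.pi fun _ : Fin n => measI p).map (fun x => ∏ i, pt (x i)) = meas (full p ^ n) := by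
  rw [← hp.full.map_prod_pi n, ← map_pt_measI hp, ← Measure.pi_map_pi fun _ => measurable_pt.aemeasurable,
    Measure.map_map (by fun_prop) (by have := measurable_pt; fun_prop)]
  rfl

end

end NaeSat

namespace NaeSat

noncomputable section

set_option linter.unusedSectionVars false

variable {n d : ℕ} {p : SpE} {lam : ℝ}

lemma Good.two_le (hg : Good n d) : 2 ≤ d := by
  by_contra h
  have h1 : (d : ℝ) ≤ 1 := by exact_mod_cast (by omega : d ≤ 1)
  have h2 := hg.lower
  have h3 := hg.h_le
  have h4 := hg.n_ge
  have h5 := Real.log_two_gt_d9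
  have h0 := hh_pos n
  have h6 : (d : ℝ) * hh n ≤ 1 / 10 := by nlinarith
  have h7 : 1 ≤ ((n : ℝ) + 1) * Real.log 2 := by nlinarith
  nlinarith

/-! ### The recursion on message measures -/

lemma Pos.qq (hp : Pos p) (n : ℕ) : Pos (qq n p) :=
  Pos.lift flipL_bound (fun _ => Pos.delta _) (hp.full.pow n)

lemma map_flip_measI (hp : Pos p) (n : ℕ) :
    (Measure.pi fun _ : Fin n => measI p).map (fun x => flipPt (∏ i, pt (x i)))
      = meas (NaeSat.qq n p) := by
  have h : meas (NaeSat.qq n p) = (meas (full p ^ n)).map flipPt :=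
    (hp.full.pow n).meas_lift_delta measurable_flipPt flipL_bound
  rw [h, ← map_prod_measI hp, Measure.map_map measurable_flipPt (by have := measurable_pt; fun_prop)]
  rfl

lemma clause_prod_fst {ι : Type*} (s : Finset ι) (x : ι → unitInterval) :
    ((∏ i ∈ s, pt (x i)).1.1 : ℝ) = ∏ i ∈ s, (x i : ℝ) := by
  classical
  induction s using Finset.induction_on with
  | empty => simp
  | insert a s ha ih => rw [Finset.prod_insert ha, Finset.prod_insert ha, clause_mul_fst, ih, pt_fst]

lemma clause_prod_snd {ι : Type*} (s : Finset ι) (x : ι → unitInterval) :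
    ((∏ i ∈ s, pt (x i)).1.2 : ℝ) = ∏ i ∈ s, (1 - (x i : ℝ)) := by
  classical
  induction s using Finset.induction_on with
  | empty => simp
  | insert a s ha ih => rw [Finset.prod_insert ha, Finset.prod_insert ha, clause_mul_snd, ih, pt_snd]

lemma two_sub_agree {n : ℕ} (x : Fin n → unitInterval) :
    2 - agree (fun i => (x i : ℝ)) = sumf (flipPt (∏ i, pt (x i))) := by
  rw [sumf, flipPt_fst, flipPt_snd, clause_prod_fst, clause_prod_snd, agree]; ring

lemma clause_ratio {n : ℕ} (x : Fin n → unitInterval) :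
    (1 - ∏ i, (x i : ℝ)) / (2 - agree (fun i => (x i : ℝ))) = ratf (flipPt (∏ i, pt (x i))) := by
  rw [two_sub_agree, ratf, ← sumf, flipPt_fst, clause_prod_fst]

lemma measurable_coe_pi (n : ℕ) : Measurable fun (x : Fin n → unitInterval) i => (x i : ℝ) := by
  fun_prop

lemma measurable_flip_prod (n : ℕ) :
    Measurable fun x : Fin n → unitInterval => flipPt (∏ i, pt (x i)) := by
  have := measurable_pt
  have := measurable_flipPt
  fun_prop

lemma clauseRec_msgMeas (hp : Pos p) (n : ℕ) (lam : ℝ) {c : ℝ≥0∞} (h0 : c ≠ 0) (h1 : c ≠ ∞) :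
    clauseRec (n + 1) lam (c • msgMeas p) = reweight lam (meas (qq n p)) sumf ratf := by
  rw [clauseRec, Nat.add_sub_cancel, iid_smul _ _ _ h1,
    reweight_smul (pow_ne_zero _ h0) (ENNReal.pow_ne_top h1), msgMeas,
    iid_map _ _ measurable_subtype_coe, reweight_map (measurable_coe_pi n) (by fun_prop)
      (by unfold agree; fun_prop), ← map_flip_measI hp,
    reweight_map (measurable_flip_prod n) measurable_sumf measurable_ratf]
  simp only [← clause_ratio, ← two_sub_agree]

lemma eq_inv_smul_of_isProbabilityMeasure {μ : Measure ℝ} [IsFiniteMeasure μ] {c : ℝ≥0∞}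
    (h : IsProbabilityMeasure (c • μ)) : c • μ = (μ univ)⁻¹ • μ := by
  have h1 : c * μ univ = 1 := h.measure_univ
  rw [ENNReal.eq_inv_of_mul_eq_one_left h1]

/-- The normalized message measure. -/
def nmeas (p : SpE) : Measure ℝ := (msgMeas p univ)⁻¹ • msgMeas p

lemma two_le_msgMeas_univ (p : SpE) : 2 ≤ msgMeas p univ := by
  rw [msgMeas_eq, Measure.add_apply, Measure.add_apply, measure_univ, measure_univ, one_add_one_eq_two]
  exact le_self_add

lemma msgMeas_univ_ne_zero (p : SpE) : msgMeas p univ ≠ 0 := fun h => by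
  have := two_le_msgMeas_univ p
  rw [h] at this
  simp at this

lemma msgMeas_univ_ne_top (p : SpE) : msgMeas p univ ≠ ∞ := measure_ne_top _ _

instance (p : SpE) : IsProbabilityMeasure (nmeas p) := by
  constructor
  rw [nmeas, Measure.smul_apply, smul_eq_mul]
  exact ENNReal.inv_mul_cancel (msgMeas_univ_ne_zero p) (msgMeas_univ_ne_top p)

section

variable (hlam : lam ∈ Icc (0 : ℝ) 1) (hg : Good n d) (hp : Pos p)
include hlam hg hp

lemma norm_kap_eq (N : ℕ) : ((‖kap n N lam p‖ : ℝ) : ℂ) = kap n N lam p := by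
  have h := ((hp.qq n).pow N).xi1 hlam
  have hn : n ≠ 0 := by have := hg.three; omega
  rwa [xi1_qq_pow (ofReal_mem_strip hlam) hn] at h

lemma Pos.TT : Pos (TT n (d - 1) lam p) := by
  refine (((hp.qq n).pow (d - 1)).LL hlam).smul ?_
  rw [norm_inv, Complex.ofReal_inv, norm_kap_eq hlam hg hp]

/-- The constant is a nonnegative free part plus twice the frozen mass, which is a nonzero
nonnegative real. -/
lemma partFn_qq_pow_ne_zero {N : ℕ} (hk : kap n N lam p ≠ 0) (hsy : Symm p) :
    partFn lam (meas (NaeSat.qq n p ^ N)) sumf ≠ 0 := by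
  have hz := ofReal_mem_strip hlam
  have hn : n ≠ 0 := by have := hg.three; omega
  rw [partFn_meas_sumf hlam ((hp.qq n).pow _), enorm_ne_zero]
  intro h
  rw [UU_eq hz, xi1_qq_pow hz hn, hsy.xi0_qq_pow hz hn, ← norm_kap_eq hlam hg hp] at h
  have hf : 0 ≤ (UF lam (NaeSat.qq n p ^ N)).re := by
    classical
    have hb := pd_UF.powFam_bound hz
    have e : powFam (fun y : Pair => (y.1 : ℝ) + y.2)
        (fun y => ind (0 < (y.1 : ℝ) ∧ 0 < (y.2 : ℝ))) lam
        = fun y => ((if 0 < (y.1 : ℝ) ∧ 0 < (y.2 : ℝ) then tpow (sumf y) lam else 0 : ℝ) : ℂ) :=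
      funext fun y => cpow_mul_ind fun h => add_pos h.1 h.2
    rw [e] at hb
    have := ((hp.qq n).pow N).re_nonneg hb fun y => by
      split_ifs <;> [exact tpow_nonneg (sumf_nonneg y); exact le_rfl]
    rw [← e] at this
    exact this
  have h2 := congrArg Complex.re h
  simp only [Complex.add_re, Complex.ofReal_re, Complex.zero_re] at h2
  have := norm_pos_iff.2 hk
  linarith

/-- Both frozen masses are `kap` and the free part is `kap` times `TT` by definition, so the law is
proportional to the message measure of the new free part. Being probability measures, the two
normalizations agree. -/
lemma reweight_qq_pow (hr : ‖p‖ ≤ rad n) (hsy : Symm p) :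
    reweight lam (meas (NaeSat.qq n p ^ (d - 1))) sumf ratf = nmeas (NaeSat.TT n (d - 1) lam p) := by
  have hz := ofReal_mem_strip hlam
  have hn : n ≠ 0 := by have := hg.three; omega
  have hq := (hp.qq n).pow (d - 1)
  have hk := kap_ne_zero hz hg hr
  have h0 := partFn_qq_pow_ne_zero hlam hg hp hk hsy
  have h1 : partFn lam (meas (NaeSat.qq n p ^ (d - 1))) sumf ≠ ∞ := by
    rw [partFn_meas_sumf hlam hq]; exact enorm_ne_top
  have hpr := isProbabilityMeasure_reweight measurable_ratf h0 h1
  have hL : LL lam (NaeSat.qq n p ^ (d - 1)) = kap n (d - 1) lam p • NaeSat.TT n (d - 1) lam p := by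
    rw [NaeSat.TT, smul_smul, mul_inv_cancel₀ hk, one_smul]
  have e : reweight lam (meas (NaeSat.qq n p ^ (d - 1))) sumf ratf
      = ((partFn lam (meas (NaeSat.qq n p ^ (d - 1))) sumf)⁻¹ * ‖kap n (d - 1) lam p‖ₑ)
        • msgMeas (NaeSat.TT n (d - 1) lam p) := by
    rw [mul_smul]
    refine congrArg _ ((map_ratf_withDensity hlam hq).trans ?_)
    rw [xi1_qq_pow hz hn, hsy.xi0_qq_pow hz hn, hL, meas_smul, Measure.map_smul, msgMeas_eq,
      smul_add, smul_add, add_comm (_ • Measure.dirac (1 : ℝ))]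
  rw [e] at hpr ⊢
  exact eq_inv_smul_of_isProbabilityMeasure hpr

lemma partFn_qq_ne (hsy : Symm p) : partFn lam (meas (NaeSat.qq n p)) sumf ≠ 0 ∧
    partFn lam (meas (NaeSat.qq n p)) sumf ≠ ∞ := by
  constructor
  · have hk : kap n 1 lam p ≠ 0 := by
      rw [kap, pow_one, pow_one, sub_sub_cancel]; exact one_ne_zero
    have := partFn_qq_pow_ne_zero hlam hg hp hk hsy
    rwa [pow_one] at this
  · rw [partFn_meas_sumf hlam (hp.qq n)]; exact enorm_ne_top

lemma varRec_clauseRec_nmeas (hr : ‖p‖ ≤ rad n) (hsy : Symm p) :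
    varRec d lam (clauseRec (n + 1) lam (nmeas p)) = nmeas (NaeSat.TT n (d - 1) lam p) := by
  obtain ⟨h0, h1⟩ := partFn_qq_ne hlam hg hp hsy
  rw [nmeas, clauseRec_msgMeas hp n lam (ENNReal.inv_ne_zero.2 (msgMeas_univ_ne_top p))
    (ENNReal.inv_ne_top.2 (msgMeas_univ_ne_zero p)), varRec_reweight hg.two_le h0 h1,
    (hp.qq n).map_prod_pi, reweight_qq_pow hlam hg hp hr hsy]

end

lemma pos_iter (hlam : lam ∈ Icc (0 : ℝ) 1) (hg : Good n d) (l : ℕ) : Pos (iter n d lam l) := by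
  induction l with
  | zero => exact Pos.zero
  | succ l ih => exact ih.TT hlam hg

lemma pos_fixp (hlam : lam ∈ Icc (0 : ℝ) 1) (hg : Good n d) : Pos (fixp n d lam) :=
  Pos.of_tendsto (tendsto_iter (ofReal_mem_strip hlam) hg) (pos_iter hlam hg)

lemma meas_zero : meas (0 : SpE) = 0 := by
  have h := meas_smul (c := 0) (0 : SpE)
  rwa [zero_smul, enorm_zero, zero_smul] at h

lemma norm_iter_le_rad (hlam : lam ∈ Icc (0 : ℝ) 1) (hg : Good n d) (l : ℕ) :
    ‖iter n d lam l‖ ≤ rad n :=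
  hg.small_p (norm_iter_le (ofReal_mem_strip hlam) hg l)

/-- The starting law (δ_0 + δ_1)/2 has free part zero, the starting point of `iter`. -/
lemma dotMuSeq_eq (hlam : lam ∈ Icc (0 : ℝ) 1) (hg : Good n d) (l : ℕ) :
    dotMuSeq (n + 1) d lam l = nmeas (iter n d lam l) := by
  induction l with
  | zero =>
    rw [dotMuSeq, iter, nmeas, msgMeas_eq, meas_zero, Measure.map_zero, add_zero]
    congr 2
    rw [Measure.add_apply, measure_univ, measure_univ, one_add_one_eq_two]
  | succ l ih =>
    rw [dotMuSeq, ih, varRec_clauseRec_nmeas hlam hg (pos_iter hlam hg l) (norm_iter_le_rad hlam hg l)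
      (symm_iter (ofReal_mem_strip hlam) l)]
    rfl

end

end NaeSat

namespace NaeSat

noncomputable section

set_option linter.unusedSectionVars false

variable {n d : ℕ} {p p' : SpE} {lam : ℝ}

/-! ### Convergence in the distance of point masses -/

lemma countable_support_coef {I : Type} {w : Weight I} (a : L1 w) :
    {i | L1.coef i a ≠ 0}.Countable := by
  have := (L1.summable_coef a).countable_support
  refine this.mono fun i hi => ?_
  exact norm_ne_zero_iff.2 hi

lemma meas_coef_eq_zero {I : Type} [MeasurableSpace I] [MeasurableSingletonClass I] {w : Weight I}
    (a : L1 w) : meas a {i | L1.coef i a ≠ 0}ᶜ = 0 := by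
  rw [← lintegral_indicator_one (countable_support_coef a).measurableSet.compl, lintegral_meas]
  refine ENNReal.tsum_eq_zero.2 fun i => ?_
  by_cases h : L1.coef i a = 0
  · rw [h, enorm_zero, zero_mul]
  · rw [indicator_of_notMem (by simpa using h), mul_zero]

lemma isDiscreteProb_nmeas (p : SpE) : IsDiscreteProb (nmeas p) := by
  refine ⟨inferInstance, {0, 1} ∪ (fun x : Free => (x : ℝ)) '' {i | L1.coef i p ≠ 0},
    ((Set.toFinite _).countable).union ((countable_support_coef p).image _), ?_, ?_⟩
  · rintro x (h | ⟨y, -, rfl⟩)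
    · rcases h with rfl | h
      · exact ⟨le_rfl, zero_le_one⟩
      · rw [mem_singleton_iff.1 h]; exact ⟨zero_le_one, le_rfl⟩
    · exact ⟨y.2.1.le, y.2.2.le⟩
  · set S := {0, 1} ∪ (fun x : Free => (x : ℝ)) '' {i | L1.coef i p ≠ 0} with hS
    have hSm : MeasurableSet Sᶜ := (((Set.toFinite _).countable).union
      ((countable_support_coef p).image _)).measurableSet.compl
    suffices h : msgMeas p Sᶜ = 0 by rw [nmeas, Measure.smul_apply, h, smul_zero]
    rw [msgMeas_eq, Measure.add_apply, Measure.add_apply,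
      Measure.dirac_apply' _ hSm, Measure.dirac_apply' _ hSm,
      Measure.map_apply measurable_subtype_coe hSm]
    have h0 : (0 : ℝ) ∉ Sᶜ := by simp [hS]
    have h1 : (1 : ℝ) ∉ Sᶜ := by simp [hS]
    rw [indicator_of_notMem h0, indicator_of_notMem h1]
    have h2 : meas p ((fun x : Free => (x : ℝ)) ⁻¹' Sᶜ) = 0 := by
      refine measure_mono_null (fun i hi => ?_) (meas_coef_eq_zero p)
      intro h
      exact hi (Or.inr ⟨i, h, rfl⟩)
    rw [h2]
    simp

lemma ratf_mem (y : Pair) : ratf y ∈ Icc (0 : ℝ) 1 := by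
  have h1 := y.1.2.1
  have h2 := y.2.2.1
  exact ⟨div_nonneg h1 (add_nonneg h1 h2), div_le_one_of_le₀ (by linarith) (add_nonneg h1 h2)⟩

lemma isDiscreteProb_reweight {a : SpA} (h0 : partFn lam (meas a) sumf ≠ 0)
    (h1 : partFn lam (meas a) sumf ≠ ∞) : IsDiscreteProb (reweight lam (meas a) sumf ratf) := by
  have hc := (countable_support_coef a).image ratf
  refine ⟨isProbabilityMeasure_reweight measurable_ratf h0 h1, _, hc, ?_, ?_⟩
  · rintro _ ⟨y, -, rfl⟩
    exact ratf_mem y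
  · rw [reweight, Measure.smul_apply, Measure.map_apply measurable_ratf hc.measurableSet.compl]
    have : (meas a).withDensity (fun ω => ENNReal.ofReal (tpow (sumf ω) lam))
        (ratf ⁻¹' (ratf '' {i | L1.coef i a ≠ 0})ᶜ) = 0 := by
      refine withDensity_absolutelyContinuous _ _ (measure_mono_null (fun i hi => ?_)
        (meas_coef_eq_zero a))
      intro h
      exact hi ⟨i, h, rfl⟩
    rw [this, smul_zero]

lemma atomDist_comm (μ ν : Measure ℝ) : atomDist μ ν = atomDist ν μ := by
  unfold atomDist
  simp only [add_comm]

lemma atomDist_triangle (μ ν ρ : Measure ℝ) : atomDist μ ρ ≤ atomDist μ ν + atomDist ν ρ := by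
  unfold atomDist
  rw [← ENNReal.tsum_add]
  refine ENNReal.tsum_le_tsum fun x => ?_
  calc _ ≤ ((μ {x} - ν {x}) + (ν {x} - ρ {x})) + ((ρ {x} - ν {x}) + (ν {x} - μ {x})) :=
        add_le_add tsub_le_tsub_add_tsub tsub_le_tsub_add_tsub
    _ = _ := by ring

/-- All point masses agree, and both measures are carried by the countable union of their supports.
-/
lemma eq_of_atomDist_eq_zero {μ ν : Measure ℝ} (hμ : IsDiscreteProb μ) (hν : IsDiscreteProb ν)
    (h : atomDist μ ν = 0) : μ = ν := by
  have h1 : ∀ x, μ {x} = ν {x} := fun x => by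
    have := ENNReal.tsum_eq_zero.1 h x
    rw [add_eq_zero] at this
    exact le_antisymm (tsub_eq_zero_iff_le.1 this.1) (tsub_eq_zero_iff_le.1 this.2)
  obtain ⟨-, S, hS, -, hS0⟩ := hμ
  obtain ⟨-, T, hT, -, hT0⟩ := hν
  have key : ∀ (m : Measure ℝ), m (S ∪ T)ᶜ = 0 → ∀ B, MeasurableSet B →
      m B = ∑' x : ↥(B ∩ (S ∪ T)), m {(x : ℝ)} := fun m hm B hB => by
    have e := tsum_measure_preimage_singleton (μ := m) (s := B ∩ (S ∪ T)) (f := id)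
      ((hS.union hT).mono inter_subset_right) fun y _ => measurableSet_singleton y
    simp only [preimage_id_eq, id_eq] at e
    rw [e, measure_inter_conull hm]
  have k1 := key μ (measure_mono_null (compl_subset_compl.2 subset_union_left) hS0)
  have k2 := key ν (measure_mono_null (compl_subset_compl.2 subset_union_right) hT0)
  ext B hB
  rw [k1 B hB, k2 B hB]
  exact tsum_congr fun x => h1 x

lemma tsum_singleton_le (μ : Measure ℝ) : ∑' x : ℝ, μ {x} ≤ μ univ := by
  refine (tsum_meas_le_meas_iUnion_of_disjoint μ (fun x => measurableSet_singleton x)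
    fun x y h => ?_).trans (measure_mono (subset_univ _))
  exact disjoint_singleton.2 h

lemma meas_univ_le (a : SpE) : meas a univ ≤ ‖a‖ₑ := by
  rw [← lintegral_one, lintegral_meas, ← ofReal_norm, ← (L1.hasSum_norm a).tsum_eq,
    ENNReal.ofReal_tsum_of_nonneg (fun i => mul_nonneg (norm_nonneg _) (wE.pos i).le)
      (L1.hasSum_norm a).summable]
  refine ENNReal.tsum_le_tsum fun i => ?_
  rw [← ofReal_norm, mul_one]
  exact ENNReal.ofReal_le_ofReal (le_mul_of_one_le_right (norm_nonneg _) (wE.one_le i))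

lemma meas_le_add (a b : SpE) (s : Set Free) (hs : MeasurableSet s) :
    meas a s ≤ meas b s + meas (a - b) s := by
  rw [← lintegral_indicator_one hs, ← lintegral_indicator_one hs, ← lintegral_indicator_one hs,
    lintegral_meas, lintegral_meas, lintegral_meas, ← ENNReal.tsum_add]
  refine ENNReal.tsum_le_tsum fun i => ?_
  rw [← add_mul]
  gcongr
  have : L1.coef i a = L1.coef i b + L1.coef i (a - b) := by
    rw [← L1.coef_add, add_sub_cancel]
  rw [this]
  exact enorm_add_le _ _

lemma msgMeas_le_add (p p' : SpE) (s : Set ℝ) (hs : MeasurableSet s) :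
    msgMeas p s ≤ msgMeas p' s + (meas (p - p')).map (fun x : Free => (x : ℝ)) s := by
  rw [msgMeas_eq, msgMeas_eq, Measure.add_apply, Measure.add_apply _ ((meas p').map _), add_assoc,
    Measure.map_apply measurable_subtype_coe hs, Measure.map_apply measurable_subtype_coe hs,
    Measure.map_apply measurable_subtype_coe hs]
  gcongr
  exact meas_le_add p p' _ (measurable_subtype_coe hs)

lemma inv_le_inv_add {c c' M : ℝ≥0∞} (hc : c ≠ 0) (hc' : c' ≠ 0) (ht : c ≠ ∞) (ht' : c' ≠ ∞)
    (h : c' ≤ c + M) : c⁻¹ ≤ c'⁻¹ + c⁻¹ * c'⁻¹ * M := by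
  calc c⁻¹ = c⁻¹ * c'⁻¹ * c' := by rw [mul_assoc, ENNReal.inv_mul_cancel hc' ht', mul_one]
    _ ≤ c⁻¹ * c'⁻¹ * (c + M) := by gcongr
    _ = c'⁻¹ + c⁻¹ * c'⁻¹ * M := by
      rw [mul_add, mul_right_comm, ENNReal.inv_mul_cancel hc ht, one_mul]

/-- The point masses before normalization and the total masses each change by at most ‖p - p'‖. The
frozen atoms keep the total masses at least 2, so normalization costs only a constant. -/
lemma tsum_tsub_nmeas_le (p p' : SpE) :
    ∑' x : ℝ, (nmeas p {x} - nmeas p' {x}) ≤ 2 * ‖p - p'‖ₑ := by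
  set c := msgMeas p univ with hc
  set c' := msgMeas p' univ with hc'
  set m := (meas (p - p')).map (fun x : Free => (x : ℝ)) with hm
  have h0 := msgMeas_univ_ne_zero p
  have h0' := msgMeas_univ_ne_zero p'
  have ht := msgMeas_univ_ne_top p
  have ht' := msgMeas_univ_ne_top p'
  have hM : m univ ≤ ‖p - p'‖ₑ := by
    rw [hm, Measure.map_apply measurable_subtype_coe MeasurableSet.univ, preimage_univ]
    exact meas_univ_le _
  have hcc : c' ≤ c + ‖p - p'‖ₑ := by
    refine (msgMeas_le_add p' p univ MeasurableSet.univ).trans ?_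
    gcongr
    rw [Measure.map_apply measurable_subtype_coe MeasurableSet.univ, preimage_univ, ← enorm_neg,
      neg_sub]
    exact meas_univ_le _
  have hc1 : c⁻¹ ≤ 1 := ENNReal.inv_le_one.2 (le_trans (by norm_num) (two_le_msgMeas_univ p))
  have key : ∀ x, nmeas p {x} - nmeas p' {x}
      ≤ c⁻¹ * c'⁻¹ * ‖p - p'‖ₑ * msgMeas p' {x} + c⁻¹ * m {x} := fun x => by
    rw [tsub_le_iff_left, nmeas, nmeas, Measure.smul_apply, Measure.smul_apply, smul_eq_mul,
      smul_eq_mul, ← add_assoc, ← add_mul]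
    calc c⁻¹ * msgMeas p {x} ≤ c⁻¹ * (msgMeas p' {x} + m {x}) := by
          gcongr; exact msgMeas_le_add p p' _ (measurableSet_singleton x)
      _ = c⁻¹ * msgMeas p' {x} + c⁻¹ * m {x} := mul_add _ _ _
      _ ≤ _ := by
          gcongr
          exact inv_le_inv_add h0 h0' ht ht' hcc
  calc _ ≤ ∑' x : ℝ, (c⁻¹ * c'⁻¹ * ‖p - p'‖ₑ * msgMeas p' {x} + c⁻¹ * m {x}) :=
        ENNReal.tsum_le_tsum key
    _ = c⁻¹ * c'⁻¹ * ‖p - p'‖ₑ * (∑' x : ℝ, msgMeas p' {x}) + c⁻¹ * ∑' x : ℝ, m {x} := by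
        rw [ENNReal.tsum_add, ENNReal.tsum_mul_left, ENNReal.tsum_mul_left]
    _ ≤ c⁻¹ * c'⁻¹ * ‖p - p'‖ₑ * c' + c⁻¹ * ‖p - p'‖ₑ := by
        gcongr
        · exact tsum_singleton_le _
        · exact (tsum_singleton_le _).trans hM
    _ = c⁻¹ * (c'⁻¹ * c') * ‖p - p'‖ₑ + c⁻¹ * ‖p - p'‖ₑ := by ring
    _ ≤ 1 * 1 * ‖p - p'‖ₑ + 1 * ‖p - p'‖ₑ := by
        rw [ENNReal.inv_mul_cancel h0' ht']
        gcongr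
    _ = _ := by ring

lemma atomDist_nmeas_le (p p' : SpE) : atomDist (nmeas p) (nmeas p') ≤ 4 * ‖p - p'‖ₑ := by
  rw [atomDist, ENNReal.tsum_add]
  have h1 := tsum_tsub_nmeas_le p p'
  have h2 := tsum_tsub_nmeas_le p' p
  rw [← enorm_neg, neg_sub] at h2
  calc _ ≤ 2 * ‖p - p'‖ₑ + 2 * ‖p - p'‖ₑ := add_le_add h1 h2
    _ = _ := by ring

section

variable (hlam : lam ∈ Icc (0 : ℝ) 1) (hg : Good n d)
include hlam hg

lemma isDotMu_nmeas : IsDotMu (n + 1) d lam (nmeas (fixp n d lam)) := by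
  refine ⟨isDiscreteProb_nmeas _, ?_⟩
  have h := tendsto_iff_norm_sub_tendsto_zero.1 (tendsto_iter (ofReal_mem_strip hlam) hg)
  have h1 : Tendsto (fun l => 4 * ‖iter n d lam l - fixp n d lam‖ₑ) atTop (𝓝 0) := by
    have h2 := (ENNReal.continuous_ofReal.tendsto 0).comp h
    rw [ENNReal.ofReal_zero] at h2
    have h3 := ENNReal.Tendsto.const_mul (a := 4) h2 (Or.inr (by simp))
    rw [mul_zero] at h3
    refine h3.congr fun l => ?_
    rw [Function.comp_apply, ofReal_norm]
  refine tendsto_of_tendsto_of_tendsto_of_le_of_le tendsto_const_nhds h1 (fun _ => zero_le) ?_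
  intro l
  show atomDist (dotMuSeq (n + 1) d lam l) _ ≤ _
  rw [dotMuSeq_eq hlam hg]
  exact atomDist_nmeas_le _ _

/-- Two limits of the same sequence have distance zero by the triangle inequality through the
iterates. -/
lemma isDotMu_unique {μ : Measure ℝ} (h : IsDotMu (n + 1) d lam μ) : μ = nmeas (fixp n d lam) := by
  have h' := isDotMu_nmeas hlam hg
  refine eq_of_atomDist_eq_zero h.1 h'.1 ?_
  have h2 := h.2.add h'.2
  rw [add_zero] at h2
  refine le_antisymm (ge_of_tendsto' h2 fun l => ?_) zero_le
  rw [atomDist_comm _ μ]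
  exact atomDist_triangle _ _ _

lemma dotMu_eq : dotMu (n + 1) d lam = nmeas (fixp n d lam) :=
  isDotMu_unique hlam hg (Classical.epsilon_spec ⟨_, isDotMu_nmeas hlam hg⟩)

lemma hatMu_eq :
    hatMu (n + 1) d lam = reweight lam (meas (qq n (fixp n d lam))) sumf ratf := by
  rw [hatMu, dotMu_eq hlam hg, nmeas, clauseRec_msgMeas (pos_fixp hlam hg) n lam
    (ENNReal.inv_ne_zero.2 (msgMeas_univ_ne_top _)) (ENNReal.inv_ne_top.2 (msgMeas_univ_ne_zero _))]

end

end

end NaeSat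

namespace NaeSat

noncomputable section

set_option linter.unusedSectionVars false

variable {n d : ℕ} {p : SpE} {lam : ℝ}

/-! ### The normalizing constants -/

/-- The positive part of `1 - a - b`. -/
def vf (s : Clause) : ℝ := max 0 (1 - s.1.1 - s.1.2)

@[fun_prop]
lemma measurable_vf : Measurable vf := by unfold vf; fun_prop

lemma vf_nonneg (s : Clause) : 0 ≤ vf s := le_max_left _ _

lemma VV_fam (s : Clause) : powFam (fun s : Clause => 1 - (s.1.1 : ℝ) - s.1.2)
    (fun s => ind (0 < 1 - (s.1.1 : ℝ) - s.1.2)) lam s = ((tpow (vf s) lam : ℝ) : ℂ) := by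
  classical
  have h := cpow_mul_ind (lam := lam) (s := 1 - (s.1.1 : ℝ) - s.1.2)
    (P := 0 < 1 - (s.1.1 : ℝ) - s.1.2) id
  rw [powFam, h]
  split_ifs with h1
  · rw [vf, max_eq_right h1.le]
  · rw [vf, max_eq_left (not_lt.1 h1), tpow_zero]

section

variable (hlam : lam ∈ Icc (0 : ℝ) 1) {b : SpB} (hb : Pos b)
include hlam hb

lemma partFn_meas_vf : partFn lam (meas b) vf = ‖VV lam b‖ₑ := by
  have h1 := pd_V.powFam_bound (ofReal_mem_strip hlam)
  rw [funext VV_fam] at h1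
  have h2 := hb.lintegral h1 fun y => tpow_nonneg (vf_nonneg y)
  have h3 := hb.lift_eq_re h1
  have h4 := hb.re_nonneg h1 fun y => tpow_nonneg (vf_nonneg y)
  have e : VV lam b = L1.lift wB (fun y => ((tpow (vf y) lam : ℝ) : ℂ)) b := by
    rw [← funext VV_fam]; rfl
  rw [partFn, h2, e, ← ofReal_norm]
  nth_rewrite 2 [← h3]
  rw [Complex.norm_real, Real.norm_of_nonneg h4]

end

/-- The truncation in `vf` is inactive because the two products are at most x_0 and 1 - x_0. The
empty product would give the value -1. -/
lemma one_sub_agree {j : ℕ} (hj : j ≠ 0) (x : Fin j → unitInterval) :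
    1 - agree (fun i => (x i : ℝ)) = vf (∏ i, pt (x i)) := by
  obtain ⟨j, rfl⟩ := Nat.exists_eq_succ_of_ne_zero hj
  have h1 : ∏ i, (x i : ℝ) ≤ x 0 := by
    rw [Fin.prod_univ_succ]
    exact mul_le_of_le_one_right (x 0).2.1
      (Finset.prod_le_one (fun i _ => (x _).2.1) fun i _ => (x _).2.2)
  have h2 : ∏ i, (1 - (x i : ℝ)) ≤ 1 - x 0 := by
    rw [Fin.prod_univ_succ]
    exact mul_le_of_le_one_right (by linarith [(x 0).2.2])
      (Finset.prod_le_one (fun i _ => by linarith [(x i.succ).2.2])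
        fun i _ => by linarith [(x i.succ).2.1])
  rw [vf, clause_prod_fst, clause_prod_snd, agree, max_eq_right (by linarith)]
  ring

lemma measurable_pt_prod (j : ℕ) :
    Measurable fun x : Fin j → unitInterval => ∏ i, pt (x i) := by
  have := measurable_pt
  fun_prop

/-- The contribution of an edge, in terms of the pairs before normalization. -/
lemma edgeWt_eq (x : unitInterval) (t : Clause) :
    (x : ℝ) * (flipPt t).1 + (1 - x) * (flipPt t).2 = vf (pt x * t) := by
  have h1 : (0 : ℝ) ≤ x * (flipPt t).1 := mul_nonneg x.2.1 (flipPt t).1.2.1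
  have h2 : (0 : ℝ) ≤ (1 - x) * (flipPt t).2 := mul_nonneg (by linarith [x.2.2]) (flipPt t).2.2.1
  rw [flipPt_fst] at *
  rw [flipPt_snd] at *
  rw [vf, clause_mul_fst, clause_mul_snd, pt_fst, pt_snd, max_eq_right (by linarith)]
  ring

lemma edgeWt_ratf {y : Pair} (hy : sumf y ≠ 0) (x : ℝ) :
    edgeWt (x, ratf y) = (x * y.1 + (1 - x) * y.2) / sumf y := by
  rw [edgeWt, one_sub_ratf hy]
  show x * ((y.1 : ℝ) / sumf y) + _ = _
  ring

/-- The edge version of `prod_dens_mul`: an edge weight times the normalization of its clause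
message is the weight of the whole clause. -/
lemma dens_mul_edgeWt (x : unitInterval) (t : Clause) :
    dens lam (flipPt t) * ENNReal.ofReal (tpow (edgeWt ((x : ℝ), ratf (flipPt t))) lam)
      = ENNReal.ofReal (tpow (vf (pt x * t)) lam) := by
  rw [← edgeWt_eq]
  by_cases h : sumf (flipPt t) = 0
  · rw [fst_eq_zero_of_sumf h, snd_eq_zero_of_sumf h, dens, h]
    simp [tpow_zero]
  · have h0 := sumf_nonneg (flipPt t)
    have h1 : (0 : ℝ) ≤ x * (flipPt t).1 := mul_nonneg x.2.1 (flipPt t).1.2.1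
    have h2 : (0 : ℝ) ≤ (1 - x) * (flipPt t).2 := mul_nonneg (by linarith [x.2.2]) (flipPt t).2.2.1
    rw [edgeWt_ratf h, dens, ← ENNReal.ofReal_mul (tpow_nonneg h0),
      ← tpow_mul h0 (div_nonneg (add_nonneg h1 h2) h0), mul_div_cancel₀ _ h]

@[fun_prop]
lemma measurable_edgeWt : Measurable edgeWt := by unfold edgeWt; fun_prop

lemma measurable_edge : Measurable fun x : unitInterval × Clause => ((x.1 : ℝ), ratf (flipPt x.2)) := by
  have hmf := measurable_flipPt
  fun_prop

lemma measurable_dens_flip (lam : ℝ) :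
    Measurable fun x : unitInterval × Clause => dens lam (flipPt x.2) := by
  have hmf := measurable_flipPt
  fun_prop

lemma measurable_edgeWt_ratf :
    Measurable fun x : unitInterval × Clause => edgeWt ((x.1 : ℝ), ratf (flipPt x.2)) :=
  measurable_edgeWt.comp measurable_edge

section

variable (hlam : lam ∈ Icc (0 : ℝ) 1) (hg : Good n d)
include hlam hg

lemma fixp_qq_ne : partFn lam (meas (qq n (fixp n d lam))) sumf ≠ 0 ∧
    partFn lam (meas (qq n (fixp n d lam))) sumf ≠ ∞ :=
  partFn_qq_ne hlam hg (pos_fixp hlam hg) (symm_fixp (ofReal_mem_strip hlam) hg)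

lemma dotZ_eq : dotZ (n + 1) d lam = ‖UU lam (qq n (fixp n d lam))‖ₑ⁻¹ ^ d
    * ‖DD n d lam (fixp n d lam)‖ₑ := by
  obtain ⟨h0, h1⟩ := fixp_qq_ne hlam hg
  have hd : d ≠ 0 := by have := hg.pos; omega
  have hq := (pos_fixp hlam hg).qq n
  rw [dotZ, hatMu_eq hlam hg, partFn_iid_reweight hd h0 h1, hq.map_prod_pi,
    partFn_meas_sumf hlam hq, partFn_meas_sumf hlam (hq.pow d), DD]

/-- The law is kept on tuples of clause pairs before flipping and multiplication, since the
logarithm of the normalized weight is a sum over the individual clauses. -/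
lemma dotW_eq : dotW (n + 1) d lam = reweight lam
    (Measure.pi fun _ : Fin d => meas (full (fixp n d lam) ^ n))
    (fun t => sumf (∏ i, flipPt (t i))) fun t => agree fun i => ratf (flipPt (t i)) := by
  obtain ⟨h0, h1⟩ := fixp_qq_ne hlam hg
  have hd : d ≠ 0 := by have := hg.pos; omega
  have hc0 : ((partFn lam (meas (qq n (fixp n d lam))) sumf)⁻¹) ^ d ≠ 0 :=
    pow_ne_zero _ (ENNReal.inv_ne_zero.2 h1)
  have hc1 : ((partFn lam (meas (qq n (fixp n d lam))) sumf)⁻¹) ^ d ≠ ∞ :=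
    ENNReal.pow_ne_top (ENNReal.inv_ne_top.2 h0)
  have hm : meas (qq n (fixp n d lam)) = (meas (full (fixp n d lam) ^ n)).map flipPt :=
    ((pos_fixp hlam hg).full.pow n).meas_lift_delta measurable_flipPt flipL_bound
  have hpi : (Measure.pi fun _ : Fin d => meas (qq n (fixp n d lam)))
      = (Measure.pi fun _ : Fin d => meas (full (fixp n d lam) ^ n)).map fun t i => flipPt (t i) := by
    rw [hm, ← Measure.pi_map_pi fun _ => measurable_flipPt.aemeasurable]
  have hmf := measurable_flipPt
  rw [dotW, hatMu_eq hlam hg, iid_reweight _ h0 h1, reweight_smul hc0 hc1,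
    reweight_map (measurable_ratf_pi _) (measurable_agree _) (measurable_agree _),
    reweight_withDensity (measurable_prod_dens _ lam) (by fun_prop) (prod_dens_mul hd lam), hpi,
    reweight_map (by fun_prop) (by fun_prop) (by fun_prop)]

lemma hatZ_eq : hatZ (n + 1) d lam = (msgMeas (fixp n d lam) univ)⁻¹ ^ (n + 1)
    * ‖HH n lam (fixp n d lam)‖ₑ := by
  have hp := pos_fixp hlam hg
  have h1 := ENNReal.inv_ne_top.2 (msgMeas_univ_ne_zero (fixp n d lam))
  rw [hatZ, dotMu_eq hlam hg, nmeas, iid_smul _ _ _ h1, partFn_smul]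
  congr 1
  rw [msgMeas, iid_map _ _ measurable_subtype_coe,
    partFn_map (measurable_coe_pi _) (by fun_prop), HH,
    ← partFn_meas_vf hlam (hp.full.pow (n + 1)), ← map_prod_measI hp,
    partFn_map (measurable_pt_prod _) measurable_vf]
  simp only [one_sub_agree n.succ_ne_zero]

lemma hatW_eq : hatW (n + 1) d lam = reweight lam (meas (full (fixp n d lam) ^ (n + 1))) vf vf := by
  have hp := pos_fixp hlam hg
  have h1 := ENNReal.inv_ne_top.2 (msgMeas_univ_ne_zero (fixp n d lam))
  have h0 := ENNReal.inv_ne_zero.2 (msgMeas_univ_ne_top (fixp n d lam))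
  rw [hatW, dotMu_eq hlam hg, nmeas, iid_smul _ _ _ h1,
    reweight_smul (pow_ne_zero _ h0) (ENNReal.pow_ne_top h1), msgMeas,
    iid_map _ _ measurable_subtype_coe, reweight_map (measurable_coe_pi _) (by fun_prop) (by fun_prop),
    ← map_prod_measI hp, reweight_map (measurable_pt_prod _) measurable_vf measurable_vf]
  simp only [one_sub_agree n.succ_ne_zero]

lemma prod_dotMu_hatMu : (dotMu (n + 1) d lam).prod (hatMu (n + 1) d lam)
    = ((msgMeas (fixp n d lam) univ)⁻¹ * ‖UU lam (qq n (fixp n d lam))‖ₑ⁻¹) •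
      (((measI (fixp n d lam)).prod (meas (full (fixp n d lam) ^ n))).withDensity
        fun x => dens lam (flipPt x.2)).map fun x => ((x.1 : ℝ), ratf (flipPt x.2)) := by
  have hp := pos_fixp hlam hg
  have hq := hp.qq n
  have hmf := measurable_flipPt
  obtain ⟨h0, h1⟩ := fixp_qq_ne hlam hg
  have hm : meas (qq n (fixp n d lam)) = (meas (full (fixp n d lam) ^ n)).map flipPt :=
    (hp.full.pow n).meas_lift_delta measurable_flipPt flipL_bound
  have hmd : Measurable fun t => dens lam (flipPt t) := (measurable_dens lam).comp hmf
  have hr : Measurable fun t => ratf (flipPt t) := measurable_ratf.comp hmf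
  have hfin : IsFiniteMeasure
      ((meas (full (fixp n d lam) ^ n)).withDensity fun t => dens lam (flipPt t)) := by
    refine isFiniteMeasure_withDensity ?_
    rw [← lintegral_map (measurable_dens lam) hmf, ← hm]
    exact h1
  have e : hatMu (n + 1) d lam = ‖UU lam (qq n (fixp n d lam))‖ₑ⁻¹ •
      ((meas (full (fixp n d lam) ^ n)).withDensity fun t => dens lam (flipPt t)).map
        fun t => ratf (flipPt t) := by
    rw [hatMu_eq hlam hg, reweight, partFn_meas_sumf hlam hq, hm]
    congr 1
    rw [show (fun ω => ENNReal.ofReal (tpow (sumf ω) lam)) = dens lam from rfl,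
      map_withDensity hmf (measurable_dens lam), Measure.map_map measurable_ratf hmf]
    rfl
  rw [e, dotMu_eq hlam hg, nmeas, msgMeas, Measure.prod_smul_left, Measure.prod_smul_right, smul_smul,
    Measure.map_prod_map _ _ measurable_subtype_coe hr,
    prod_withDensity_right hmd]
  rfl

lemma map_mul_measI (b : SpB) (hb : Pos b) : ((measI (fixp n d lam)).prod (meas b)).map
    (fun x => pt x.1 * x.2) = meas (full (fixp n d lam) * b) := by
  have hp := pos_fixp hlam hg
  have hmp := measurable_pt
  rw [← hp.full.meas_mul hb, ← map_pt_measI hp]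
  nth_rewrite 2 [← Measure.map_id (μ := meas b)]
  rw [Measure.map_prod_map _ _ measurable_pt measurable_id,
    Measure.map_map measurable_mul (measurable_pt.prodMap measurable_id)]
  rfl

/-- An edge joins one variable message to the product of the n others in the clause. Before
normalization this is the full clause, so `HH` appears again. -/
lemma barZ_eq : barZ (n + 1) d lam = (msgMeas (fixp n d lam) univ)⁻¹
    * ‖UU lam (qq n (fixp n d lam))‖ₑ⁻¹ * ‖HH n lam (fixp n d lam)‖ₑ := by
  have hp := pos_fixp hlam hg
  have hmp := measurable_pt
  rw [barZ, prod_dotMu_hatMu hlam hg, partFn_smul,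
    partFn_map measurable_edge measurable_edgeWt,
    partFn_withDensity (measurable_dens_flip lam)
      measurable_edgeWt_ratf fun x => dens_mul_edgeWt x.1 x.2, HH,
    ← partFn_meas_vf hlam (hp.full.pow (n + 1)), pow_succ',
    ← map_mul_measI hlam hg _ (hp.full.pow n), partFn_map (by fun_prop) measurable_vf]

lemma barW_eq : barW (n + 1) d lam = reweight lam
    ((measI (fixp n d lam)).prod (meas (full (fixp n d lam) ^ n)))
    (fun x => vf (pt x.1 * x.2)) fun x => edgeWt ((x.1 : ℝ), ratf (flipPt x.2)) := by
  obtain ⟨h0, h1⟩ := fixp_qq_ne hlam hg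
  rw [partFn_meas_sumf hlam ((pos_fixp hlam hg).qq n)] at h0 h1
  have hc0 : (msgMeas (fixp n d lam) univ)⁻¹ * ‖UU lam (qq n (fixp n d lam))‖ₑ⁻¹ ≠ 0 :=
    mul_ne_zero (ENNReal.inv_ne_zero.2 (msgMeas_univ_ne_top _)) (ENNReal.inv_ne_zero.2 h1)
  have hc1 : (msgMeas (fixp n d lam) univ)⁻¹ * ‖UU lam (qq n (fixp n d lam))‖ₑ⁻¹ ≠ ∞ :=
    ENNReal.mul_ne_top (ENNReal.inv_ne_top.2 (msgMeas_univ_ne_zero _)) (ENNReal.inv_ne_top.2 h0)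
  rw [barW, prod_dotMu_hatMu hlam hg, reweight_smul hc0 hc1,
    reweight_map measurable_edge measurable_edgeWt measurable_edgeWt,
    reweight_withDensity (measurable_dens_flip lam)
      measurable_edgeWt_ratf fun x => dens_mul_edgeWt x.1 x.2]

end

end

end NaeSat

namespace NaeSat

noncomputable section

set_option linter.unusedSectionVars false

variable {n d : ℕ} {p : SpE} {lam : ℝ}

/-! ### Integrals of the logarithm -/

/-- Only the product of the tilt with the logarithm matters, so `log G` may be rewritten freely
where W vanishes. This is how the splittings `log_edgeWt` and `log_agree` become exact everywhere.
-/
lemma log_reweight {Ω : Type} [MeasurableSpace Ω] {P : Measure Ω} {W G F : Ω → ℝ}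
    (hW : Measurable W) (hG : Measurable G) (hW0 : ∀ ω, 0 ≤ W ω) (h0 : partFn lam P W ≠ 0)
    (hF : ∀ ω, tpow (W ω) lam * Real.log (G ω) = F ω) (hI : Integrable F P) :
    Integrable Real.log (reweight lam P W G) ∧
      ∫ x, Real.log x ∂reweight lam P W G = (partFn lam P W)⁻¹.toReal * ∫ ω, F ω ∂P := by
  have hm : Measurable fun ω => Real.toNNReal (tpow (W ω) lam) := by fun_prop
  have e : (fun ω => ENNReal.ofReal (tpow (W ω) lam))
      = fun ω => ((Real.toNNReal (tpow (W ω) lam) : NNReal) : ℝ≥0∞) := rfl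
  have e2 : (fun ω => Real.toNNReal (tpow (W ω) lam) • Real.log (G ω)) = F := funext fun ω => by
    rw [NNReal.smul_def, Real.coe_toNNReal _ (tpow_nonneg (hW0 ω)), smul_eq_mul, hF]
  constructor
  · rw [reweight]
    refine Integrable.smul_measure ?_ (ENNReal.inv_ne_top.2 h0)
    rw [integrable_map_measure Real.measurable_log.aestronglyMeasurable hG.aemeasurable, e,
      integrable_withDensity_iff_integrable_smul hm]
    simp only [Function.comp_apply]
    rwa [e2]
  · rw [reweight, integral_smul_measure, smul_eq_mul,
      integral_map hG.aemeasurable Real.measurable_log.aestronglyMeasurable, e,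
      integral_withDensity_eq_integral_smul hm, e2]

lemma integral_of_lintegral {Ω : Type} [MeasurableSpace Ω] {P : Measure Ω} {F : Ω → ℝ}
    (hm : Measurable F) (hF : ∀ ω, 0 ≤ F ω) {c : ℂ} (h : ∫⁻ ω, ENNReal.ofReal (F ω) ∂P = ‖c‖ₑ) :
    Integrable F P ∧ ∫ ω, F ω ∂P = ‖c‖ := by
  constructor
  · rw [← lintegral_ofReal_ne_top_iff_integrable hm.aestronglyMeasurable (ae_of_all _ hF), h]
    exact enorm_ne_top
  · rw [integral_eq_lintegral_of_nonneg_ae (ae_of_all _ hF) hm.aestronglyMeasurable, h, toReal_enorm]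

/-- The logarithm of the normalization of a clause message. -/
def lg (t : Clause) : ℝ := Real.log (sumf (flipPt t))

lemma measurable_lg : Measurable lg := by
  have := measurable_flipPt
  unfold lg
  fun_prop

lemma lg_mem (t : Clause) : lg t ∈ Icc (0 : ℝ) 1 := by
  have e : sumf (flipPt t) = 2 - (t.1.1 : ℝ) - t.1.2 := by
    rw [sumf, flipPt_fst, flipPt_snd]; ring
  have h1 := t.1.1.2.1
  have h2 := t.1.2.2.1
  rw [lg, e]
  rcases t.2 with h | h
  · have h' : (t.1.1 : ℝ) + t.1.2 ≤ 1 := h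
    refine ⟨Real.log_nonneg (by linarith), ?_⟩
    refine (Real.log_le_sub_one_of_pos (by linarith)).trans (by linarith)
  -- At the unit (1, 1) the sum is zero, and the value log 0 = 0 keeps `lg` in [0, 1].
  · have a1 : (t.1.1 : ℝ) = 1 := by rw [h]; rfl
    have a2 : (t.1.2 : ℝ) = 1 := by rw [h]; rfl
    rw [a1, a2]
    norm_num

/-- Multiplication of the coefficients by `lg`. -/
def Dg : SpB →L[ℂ] SpB := L1.lift wB fun t => ((lg t : ℝ) : ℂ) • L1.delta wB t

lemma Dg_bound (t : Clause) : ‖((lg t : ℝ) : ℂ) • L1.delta wB t‖ ≤ 1 * wB t := by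
  obtain ⟨h0, h1⟩ := lg_mem t
  rw [norm_smul, L1.norm_delta, Complex.norm_real, Real.norm_of_nonneg h0]
  exact mul_le_mul_of_nonneg_right h1 (wB.pos t).le

lemma Pos.Dg {b : SpB} (hb : Pos b) : Pos (Dg b) :=
  Pos.lift Dg_bound (fun t => (Pos.delta t).smul (by
    rw [Complex.norm_real, Real.norm_of_nonneg (lg_mem t).1])) hb

lemma coef_Dg (b : SpB) (t : Clause) : L1.coef t (Dg b) = (lg t : ℂ) * L1.coef t b := by
  classical
  have h : ∀ t b, L1.coef t b = (L1.lift wB fun j => if j = t then (1 : ℂ) else 0) b :=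
    fun t b => by rw [L1.coef_eq_lift]; congr!
  have : (L1.lift wB fun j => if j = t then (1 : ℂ) else 0) ∘L Dg
      = (lg t : ℂ) • L1.lift wB fun j => if j = t then (1 : ℂ) else 0 := by
    refine L1.clm_ext fun s => ?_
    rw [ContinuousLinearMap.comp_apply, smul_apply, Dg, L1.lift_delta Dg_bound, map_smul, ← h,
      L1.coef_delta]
    split_ifs with hs
    · rw [hs]
    · simp
  rw [h, h]
  exact congrArg (fun f => f b) this

lemma meas_Dg (b : SpB) : meas (Dg b) = (meas b).withDensity fun t => ENNReal.ofReal (lg t) := by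
  ext s hs
  rw [withDensity_apply _ hs, ← lintegral_indicator hs, ← lintegral_indicator_one hs,
    lintegral_meas, lintegral_meas]
  refine tsum_congr fun t => ?_
  rw [coef_Dg, enorm_mul]
  have : ‖(lg t : ℂ)‖ₑ = ENNReal.ofReal (lg t) := by
    rw [← ofReal_norm, Complex.norm_real, Real.norm_of_nonneg (lg_mem t).1]
  rw [this]
  by_cases h : t ∈ s
  · rw [indicator_of_mem h, indicator_of_mem h, Pi.one_apply, mul_one, mul_comm]
  · rw [indicator_of_notMem h, indicator_of_notMem h, mul_zero, mul_zero]

lemma VVlog_fam (s : Clause) : logFam (fun s : Clause => 1 - (s.1.1 : ℝ) - s.1.2)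
    (fun s => ind (0 < 1 - (s.1.1 : ℝ) - s.1.2)) lam s
      = ((tpow (vf s) lam * Real.log (vf s) : ℝ) : ℂ) := by
  have h := VV_fam (lam := lam) s
  by_cases h1 : 0 < 1 - (s.1.1 : ℝ) - s.1.2
  · rw [powFam] at h
    rw [logFam, smul_eq_mul, mul_right_comm, ← smul_eq_mul (_ ^ _), h, ← Complex.ofReal_mul, vf,
      max_eq_right h1.le]
  · rw [logFam, ind_false h1, smul_zero, vf, max_eq_left (not_lt.1 h1), tpow_zero, zero_mul,
      Complex.ofReal_zero]

lemma UUlog_fam (y : Pair) : logFam (fun y : Pair => (y.1 : ℝ) + y.2)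
    (fun y => ind (0 < (y.1 : ℝ) + y.2)) lam y
      = ((tpow (sumf y) lam * Real.log (sumf y) : ℝ) : ℂ) := by
  have h := UU_fam (lam := lam) y
  rw [powFam] at h
  rw [logFam, smul_eq_mul, mul_right_comm, ← smul_eq_mul (_ ^ _), h, ← Complex.ofReal_mul]
  rfl

section

variable (hlam : lam ∈ Icc (0 : ℝ) 1)
include hlam

lemma integral_VVlog {b : SpB} (hb : Pos b) :
    Integrable (fun s => tpow (vf s) lam * Real.log (vf s)) (meas b) ∧
      ∫ s, tpow (vf s) lam * Real.log (vf s) ∂meas b = (VVlog lam b).re := by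
  have h := pd_V.logFam_bound (ofReal_mem_strip hlam)
  rw [funext VVlog_fam] at h
  have hm : Measurable fun s => tpow (vf s) lam * Real.log (vf s) :=
    ((measurable_tpow lam).comp measurable_vf).mul (Real.measurable_log.comp measurable_vf)
  refine ⟨integrable_meas b hm h, ?_⟩
  rw [hb.integral hm h, ← funext VVlog_fam]
  rfl

lemma integral_UUlog {a : SpA} (ha : Pos a) :
    Integrable (fun y => tpow (sumf y) lam * Real.log (sumf y)) (meas a) ∧
      ∫ y, tpow (sumf y) lam * Real.log (sumf y) ∂meas a = (UUlog lam a).re := by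
  have h := pd_U.logFam_bound (ofReal_mem_strip hlam)
  rw [funext UUlog_fam] at h
  have hm : Measurable fun y => tpow (sumf y) lam * Real.log (sumf y) :=
    ((measurable_tpow lam).comp measurable_sumf).mul (Real.measurable_log.comp measurable_sumf)
  refine ⟨integrable_meas a hm h, ?_⟩
  rw [ha.integral hm h, ← funext UUlog_fam]
  rfl

variable (hg : Good n d)
include hg

lemma HH_fixp_ne_zero : HH n lam (fixp n d lam) ≠ 0 :=
  HH_ne_zero (ofReal_mem_strip hlam) hg (symm_fixp (ofReal_mem_strip hlam) hg)
    (norm_fixp_le_rad (ofReal_mem_strip hlam) hg)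

lemma DD_fixp_ne_zero : DD n d lam (fixp n d lam) ≠ 0 :=
  DD_ne_zero (ofReal_mem_strip hlam) hg (symm_fixp (ofReal_mem_strip hlam) hg)
    (norm_fixp_le (ofReal_mem_strip hlam) hg)

lemma log_hatW : Integrable Real.log (hatW (n + 1) d lam) ∧
    ∫ x, Real.log x ∂hatW (n + 1) d lam
      = (VVlog lam (full (fixp n d lam) ^ (n + 1))).re / ‖HH n lam (fixp n d lam)‖ := by
  have hb := (pos_fixp hlam hg).full.pow (n + 1)
  obtain ⟨hI, hv⟩ := integral_VVlog hlam hb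
  have hZ := partFn_meas_vf hlam hb
  rw [← HH] at hZ
  have h0 : partFn lam (meas (full (fixp n d lam) ^ (n + 1))) vf ≠ 0 := by
    rw [hZ, enorm_ne_zero]; exact HH_fixp_ne_zero hlam hg
  obtain ⟨r1, r2⟩ := log_reweight measurable_vf measurable_vf vf_nonneg h0 (fun _ => rfl) hI
  rw [hatW_eq hlam hg]
  refine ⟨r1, ?_⟩
  rw [r2, hZ, hv, ENNReal.toReal_inv, toReal_enorm, div_eq_inv_mul]

lemma lintegral_bar {b : SpB} (hb : Pos b) :
    ∫⁻ x : unitInterval × Clause, ENNReal.ofReal (tpow (vf (pt x.1 * x.2)) lam * lg x.2)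
      ∂((measI (fixp n d lam)).prod (meas b)) = ‖VV lam (full (fixp n d lam) * Dg b)‖ₑ := by
  have hmp := measurable_pt
  have hml : Measurable fun t => ENNReal.ofReal (lg t) := measurable_lg.ennreal_ofReal
  have hml' : Measurable fun x : unitInterval × Clause => ENNReal.ofReal (lg x.2) :=
    hml.comp measurable_snd
  have hmt : Measurable fun x : unitInterval × Clause =>
    ENNReal.ofReal (tpow (vf (pt x.1 * x.2)) lam) := by fun_prop
  have hfin : IsFiniteMeasure ((meas b).withDensity fun t => ENNReal.ofReal (lg t)) := by
    rw [← meas_Dg]; infer_instance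
  rw [← partFn_meas_vf hlam ((pos_fixp hlam hg).full.mul hb.Dg), ← map_mul_measI hlam hg _ hb.Dg,
    partFn_map (by fun_prop) measurable_vf, meas_Dg, prod_withDensity_right hml, partFn,
    lintegral_withDensity_eq_lintegral_mul _ hml' hmt]
  refine lintegral_congr fun x => ?_
  rw [Pi.mul_apply, mul_comm (ENNReal.ofReal (lg _)), ← ENNReal.ofReal_mul (tpow_nonneg (vf_nonneg _))]

lemma log_edgeWt (x : unitInterval) (t : Clause) :
    tpow (vf (pt x * t)) lam * Real.log (edgeWt ((x : ℝ), ratf (flipPt t)))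
      = tpow (vf (pt x * t)) lam * Real.log (vf (pt x * t)) - tpow (vf (pt x * t)) lam * lg t := by
  by_cases hv : vf (pt x * t) = 0
  · rw [hv, tpow_zero]; ring
  · have hs : sumf (flipPt t) ≠ 0 := fun h => by
      rw [← edgeWt_eq, fst_eq_zero_of_sumf h, snd_eq_zero_of_sumf h] at hv
      simp at hv
    rw [edgeWt_ratf hs, edgeWt_eq, Real.log_div hv hs, lg]
    ring

/-- The logarithm of the edge weight is that of the clause weight minus `lg` of the clause message.
Inserting `lg` into an expectation amounts to applying `Dg` to the corresponding factor. -/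
lemma log_barW : Integrable Real.log (barW (n + 1) d lam) ∧
    ∫ x, Real.log x ∂barW (n + 1) d lam
      = ((VVlog lam (full (fixp n d lam) ^ (n + 1))).re
        - ‖VV lam (full (fixp n d lam) * Dg (full (fixp n d lam) ^ n))‖)
          / ‖HH n lam (fixp n d lam)‖ := by
  have hb := (pos_fixp hlam hg).full.pow n
  have hmp := measurable_pt
  have hml := measurable_lg
  have hmm : Measurable fun x : unitInterval × Clause => pt x.1 * x.2 := by fun_prop
  have hmap := map_mul_measI hlam hg _ hb
  rw [← pow_succ'] at hmap
  obtain ⟨hI, hv⟩ := integral_VVlog hlam ((pos_fixp hlam hg).full.pow (n + 1))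
  have hZ := partFn_meas_vf hlam ((pos_fixp hlam hg).full.pow (n + 1))
  have hms : Measurable fun s => tpow (vf s) lam * Real.log (vf s) :=
    ((measurable_tpow lam).comp measurable_vf).mul (Real.measurable_log.comp measurable_vf)
  rw [← HH, ← hmap, partFn_map hmm measurable_vf] at hZ
  rw [← hmap, integrable_map_measure hms.aestronglyMeasurable hmm.aemeasurable,
    Function.comp_def] at hI
  rw [← hmap, integral_map hmm.aemeasurable hms.aestronglyMeasurable] at hv
  obtain ⟨hI2, hv2⟩ := integral_of_lintegral (by fun_prop)
    (fun x => mul_nonneg (tpow_nonneg (vf_nonneg _)) (lg_mem _).1) (lintegral_bar hlam hg hb)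
  have h0 : partFn lam ((measI (fixp n d lam)).prod (meas (full (fixp n d lam) ^ n)))
      (fun x => vf (pt x.1 * x.2)) ≠ 0 := by
    rw [hZ, enorm_ne_zero]; exact HH_fixp_ne_zero hlam hg
  obtain ⟨r1, r2⟩ := log_reweight (by fun_prop) measurable_edgeWt_ratf (fun x => vf_nonneg _) h0
    (fun x => log_edgeWt hlam hg x.1 x.2) (hI.sub hI2)
  rw [barW_eq hlam hg]
  refine ⟨r1, ?_⟩
  rw [r2, hZ, integral_sub hI hI2, hv, hv2, ENNReal.toReal_inv, toReal_enorm, div_eq_inv_mul]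

/-- Coordinate i is separated from the others and its factor tilted by `lg`. The result does not
depend on i, which produces the factor d in `log_dotW`. -/
lemma lintegral_dot {b : SpB} (hb : Pos b) (N : ℕ) (i : Fin (N + 1)) :
    ∫⁻ t, ENNReal.ofReal (tpow (sumf (∏ j, flipPt (t j))) lam * lg (t i))
      ∂(Measure.pi fun _ : Fin (N + 1) => meas b) = ‖UU lam (flipL (Dg b) * flipL b ^ N)‖ₑ := by
  have hmf := measurable_flipPt
  have hfb : Pos (flipL b) := Pos.lift flipL_bound (fun _ => Pos.delta _) hb
  have hfD : Pos (flipL (Dg b)) := Pos.lift flipL_bound (fun _ => Pos.delta _) hb.Dg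
  have hml : Measurable fun t => ENNReal.ofReal (lg t) := measurable_lg.ennreal_ofReal
  have hml' : Measurable fun x : Clause × (Fin N → Clause) => ENNReal.ofReal (lg x.1) :=
    hml.comp measurable_fst
  have hmt : Measurable fun x : Clause × (Fin N → Clause) =>
    ENNReal.ofReal (tpow (sumf (flipPt x.1 * ∏ j, flipPt (x.2 j))) lam) := by fun_prop
  have hfin : IsFiniteMeasure ((meas b).withDensity fun t => ENNReal.ofReal (lg t)) := by
    rw [← meas_Dg]; infer_instance
  have hD : meas (flipL (Dg b)) = (meas (Dg b)).map flipPt :=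
    hb.Dg.meas_lift_delta measurable_flipPt flipL_bound
  have hB : meas (flipL b) = (meas b).map flipPt := hb.meas_lift_delta measurable_flipPt flipL_bound
  have hpi : meas (flipL b ^ N)
      = (Measure.pi fun _ : Fin N => meas b).map fun t => ∏ j, flipPt (t j) := by
    rw [← hfb.map_prod_pi N, hB, ← Measure.pi_map_pi fun _ => measurable_flipPt.aemeasurable,
      Measure.map_map (by fun_prop) (by fun_prop)]
    rfl
  have hprod : ((meas (Dg b)).prod (Measure.pi fun _ : Fin N => meas b)).map
      (fun x => flipPt x.1 * ∏ j, flipPt (x.2 j)) = meas (flipL (Dg b) * flipL b ^ N) := by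
    have hp1 : Measurable fun t : Fin N → Clause => ∏ j, flipPt (t j) := by fun_prop
    rw [← hfD.meas_mul (hfb.pow N), hD, hpi, Measure.map_prod_map _ _ measurable_flipPt hp1,
      Measure.map_map measurable_mul (measurable_flipPt.prodMap hp1)]
    rfl
  rw [← partFn_meas_sumf hlam (hfD.mul (hfb.pow N)), ← hprod, partFn_map (by fun_prop) measurable_sumf,
    meas_Dg, prod_withDensity_left hml, partFn, lintegral_withDensity_eq_lintegral_mul _ hml' hmt]
  have hmx : Measurable fun x : Clause × (Fin N → Clause) => ENNReal.ofReal (lg x.1)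
      * ENNReal.ofReal (tpow (sumf (flipPt x.1 * ∏ j, flipPt (x.2 j))) lam) := hml'.mul hmt
  have h := map_insertNth b N i hmx
  have e1 := congrArg (fun m : Measure ℝ≥0∞ => ∫⁻ x, x ∂m) h
  simp only at e1
  have hmm : Measurable fun x : Fin (N + 1) → Clause => ENNReal.ofReal (lg (x i))
      * ENNReal.ofReal (tpow (sumf (flipPt (x i) * ∏ j, flipPt (x (i.succAbove j)))) lam) := by
    have := measurable_lg
    fun_prop
  rw [lintegral_map (f := fun x => x) measurable_id' hmm,
    lintegral_map (f := fun x => x) measurable_id' hmx] at e1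
  simp only [Pi.mul_apply]
  rw [← e1]
  refine lintegral_congr fun t => ?_
  rw [mul_comm (ENNReal.ofReal (lg _)), ← ENNReal.ofReal_mul (tpow_nonneg (sumf_nonneg _)),
    Fin.prod_univ_succAbove _ i]

lemma log_agree (t : Fin d → Clause) :
    tpow (sumf (∏ i, flipPt (t i))) lam * Real.log (agree fun i => ratf (flipPt (t i)))
      = tpow (sumf (∏ i, flipPt (t i))) lam * Real.log (sumf (∏ i, flipPt (t i)))
        - ∑ i, tpow (sumf (∏ i, flipPt (t i))) lam * lg (t i) := by
  by_cases hv : sumf (∏ i, flipPt (t i)) = 0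
  · rw [hv, tpow_zero]; simp
  · have hs : ∀ i, sumf (flipPt (t i)) ≠ 0 := fun i h =>
      hv (sumf_prod_eq_zero (y := fun i => flipPt (t i)) h)
    rw [agree_ratf hs, Real.log_div hv (Finset.prod_ne_zero_iff.2 fun i _ => hs i),
      Real.log_prod fun i _ => hs i, ← Finset.mul_sum, mul_sub]
    rfl

lemma log_dotW : Integrable Real.log (dotW (n + 1) d lam) ∧
    ∫ x, Real.log x ∂dotW (n + 1) d lam
      = ((UUlog lam (qq n (fixp n d lam) ^ d)).re
        - d * ‖UU lam (qq n (fixp n d lam) ^ (d - 1) * flipL (Dg (full (fixp n d lam) ^ n)))‖)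
          / ‖DD n d lam (fixp n d lam)‖ := by
  obtain ⟨N, rfl⟩ : ∃ N, d = N + 1 := ⟨d - 1, by have := hg.pos; omega⟩
  have hp := pos_fixp hlam hg
  have hb := hp.full.pow n
  have hq := hp.qq n
  have hmf := measurable_flipPt
  have hml := measurable_lg
  set P := fixp n (N + 1) lam
  have hmm : Measurable fun t : Fin (N + 1) → Clause => ∏ i, flipPt (t i) := by fun_prop
  have hB : meas (qq n P) = (meas (full P ^ n)).map flipPt :=
    hb.meas_lift_delta measurable_flipPt flipL_bound
  have hmap : (Measure.pi fun _ : Fin (N + 1) => meas (full P ^ n)).map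
      (fun t => ∏ j, flipPt (t j)) = meas (qq n P ^ (N + 1)) := by
    rw [← hq.map_prod_pi, hB, ← Measure.pi_map_pi fun _ => measurable_flipPt.aemeasurable,
      Measure.map_map (by fun_prop) (by fun_prop)]
    rfl
  obtain ⟨hI, hv⟩ := integral_UUlog hlam (hq.pow (N + 1))
  have hZ := partFn_meas_sumf hlam (hq.pow (N + 1))
  have hms : Measurable fun y => tpow (sumf y) lam * Real.log (sumf y) :=
    ((measurable_tpow lam).comp measurable_sumf).mul (Real.measurable_log.comp measurable_sumf)
  rw [← hmap, partFn_map hmm measurable_sumf] at hZ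
  rw [← hmap, integrable_map_measure hms.aestronglyMeasurable hmm.aemeasurable,
    Function.comp_def] at hI
  rw [← hmap, integral_map hmm.aemeasurable hms.aestronglyMeasurable] at hv
  have h2 := fun i => integral_of_lintegral (by fun_prop)
    (fun t => mul_nonneg (tpow_nonneg (sumf_nonneg _)) (lg_mem _).1)
    (lintegral_dot hlam hg hb N i)
  have h0 : partFn lam (Measure.pi fun _ : Fin (N + 1) => meas (full P ^ n))
      (fun t => sumf (∏ i, flipPt (t i))) ≠ 0 := by
    rw [hZ, enorm_ne_zero]; exact DD_fixp_ne_zero hlam hg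
  have hS := integrable_finsetSum Finset.univ fun i _ => (h2 i).1
  obtain ⟨r1, r2⟩ := log_reweight (by fun_prop) (by fun_prop) (fun x => sumf_nonneg _) h0
    (log_agree hlam hg) (hI.sub hS)
  rw [dotW_eq hlam hg]
  refine ⟨r1, ?_⟩
  rw [r2, hZ, integral_sub hI hS, hv, integral_finsetSum _ fun i _ => (h2 i).1,
    ENNReal.toReal_inv, toReal_enorm, div_eq_inv_mul]
  simp only [fun i => (h2 i).2]
  rw [Finset.sum_const, Finset.card_univ, Fintype.card_fin, nsmul_eq_mul, Nat.add_sub_cancel,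
    mul_comm (qq n P ^ N)]
  rfl

end

end

end NaeSat

namespace NaeSat

noncomputable section

set_option linter.unusedSectionVars false

variable {n d : ℕ} {p : SpE} {lam : ℝ}

/-! ### The parameters of the complexity function -/

lemma Pos.VV {b : SpB} (hlam : lam ∈ Icc (0 : ℝ) 1) (hb : Pos b) :
    ((‖VV lam b‖ : ℝ) : ℂ) = VV lam b := by
  have h1 := pd_V.powFam_bound (ofReal_mem_strip hlam)
  rw [funext VV_fam] at h1
  have h3 := hb.lift_eq_re h1
  have h4 := hb.re_nonneg h1 fun y => tpow_nonneg (vf_nonneg y)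
  have e : NaeSat.VV lam b = L1.lift wB (fun y => ((tpow (vf y) lam : ℝ) : ℂ)) b := by
    rw [← funext VV_fam]; rfl
  rw [e, ← h3, Complex.norm_real, Real.norm_of_nonneg h4]

lemma density_succ (n d : ℕ) : density (n + 1) d = d / (n + 1) := by
  rw [density]; push_cast; rfl

lemma natCast_mul_density (n d : ℕ) : ((n + 1 : ℕ) : ℝ) * density (n + 1) d = d := by
  rw [density_succ]; push_cast; field_simp

section

variable (hlam : lam ∈ Icc (0 : ℝ) 1) (hg : Good n d)
include hlam hg

lemma UU_qq_fixp_ne_zero : UU lam (qq n (fixp n d lam)) ≠ 0 := by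
  have h := (fixp_qq_ne hlam hg).1
  rwa [partFn_meas_sumf hlam ((pos_fixp hlam hg).qq n), enorm_ne_zero] at h

theorem paramsDefined : ParamsDefined (n + 1) d lam := by
  have hU := UU_qq_fixp_ne_zero hlam hg
  have hH := HH_fixp_ne_zero hlam hg
  have hD := DD_fixp_ne_zero hlam hg
  have hM0 := ENNReal.inv_ne_zero.2 (msgMeas_univ_ne_top (fixp n d lam))
  have hM1 := ENNReal.inv_ne_top.2 (msgMeas_univ_ne_zero (fixp n d lam))
  have hU0 : ‖UU lam (qq n (fixp n d lam))‖ₑ⁻¹ ≠ 0 := ENNReal.inv_ne_zero.2 enorm_ne_top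
  have hU1 : ‖UU lam (qq n (fixp n d lam))‖ₑ⁻¹ ≠ ∞ := ENNReal.inv_ne_top.2 (enorm_ne_zero.2 hU)
  refine ⟨fun l => ?_, ⟨_, isDotMu_nmeas hlam hg, fun μ h => isDotMu_unique hlam hg h⟩, ?_, ?_, ?_, ?_,
    (log_dotW hlam hg).1, (log_hatW hlam hg).1, (log_barW hlam hg).1⟩
  · rw [dotMuSeq_eq hlam hg]; exact isDiscreteProb_nmeas _
  · rw [hatMu_eq hlam hg]
    exact isDiscreteProb_reweight (fixp_qq_ne hlam hg).1 (fixp_qq_ne hlam hg).2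
  · rw [dotZ_eq hlam hg]
    exact ⟨ENNReal.mul_pos (pow_ne_zero _ hU0) (enorm_ne_zero.2 hD),
      ENNReal.mul_lt_top (ENNReal.pow_lt_top hU1.lt_top) enorm_lt_top⟩
  · rw [hatZ_eq hlam hg]
    exact ⟨ENNReal.mul_pos (pow_ne_zero _ hM0) (enorm_ne_zero.2 hH),
      ENNReal.mul_lt_top (ENNReal.pow_lt_top hM1.lt_top) enorm_lt_top⟩
  · rw [barZ_eq hlam hg]
    exact ⟨ENNReal.mul_pos (mul_ne_zero hM0 hU0) (enorm_ne_zero.2 hH),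
      ENNReal.mul_lt_top (ENNReal.mul_lt_top hM1.lt_top hU1.lt_top) enorm_lt_top⟩

/-- The message normalizations occur with total exponent zero: the d clause messages at a variable,
and the d variable messages counted through α(n+1) = d, are both compensated by the d edges. The
edges also carry d copies of `HH`. -/
lemma bigF_eq_log : bigF (n + 1) d lam = Real.log ‖DD n d lam (fixp n d lam)‖
    - d * n / (n + 1) * Real.log ‖HH n lam (fixp n d lam)‖ := by
  have hU := norm_ne_zero_iff.2 (UU_qq_fixp_ne_zero hlam hg)
  have hH := norm_ne_zero_iff.2 (HH_fixp_ne_zero hlam hg)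
  have hD := norm_ne_zero_iff.2 (DD_fixp_ne_zero hlam hg)
  have hM : (msgMeas (fixp n d lam) univ).toReal ≠ 0 :=
    ENNReal.toReal_ne_zero.2 ⟨msgMeas_univ_ne_zero _, msgMeas_univ_ne_top _⟩
  rw [bigF, natCast_mul_density, density_succ, dotZ_eq hlam hg, hatZ_eq hlam hg, barZ_eq hlam hg]
  simp only [ENNReal.toReal_mul, ENNReal.toReal_pow, ENNReal.toReal_inv, toReal_enorm]
  rw [Real.log_mul (pow_ne_zero _ (inv_ne_zero hU)) hD, Real.log_mul (pow_ne_zero _ (inv_ne_zero hM)) hH,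
    Real.log_mul (mul_ne_zero (inv_ne_zero hM) (inv_ne_zero hU)) hH,
    Real.log_mul (inv_ne_zero hM) (inv_ne_zero hU), Real.log_pow, Real.log_pow, Real.log_inv,
    Real.log_inv]
  push_cast
  field_simp
  ring

/-- The normalizers in `nu1`, `nu2` and `xx` cancel in `Fc`; they only keep the complex logarithms
near 1. -/
theorem bigF_eq : bigF (n + 1) d lam = (Fc n d lam (fixp n d lam)).re := by
  have hz := ofReal_mem_strip hlam
  have hp' := norm_fixp_le_rad hz hg
  have hH := norm_ne_zero_iff.2 (HH_fixp_ne_zero hlam hg)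
  have hD := norm_ne_zero_iff.2 (DD_fixp_ne_zero hlam hg)
  have hm := norm_ne_zero_iff.2 (mm_add_one_ne_zero hz hg hp')
  have ht := norm_ne_zero_iff.2 (two_add_mass_ne_zero hg hp')
  have hh1 : (0 : ℝ) < 1 - hh n := by have := hg.h_le; linarith
  rw [bigF_eq_log hlam hg, Fc, ← Complex.ofReal_natCast d]
  simp only [Complex.add_re, Complex.sub_re, Complex.ofReal_re, Complex.re_ofReal_mul,
    Complex.log_re, nu1, nu2, xx, norm_div, norm_mul, norm_pow,
    Complex.norm_real, Complex.norm_ofNat]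
  rw [Real.norm_of_nonneg hh1.le, Real.log_div hm (mul_ne_zero (pow_ne_zero _ ht) hh1.ne'),
    Real.log_div hH (mul_ne_zero (pow_ne_zero _ ht) hh1.ne'),
    Real.log_div hD (mul_ne_zero two_ne_zero (pow_ne_zero _ hm)),
    Real.log_mul (pow_ne_zero _ ht) hh1.ne', Real.log_mul (pow_ne_zero _ ht) hh1.ne',
    Real.log_mul two_ne_zero (pow_ne_zero _ hm), Real.log_pow, Real.log_pow, Real.log_pow]
  push_cast
  field_simp
  ring

/-- The `lg` corrections of the variable and edge terms cancel: by `UU_qq_pow_mul_flipL` the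
variable correction is `kap` times the edge correction, and by `DD_eq_kap_mul` their denominators
have the same ratio. -/
theorem sParam_eq : sParam (n + 1) d lam = (Sc n d lam (fixp n d lam)).re := by
  have hz := ofReal_mem_strip hlam
  have hn : n ≠ 0 := by have := hg.three; omega
  have hp' := norm_fixp_le_rad hz hg
  have hpos := pos_fixp hlam hg
  have hH0 := HH_fixp_ne_zero hlam hg
  have hsy := symm_fixp hz hg
  have hT := TT_fixp hz hg
  have hk := kap_ne_zero hz hg hp'
  have hH : ((‖HH n lam (fixp n d lam)‖ : ℝ) : ℂ) = HH n lam (fixp n d lam) :=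
    Pos.VV hlam (hpos.full.pow (n + 1))
  have hD : ((‖DD n d lam (fixp n d lam)‖ : ℝ) : ℂ) = DD n d lam (fixp n d lam) :=
    Pos.UU hlam ((hpos.qq n).pow d)
  have hE := UU_qq_pow_mul_flipL hz hn hsy hk hT (Dg (full (fixp n d lam) ^ n))
  have hDk := DD_eq_kap_mul hz hn hg.pos hsy hk hT
  have hS : (Sc n d lam (fixp n d lam)).re
      = (UUlog lam (qq n (fixp n d lam) ^ d)).re / ‖DD n d lam (fixp n d lam)‖
        - d * n / (n + 1) * ((VVlog lam (full (fixp n d lam) ^ (n + 1))).re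
          / ‖HH n lam (fixp n d lam)‖) := by
    rw [Sc, Complex.sub_re, Complex.re_ofReal_mul, ← Complex.div_ofReal_re, ← Complex.div_ofReal_re,
      hH, hD]
  rw [sParam, natCast_mul_density, density_succ, (log_dotW hlam hg).2, (log_hatW hlam hg).2,
    (log_barW hlam hg).2, hS, hE, hDk, norm_mul, norm_mul]
  have h1 := norm_ne_zero_iff.2 hH0
  have h2 := norm_ne_zero_iff.2 hk
  field_simp
  ring

end

end

end NaeSat

namespace NaeSat

noncomputable section

variable {n d : ℕ} {lam : ℝ}

/-! ### Monotonicity of the complexity function -/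

lemma hasDerivAt_two_cpow (z : ℂ) : HasDerivAt (fun y : ℂ => (2 : ℂ) ^ y) (2 ^ z * Real.log 2) z := by
  refine ((hasDerivAt_id z).const_cpow (c := 2) (Or.inl two_ne_zero)).congr_deriv ?_
  rw [mul_one, id, Complex.ofReal_log (by norm_num), Complex.ofReal_ofNat]

lemma hasDerivAt_Fmain (n d : ℕ) (z : ℂ) :
    HasDerivAt (Fmain n d) ((hh n / 4 * Real.log 2 : ℝ) * 2 ^ z) z := by
  have h := (((hasDerivAt_two_cpow z).sub_const 2).const_mul ((hh n / 4 : ℝ) : ℂ)).const_add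
    ((Real.log 2 + d / (n + 1) * Real.log (1 - hh n) : ℝ) : ℂ)
  refine h.congr_deriv ?_
  push_cast
  ring

/-- The error of the approximation of the free energy. -/
def epsF (n : ℕ) : ℝ := 3 * 10 ^ 6 * (n ^ 3 * hh n ^ 2)

lemma ball_subset_strip (hlam : lam ∈ Icc (0 : ℝ) 1) :
    Metric.closedBall (lam : ℂ) (1 / 4) ⊆ strip := by
  intro z hz
  have h := (Complex.abs_re_le_norm (z - lam)).trans (mem_closedBall_iff_norm.1 hz)
  rw [Complex.sub_re, Complex.ofReal_re, abs_le] at h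
  constructor <;> linarith [hlam.1, hlam.2]

section

variable (hg : Good n d)
include hg

lemma differentiableOn_Fc : DifferentiableOn ℂ (fun y => Fc n d y (fixp n d y)) strip := fun _ hz =>
  (hasDerivAt_Fc hz hg).differentiableAt.differentiableWithinAt

/-- Cauchy's estimate on the circle of radius 1/4 about λ, which lies in the strip, applied to the
uniform bound `Fc_approx`. -/
lemma norm_iteratedDeriv_Fc_sub_le (hlam : lam ∈ Icc (0 : ℝ) 1) (j : ℕ) :
    ‖iteratedDeriv j (fun y => Fc n d y (fixp n d y) - Fmain n d y) lam‖
      ≤ j.factorial * epsF n / (1 / 4) ^ j := by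
  refine Complex.norm_iteratedDeriv_le_of_forall_mem_sphere_norm_le j (by norm_num) ?_ fun z hz => ?_
  · refine DifferentiableOn.diffContOnCl_ball (U := strip) ?_ (ball_subset_strip hlam)
    exact (differentiableOn_Fc hg).sub fun z _ =>
      (hasDerivAt_Fmain n d z).differentiableAt.differentiableWithinAt
  · have hz' := ball_subset_strip hlam (Metric.sphere_subset_closedBall hz)
    exact Fc_approx hz' hg (symm_fixp hz' hg) (norm_fixp_le hz' hg)

lemma norm_Sc_sub_le (hlam : lam ∈ Icc (0 : ℝ) 1) :
    ‖Sc n d lam (fixp n d lam) - (hh n / 4 * Real.log 2 : ℝ) * 2 ^ (lam : ℂ)‖ ≤ 4 * epsF n := by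
  have h := norm_iteratedDeriv_Fc_sub_le hg hlam 1
  have hd := (hasDerivAt_Fc (ofReal_mem_strip hlam) hg).fun_sub (hasDerivAt_Fmain n d lam)
  rw [iteratedDeriv_one, HasDerivAt.deriv hd] at h
  refine h.trans (le_of_eq ?_)
  norm_num
  ring

/-- The second derivative of the free energy. -/
lemma exists_hasDerivAt_Sc (hlam : lam ∈ Icc (0 : ℝ) 1) :
    ∃ D : ℂ, HasDerivAt (fun y => Sc n d y (fixp n d y)) D lam ∧
      ‖D - (hh n / 4 * Real.log 2 ^ 2 : ℝ) * 2 ^ (lam : ℂ)‖ ≤ 32 * epsF n := by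
  have hz := ofReal_mem_strip hlam
  have ho : strip ∈ 𝓝 (lam : ℂ) := isOpen_strip.mem_nhds hz
  have he : (fun y => Sc n d y (fixp n d y)) =ᶠ[𝓝 (lam : ℂ)] deriv fun y => Fc n d y (fixp n d y) := by
    filter_upwards [ho] with y hy
    exact (hasDerivAt_Fc hy hg).deriv.symm
  have hD : DifferentiableAt ℂ (fun y => Sc n d y (fixp n d y)) lam :=
    (((differentiableOn_Fc hg).deriv isOpen_strip).differentiableAt ho).congr_of_eventuallyEq he
  refine ⟨_, hD.hasDerivAt, ?_⟩
  have h := norm_iteratedDeriv_Fc_sub_le hg hlam 2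
  have hm : HasDerivAt (fun y : ℂ => ((hh n / 4 * Real.log 2 : ℝ) : ℂ) * 2 ^ y)
      ((hh n / 4 * Real.log 2 ^ 2 : ℝ) * 2 ^ (lam : ℂ)) lam := by
    refine ((hasDerivAt_two_cpow (lam : ℂ)).const_mul
      ((hh n / 4 * Real.log 2 : ℝ) : ℂ)).congr_deriv ?_
    push_cast
    ring
  have he2 : deriv (fun y => Fc n d y (fixp n d y) - Fmain n d y) =ᶠ[𝓝 (lam : ℂ)]
      (fun y => Sc n d y (fixp n d y)) - fun y : ℂ => ((hh n / 4 * Real.log 2 : ℝ) : ℂ) * 2 ^ y := by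
    filter_upwards [ho] with y hy
    exact ((hasDerivAt_Fc hy hg).sub (hasDerivAt_Fmain n d y)).deriv
  rw [iteratedDeriv_succ, iteratedDeriv_one, he2.deriv_eq, (hD.hasDerivAt.sub hm).deriv] at h
  refine h.trans (le_of_eq ?_)
  norm_num [Nat.factorial]
  ring

/-- This comparison requires n⁴h to be small in the definition of `Good`: the error, even multiplied
by n, must stay below the main term of order h. -/
lemma Good.epsF_le : epsF n * n ≤ hh n / 3000 := by
  have h1 := hg.small
  have h0 := hh_pos n
  have : epsF n * n = 3 / 10 ^ 4 * (hh n * (10 ^ 10 * n ^ 4 * hh n)) := by rw [epsF]; ring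
  rw [this]
  nlinarith

lemma Good.epsF_le' : epsF n ≤ hh n / 9000 := by
  have h1 := hg.epsF_le
  have h2 := hg.n_ge
  have h3 : 0 ≤ epsF n := by unfold epsF; positivity
  nlinarith

end

lemma two_cpow_ofReal (x : ℝ) : (2 : ℂ) ^ (x : ℂ) = ((2 ^ x : ℝ) : ℂ) := by
  rw [Complex.ofReal_cpow (by norm_num), Complex.ofReal_ofNat]

section

variable (hg : Good n d)
include hg

lemma hasDerivAt_re_Fc (hlam : lam ∈ Icc (0 : ℝ) 1) :
    HasDerivAt (fun x : ℝ => (Fc n d x (fixp n d x)).re) (Sc n d lam (fixp n d lam)).re lam :=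
  (hasDerivAt_Fc (ofReal_mem_strip hlam) hg).real_of_complex

/-- The second derivative of the main term is (h/4)(log 2)² 2^λ ≥ h/12, against an error of at most
32h/9000. -/
lemma exists_hasDerivAt_re_Sc (hlam : lam ∈ Icc (0 : ℝ) 1) :
    ∃ D > 0, HasDerivAt (fun x : ℝ => (Sc n d x (fixp n d x)).re) D lam := by
  obtain ⟨D, hD, h⟩ := exists_hasDerivAt_Sc hg hlam
  refine ⟨D.re, ?_, hD.real_of_complex⟩
  rw [two_cpow_ofReal, ← Complex.ofReal_mul] at h
  have h1 := (Complex.abs_re_le_norm _).trans h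
  rw [Complex.sub_re, Complex.ofReal_re, abs_le] at h1
  have h2 := hg.epsF_le'
  have h3 := hh_pos n
  have h4 : (1 : ℝ) ≤ 2 ^ lam := Real.one_le_rpow (by norm_num) hlam.1
  have h5 := Real.log_two_gt_d9
  have h6 : (1 : ℝ) / 3 ≤ Real.log 2 ^ 2 := by nlinarith
  have h7 : hh n / 12 ≤ hh n / 4 * Real.log 2 ^ 2 := by nlinarith
  have h8 : hh n / 12 ≤ hh n / 4 * Real.log 2 ^ 2 * 2 ^ lam := by nlinarith
  linarith [h1.1]

lemma strictMonoOn_sParam : StrictMonoOn (sParam (n + 1) d) (Icc 0 1) := by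
  have h : StrictMonoOn (fun x : ℝ => (Sc n d x (fixp n d x)).re) (Icc 0 1) := by
    refine strictMonoOn_of_deriv_pos (convex_Icc 0 1) (fun x hx => ?_) fun x hx => ?_
    · obtain ⟨D, -, hD⟩ := exists_hasDerivAt_re_Sc hg hx
      exact hD.continuousAt.continuousWithinAt
    · obtain ⟨D, h0, hD⟩ := exists_hasDerivAt_re_Sc hg (interior_subset hx)
      rwa [hD.deriv]
  exact h.congr fun x hx => (sParam_eq hx hg).symm

lemma continuousOn_sParam : ContinuousOn (sParam (n + 1) d) (Icc 0 1) := by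
  refine ContinuousOn.congr (f := fun x : ℝ => (Sc n d x (fixp n d x)).re) (fun x hx => ?_)
    fun x hx => sParam_eq hx hg
  obtain ⟨D, -, hD⟩ := exists_hasDerivAt_re_Sc hg hx
  exact hD.continuousAt.continuousWithinAt

lemma continuousOn_bigF : ContinuousOn (bigF (n + 1) d) (Icc 0 1) :=
  ContinuousOn.congr (f := fun x : ℝ => (Fc n d x (fixp n d x)).re)
    (fun _ hx => (hasDerivAt_re_Fc hg hx).continuousAt.continuousWithinAt)
    fun _ hx => bigF_eq hx hg

lemma continuousOn_bigF_sub :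
    ContinuousOn (fun x => bigF (n + 1) d x - x * sParam (n + 1) d x) (Icc 0 1) :=
  (continuousOn_bigF hg).sub (continuousOn_id.mul (continuousOn_sParam hg))

/-- As 𝔉' = s, the derivative of 𝔉 - λ s is -λ s', which is negative in the interior. -/
lemma strictAntiOn_bigF_sub :
    StrictAntiOn (fun x => bigF (n + 1) d x - x * sParam (n + 1) d x) (Icc 0 1) := by
  have h : StrictAntiOn (fun x : ℝ => (Fc n d x (fixp n d x)).re - x * (Sc n d x (fixp n d x)).re)
      (Icc 0 1) := by
    refine strictAntiOn_of_deriv_neg (convex_Icc 0 1) (fun x hx => ?_) fun x hx => ?_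
    · obtain ⟨D, -, hD⟩ := exists_hasDerivAt_re_Sc hg hx
      exact ((hasDerivAt_re_Fc hg hx).sub
        ((hasDerivAt_id x).mul hD)).continuousAt.continuousWithinAt
    · obtain ⟨D, h0, hD⟩ := exists_hasDerivAt_re_Sc hg (interior_subset hx)
      have h1 := (hasDerivAt_re_Fc hg (interior_subset hx)).fun_sub ((hasDerivAt_id' x).fun_mul hD)
      rw [interior_Icc] at hx
      have h2 : deriv (fun x : ℝ => (Fc n d x (fixp n d x)).re - x * (Sc n d x (fixp n d x)).re) x
          = -(x * D) := by
        rw [HasDerivAt.deriv h1]; ring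
      rw [h2]
      exact neg_neg_of_pos (mul_pos hx.1 h0)
  refine h.congr fun x hx => ?_
  rw [sParam_eq hx hg, bigF_eq hx hg]

/-- Strict monotonicity makes λ ↦ s_λ injective, so the chosen parameter is the given one. -/
lemma complexity_sParam (hlam : lam ∈ Icc (0 : ℝ) 1) :
    complexity (n + 1) d (sParam (n + 1) d lam)
      = bigF (n + 1) d lam - lam * sParam (n + 1) d lam := by
  have h := Classical.epsilon_spec (p := fun t : ℝ =>
    t ∈ Icc (0 : ℝ) 1 ∧ sParam (n + 1) d t = sParam (n + 1) d lam) ⟨lam, hlam, rfl⟩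
  rw [complexity, (strictMonoOn_sParam hg).injOn h.1 hlam h.2]

lemma strictAntiOn_complexity : StrictAntiOn (complexity (n + 1) d) (sDomain (n + 1) d) := by
  rintro _ ⟨a, ha, rfl⟩ _ ⟨b, hb, rfl⟩ hab
  rw [complexity_sParam hg ha, complexity_sParam hg hb]
  exact strictAntiOn_bigF_sub hg ha hb (((strictMonoOn_sParam hg).lt_iff_lt ha hb).1 hab)

/-- The map λ ↦ s_λ from the compact interval onto the domain is a quotient map, so continuity can
be tested after composing with it. -/
lemma continuousOn_complexity : ContinuousOn (complexity (n + 1) d) (sDomain (n + 1) d) := by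
  rw [continuousOn_iff_continuous_domRestrict]
  set φ : Icc (0 : ℝ) 1 → sDomain (n + 1) d := fun x => ⟨sParam (n + 1) d x, x, x.2, rfl⟩
  have hφ : Continuous φ := (continuousOn_iff_continuous_domRestrict.1 (continuousOn_sParam hg)).subtype_mk _
  have hs : Function.Surjective φ := by
    rintro ⟨_, x, hx, rfl⟩
    exact ⟨⟨x, hx⟩, rfl⟩
  rw [(hφ.isClosedMap.isQuotientMap hφ hs).continuous_iff]
  have h := continuousOn_iff_continuous_domRestrict.1 (continuousOn_bigF_sub hg)
  refine h.congr fun x => ?_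
  exact (complexity_sParam hg x.2).symm

lemma bddAbove_sDomain : BddAbove (sDomain (n + 1) d) :=
  (isCompact_Icc.image_of_continuousOn (continuousOn_sParam hg)).bddAbove

end

end

end NaeSat

namespace NaeSat

noncomputable section

variable {n d : ℕ} {lam : ℝ}

/-! ### The thresholds -/

/-- The replica symmetric part of the free energy. -/
def rsF (n d : ℕ) : ℝ := Real.log 2 + d / (n + 1) * Real.log (1 - hh n)

section

variable (hg : Good n d)
include hg

lemma abs_bigF_sub_le (hlam : lam ∈ Icc (0 : ℝ) 1) :
    |bigF (n + 1) d lam - (rsF n d + hh n / 4 * (2 ^ lam - 2))| ≤ epsF n := by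
  have hz := ofReal_mem_strip hlam
  have h := (Complex.abs_re_le_norm _).trans
    (Fc_approx hz hg (symm_fixp hz hg) (norm_fixp_le hz hg))
  have e : (Fmain n d lam).re = rsF n d + hh n / 4 * (2 ^ lam - 2) := by
    rw [Fmain, two_cpow_ofReal, Complex.add_re, Complex.ofReal_re, Complex.re_ofReal_mul,
      Complex.sub_re, Complex.ofReal_re, Complex.re_ofNat, rsF]
  rwa [Complex.sub_re, ← bigF_eq hlam hg, e] at h

lemma sParam_one_le : sParam (n + 1) d 1 ≤ hh n / 2 * Real.log 2 + 4 * epsF n := by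
  have h1 : (1 : ℝ) ∈ Icc (0 : ℝ) 1 := by simp
  have h := (Complex.abs_re_le_norm _).trans (norm_Sc_sub_le hg h1)
  rw [two_cpow_ofReal, ← Complex.ofReal_mul, Complex.sub_re, Complex.ofReal_re, ← sParam_eq h1 hg,
    Real.rpow_one] at h
  linarith [(abs_le.1 h).2]

lemma complexity_one : complexity (n + 1) d (sParam (n + 1) d 1)
    = bigF (n + 1) d 1 - sParam (n + 1) d 1 := by
  rw [complexity_sParam hg (by simp), one_mul]

lemma complexity_zero : complexity (n + 1) d (sParam (n + 1) d 0) = bigF (n + 1) d 0 := by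
  rw [complexity_sParam hg (by simp), zero_mul, sub_zero]

lemma complexity_one_lt_zero : complexity (n + 1) d (sParam (n + 1) d 1)
    < complexity (n + 1) d (sParam (n + 1) d 0) := by
  have h := strictAntiOn_bigF_sub hg (a := 0) (b := 1) (by simp) (by simp) one_pos
  simpa only [complexity_sParam hg (lam := 0) (by simp),
    complexity_sParam hg (lam := 1) (by simp)] using h

lemma Good.neg_log_ge : hh n ≤ -Real.log (1 - hh n) := by
  have := Real.log_le_sub_one_of_pos (x := 1 - hh n) (by linarith [hg.h_le])
  linarith

lemma Good.neg_log_le : -Real.log (1 - hh n) ≤ hh n + hh n ^ 2 / 2 + 2 * hh n ^ 3 := by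
  have h0 := hh_pos n
  have h1 := hg.h_le
  have h := Real.abs_log_sub_add_sum_range_le (x := hh n) (by rw [abs_of_pos h0]; linarith) 2
  rw [Finset.sum_range_succ, Finset.sum_range_one, abs_of_pos h0] at h
  norm_num at h
  have h2 := (abs_le.1 h).1
  have h3 : hh n ^ 3 / (1 - hh n) ≤ 2 * hh n ^ 3 := by
    rw [div_le_iff₀ (by linarith)]
    nlinarith [pow_pos h0 3]
  linarith

end

/-- The complexity at `lam = 0` is decreasing in the density. -/
lemma bigF_zero_lt {d' : ℕ} (hg : Good n d) (hg' : Good n d') (h : d < d') :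
    bigF (n + 1) d' 0 < bigF (n + 1) d 0 := by
  have h1 := (abs_le.1 (abs_bigF_sub_le hg (lam := 0) (by simp))).1
  have h2 := (abs_le.1 (abs_bigF_sub_le hg' (lam := 0) (by simp))).2
  -- One further unit of d costs -log(1 - h)/(n+1) ≥ h/(n+1), more than the two approximation errors
  -- together.
  have h3 : rsF n d' + hh n / (n + 1) ≤ rsF n d := by
    have hd : (d : ℝ) + 1 ≤ d' := by exact_mod_cast h
    have hl := hg.neg_log_ge
    have h0 := hh_pos n
    have e : rsF n d - (rsF n d' + hh n / (n + 1))
      = ((d' - d) * (-Real.log (1 - hh n)) - hh n) / (n + 1) := by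
      rw [rsF, rsF]; ring
    have : 0 ≤ ((d' - d) * (-Real.log (1 - hh n)) - hh n) / ((n : ℝ) + 1) := by
      apply div_nonneg _ (by positivity)
      nlinarith
    linarith
  have h4 := hg.epsF_le
  have h5 : 3 * epsF n ≤ hh n / (n + 1) := by
    have := hg.n_ge
    have h0 := hh_pos n
    rw [le_div_iff₀ (by positivity)]
    nlinarith [hg.epsF_le']
  have h6 : 0 < epsF n := by
    have := hg.n_ge
    have h0 := hh_pos n
    unfold epsF
    positivity
  linarith

lemma two_pow_mul_hh (n : ℕ) : (2 : ℝ) ^ n * hh n = 1 := by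
  rw [hh, ← mul_pow]; norm_num

lemma good_of_inRange (hs : 10 ^ 10 * (n : ℝ) ^ 4 * hh n ≤ 1) (h3 : 3 ≤ n)
    (h : InRange (n + 1) d) : Good n d := by
  obtain ⟨h1, h2⟩ := h
  have h0 := hh_pos n
  have e := two_pow_mul_hh n
  have hn : (0 : ℝ) < n + 1 := by positivity
  have hl := Real.log_pos one_lt_two
  rw [density_succ, alphaLbd, Nat.add_sub_cancel, le_div_iff₀ hn] at h1
  rw [density_succ, alphaUbd, Nat.add_sub_cancel, div_le_iff₀ hn] at h2
  refine ⟨hs, h3, ?_, ?_, ?_⟩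
  · have h8 : (2 : ℝ) ^ 3 ≤ 2 ^ n := pow_le_pow_right₀ (by norm_num) h3
    have : (0 : ℝ) < d := lt_of_lt_of_le (mul_pos (mul_pos (by linarith) hl) hn) h1
    exact_mod_cast this
  · calc d * hh n ≤ (2 ^ n * Real.log 2 * (n + 1)) * hh n := by gcongr
      _ = (2 ^ n * hh n) * ((n + 1) * Real.log 2) := by ring
      _ = _ := by rw [e, one_mul]
  · calc (n + 1) * Real.log 2 * (1 - 2 * hh n)
        = (n + 1) * Real.log 2 * (2 ^ n * hh n - 2 * hh n) := by rw [e]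
      _ = ((2 ^ n - 2) * Real.log 2 * (n + 1)) * hh n := by ring
      _ ≤ _ := by gcongr

/-- Near the lower end of the range the complexity at `lam = 1` is positive. -/
lemma complexity_one_pos (hg : Good n d) (hn : 20 ≤ n)
    (hd : (d : ℝ) / (n + 1) ≤ (2 ^ n - 2) * Real.log 2 + 1 / (n + 1)) :
    0 < complexity (n + 1) d (sParam (n + 1) d 1) := by
  -- At λ = 1 the correction (h/4)(2^λ - 2) vanishes. Near the lower end α(-log(1 - h)) is about log
  -- 2 - 2h log 2 + (h/2) log 2, up to h/20 from the rounding, and s_1 takes away another (h/2) log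
  -- 2. About h log 2 - h/20 > 0 is left.
  rw [complexity_one hg]
  have h1 := sParam_one_le hg
  have h2 := (abs_le.1 (abs_bigF_sub_le hg (lam := 1) (by simp))).1
  rw [Real.rpow_one, sub_self, mul_zero, add_zero] at h2
  have h3 := hg.epsF_le'
  have h0 := hh_pos n
  have hh1 := hg.h_le
  have h4 := hg.neg_log_le
  have e := two_pow_mul_hh n
  have hl := Real.log_two_gt_d9
  have hl' := Real.log_two_lt_d9
  have hn1 : (1 : ℝ) / (n + 1) ≤ 1 / 20 := by
    have : (20 : ℝ) ≤ n := by exact_mod_cast hn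
    apply one_div_le_one_div_of_le <;> linarith
  have h8 : (2 : ℝ) ^ 3 ≤ 2 ^ n := pow_le_pow_right₀ (by norm_num) (by omega)
  have h5 : (d : ℝ) / (n + 1) * -Real.log (1 - hh n)
      ≤ ((2 ^ n - 2) * Real.log 2 + 1 / 20) * (hh n + hh n ^ 2 / 2 + 2 * hh n ^ 3) := by
    have := hg.neg_log_ge
    have hL : 0 ≤ Real.log 2 := by linarith
    refine mul_le_mul (by linarith) h4 (by linarith) ?_
    have : 0 ≤ (2 ^ n - 2) * Real.log 2 := mul_nonneg (by linarith) hL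
    linarith
  have h6 : ((2 ^ n - 2) * Real.log 2 + 1 / 20) * (hh n + hh n ^ 2 / 2 + 2 * hh n ^ 3)
      = Real.log 2 * (2 ^ n * hh n) * (1 + hh n / 2 + 2 * hh n ^ 2)
        + (1 / 20 - 2 * Real.log 2) * (hh n + hh n ^ 2 / 2 + 2 * hh n ^ 3) := by ring
  rw [h6, e] at h5
  have h7 : (1 / 20 - 2 * Real.log 2) * (hh n + hh n ^ 2 / 2 + 2 * hh n ^ 3)
      ≤ (1 / 20 - 2 * Real.log 2) * hh n := by
    apply mul_le_mul_of_nonpos_left _ (by linarith)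
    nlinarith [pow_pos h0 3]
  have h9 : hh n ^ 2 ≤ hh n / 1000 := by nlinarith
  have h10 : Real.log 2 * (1 + hh n / 2 + 2 * hh n ^ 2) ≤ Real.log 2 + hh n * (51 / 100) * Real.log 2 := by
    nlinarith
  have h11 : rsF n d = Real.log 2 - (d : ℝ) / (n + 1) * -Real.log (1 - hh n) := by rw [rsF]; ring
  nlinarith

end

end NaeSat

namespace NaeSat

noncomputable section

variable {n d : ℕ}

/-! ### The free energy -/

/-- The size condition on the clause length. -/
def Large (n : ℕ) : Prop := 10 ^ 10 * (n : ℝ) ^ 4 * hh n ≤ 1 ∧ 20 ≤ n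

lemma exists_large : ∃ k₀ : ℕ, ∀ k, k₀ ≤ k → ∃ n, k = n + 1 ∧ Large n := by
  have h := (tendsto_pow_const_mul_const_pow_of_abs_lt_one 4 (r := 1 / 2)
    (by rw [abs_of_pos] <;> norm_num)).const_mul (10 ^ 10)
  rw [mul_zero] at h
  obtain ⟨N, hN⟩ := eventually_atTop.1 ((h.eventually_le_const one_pos).and (eventually_ge_atTop 20))
  refine ⟨N + 1, fun k hk => ⟨k - 1, by omega, ?_⟩⟩
  obtain ⟨h1, h2⟩ := hN (k - 1) (by omega)
  exact ⟨by rw [hh, mul_assoc]; exact h1, h2⟩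

lemma bddAbove_posSet (k : ℕ) (lam : ℝ) : BddAbove (posSet k lam) := by
  refine ⟨alphaUbd k, ?_⟩
  rintro _ ⟨d, rfl, hr, -⟩
  exact hr.2

section

variable (hL : Large n)
include hL

lemma Large.good (h : InRange (n + 1) d) : Good n d := good_of_inRange hL.1 (by have := hL.2; omega) h

lemma posSet_one_nonempty : (posSet (n + 1) 1).Nonempty := by
  have h8 : (2 : ℝ) ^ 3 ≤ 2 ^ n := pow_le_pow_right₀ (by norm_num) (by have := hL.2; omega)
  have hl := Real.log_two_gt_d9
  have hn : (0 : ℝ) < n + 1 := by positivity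
  have h0 : 0 ≤ ((2 : ℝ) ^ n - 2) * Real.log 2 * (n + 1) :=
    mul_nonneg (mul_nonneg (by linarith) (by linarith)) hn.le
  -- The smallest degree in the range; rounding up moves α by less than 1/(n+1).
  set d := ⌈((2 : ℝ) ^ n - 2) * Real.log 2 * (n + 1)⌉₊
  have h1 : ((2 : ℝ) ^ n - 2) * Real.log 2 ≤ d / (n + 1) := (le_div_iff₀ hn).2 (Nat.le_ceil _)
  have h2 : (d : ℝ) / (n + 1) ≤ (2 ^ n - 2) * Real.log 2 + 1 / (n + 1) := by
    rw [div_le_iff₀ hn, add_mul, one_div_mul_cancel hn.ne']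
    exact (Nat.ceil_lt_add_one h0).le
  have hr : InRange (n + 1) d := by
    rw [InRange, density_succ, alphaLbd, alphaUbd, Nat.add_sub_cancel]
    refine ⟨h1, h2.trans ?_⟩
    have : (1 : ℝ) / (n + 1) ≤ 1 := by
      rw [div_le_one hn]; linarith [n.cast_nonneg (α := ℝ)]
    linarith
  exact ⟨_, d, rfl, hr, complexity_one_pos (hL.good hr) hL.2 h2⟩

lemma posSet_subset : posSet (n + 1) 1 ⊆ posSet (n + 1) 0 := by
  rintro _ ⟨d, rfl, hr, h⟩
  exact ⟨d, rfl, hr, h.trans (complexity_one_lt_zero (hL.good hr))⟩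

lemma isLUB_alphaCond : IsLUB (posSet (n + 1) 1) (alphaCond (n + 1)) :=
  isLUB_csSup (posSet_one_nonempty hL) (bddAbove_posSet _ _)

lemma isLUB_alphaSat : IsLUB (posSet (n + 1) 0) (alphaSat (n + 1)) :=
  isLUB_csSup ((posSet_one_nonempty hL).mono (posSet_subset hL)) (bddAbove_posSet _ _)

lemma alphaCond_le_alphaSat : alphaCond (n + 1) ≤ alphaSat (n + 1) :=
  csSup_le_csSup (bddAbove_posSet _ _) (posSet_one_nonempty hL) (posSet_subset hL)

/-- Below `alphaSat` the complexity at `lam = 0` is positive. -/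
lemma complexity_zero_pos (hr : InRange (n + 1) d) (h : density (n + 1) d < alphaSat (n + 1)) :
    0 < complexity (n + 1) d (sParam (n + 1) d 0) := by
  obtain ⟨_, ⟨d', rfl, hr', h'⟩, hd⟩ :=
    exists_lt_of_lt_csSup ((posSet_one_nonempty hL).mono (posSet_subset hL)) h
  have hg := hL.good hr
  have hg' := hL.good hr'
  rw [density_succ, density_succ, div_lt_div_iff_of_pos_right (by positivity), Nat.cast_lt] at hd
  rw [complexity_zero hg'] at h'
  rw [complexity_zero hg]
  exact h'.trans (bigF_zero_lt hg hg' hd)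

lemma exists_isLUB_nonneg (hr : InRange (n + 1) d) (h : density (n + 1) d < alphaSat (n + 1)) :
    ∃ t, IsLUB {s | s ∈ sDomain (n + 1) d ∧ 0 ≤ complexity (n + 1) d s} t :=
  ⟨_, isLUB_csSup ⟨_, ⟨0, by simp, rfl⟩, (complexity_zero_pos hL hr h).le⟩
    ((bddAbove_sDomain (hL.good hr)).mono fun _ hs => hs.1)⟩

/-- Since α_cond ≤ α_sat, exactly one of the three clauses applies. The point α_sat is excluded
because none applies there when α_cond < α_sat. -/
theorem existsUnique_isFreeEnergy (hr : InRange (n + 1) d)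
    (hne : density (n + 1) d ≠ alphaSat (n + 1)) : ∃! f : ℝ, IsFreeEnergy (n + 1) d f := by
  have hcs := alphaCond_le_alphaSat hL
  rcases le_or_gt (density (n + 1) d) (alphaCond (n + 1)) with hc | hc
  · exact ⟨_, ⟨fun _ => rfl, fun h => absurd hc h.not_ge,
      fun h => absurd (hc.trans hcs) h.not_ge⟩, fun f hf => hf.1 hc⟩
  rcases hne.lt_or_gt with hs | hs
  · obtain ⟨t, ht⟩ := exists_isLUB_nonneg hL hr hs
    refine ⟨Real.exp t, ⟨fun h => absurd hc h.not_gt, fun _ _ => ⟨t, ht, rfl⟩,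
      fun h => absurd hs h.not_gt⟩, fun f hf => ?_⟩
    obtain ⟨t', ht', rfl⟩ := hf.2.1 hc hs
    rw [ht'.unique ht]
  · exact ⟨0, ⟨fun h => absurd hc h.not_gt, fun _ h => absurd hs h.not_gt, fun _ => rfl⟩,
      fun f hf => hf.2.2 hs⟩

end

end

end NaeSat

theorem propositionp :
    ∃ k₀ : ℕ, ∀ k : ℕ, k₀ ≤ k →
      (∀ d : ℕ, NaeSat.InRange k d →
        (∀ lam ∈ Set.Icc (0 : ℝ) 1, NaeSat.ParamsDefined k d lam) ∧
        (∀ lam ∈ Set.Icc (0 : ℝ) 1,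
          NaeSat.complexity k d (NaeSat.sParam k d lam) =
            NaeSat.bigF k d lam - lam * NaeSat.sParam k d lam) ∧
        ContinuousOn (NaeSat.complexity k d) (NaeSat.sDomain k d) ∧
        StrictAntiOn (NaeSat.complexity k d) (NaeSat.sDomain k d)) ∧
      IsLUB (NaeSat.posSet k 1) (NaeSat.alphaCond k) ∧
      IsLUB (NaeSat.posSet k 0) (NaeSat.alphaSat k) ∧
      (∀ d : ℕ, NaeSat.InRange k d → NaeSat.density k d ≠ NaeSat.alphaSat k →
        ∃! f : ℝ, NaeSat.IsFreeEnergy k d f) := by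
  obtain ⟨k₀, h⟩ := NaeSat.exists_large
  refine ⟨k₀, fun k hk => ?_⟩
  obtain ⟨n, rfl, hL⟩ := h k hk
  refine ⟨fun d hr => ?_, NaeSat.isLUB_alphaCond hL, NaeSat.isLUB_alphaSat hL,
    fun d hr hne => NaeSat.existsUnique_isFreeEnergy hL hr hne⟩
  have hg := hL.good hr
  exact ⟨fun lam hlam => NaeSat.paramsDefined hlam hg,
    fun lam hlam => NaeSat.complexity_sParam hg hlam,
    NaeSat.continuousOn_complexity hg, NaeSat.strictAntiOn_complexity hg⟩
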